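/- Let $(M,g)$ be a smooth, four-dimensional, oriented Lorentzian manifold of signature $(-,+,+,+)$ with vanishing Ricci curvature, let $D$ be its Levi-Civita connection, $\in_{\alpha\beta\mu\nu}$ its volume form, and let $T$ be a smooth Killing vector field. The Hodge dual on a pair of indices is ${}^*A_{\alpha\beta}=\tfrac12\in_{\alpha\beta}{}^{\mu\nu}A_{\mu\nu}$, and the Riemann tensor $R$ has the sign for which $D_\mu D_\alpha T_\beta=R_{\lambda\mu\alpha\beta}T^\lambda$. Put $$F_{\alpha\beta}=D_\alpha T_\beta,\qquad \mathcal F=F+i\,{}^*F,\qquad \mathcal F^2=\mathcal F_{\alpha\beta}\mathcal F^{\alpha\beta},\qquad \sigma_\mu=2T^\alpha\mathcal F_{\alpha\mu},$$ $$\mathcal R_{\alpha\beta\mu\nu}=R_{\alpha\beta\mu\nu}+i\,({}^*R)_{\alpha\beta\mu\nu},\qquad {}^*R_{\alpha\beta\mu\nu}=\tfrac12\in_{\alpha\beta}{}^{\rho\sigma}R_{\rho\sigma\mu\nu},$$ $$\mathcal I_{\alpha\beta\mu\nu}=\tfrac14\big(g_{\alpha\mu}g_{\beta\nu}-g_{\alpha\nu}g_{\beta\mu}+i\in_{\alpha\beta\mu\nu}\big),\qquad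 \mathcal Q_{\alpha\beta\mu\nu}=\mathcal F_{\alpha\beta}\mathcal F_{\mu\nu}-\tfrac13\mathcal F^2\,\mathcal I_{\alpha\beta\mu\nu}.$$ Let $U\subseteq M$ be an open set on which $\mathcal F^2\neq0$ and on which a continuous branch of $(-\mathcal F^2)^{1/4}$ is given, let $C\neq0$ be a complex constant, and set on $U$ $$h=C(-\mathcal F^2)^{1/4},\qquad \mathcal S_{\alpha\beta\mu\nu}=\mathcal R_{\alpha\beta\mu\nu}+6h^{-1}\mathcal Q_{\alpha\beta\mu\nu},\qquad \mathcal H_{\alpha\beta}=h^{-3}\mathcal S_{\alpha\beta\mu\nu}\mathcal F^{\mu\nu}.$$ Then on $U$ the function $h$ and the tensor $\mathcal H$ are differentiable, $\mathcal H$ is a complex $2$-form which is self-dual, ${}^*\mathcal H=-i\mathcal H$, and it satisfies the Maxwell-type equation $$D^\alpha\mathcal H_{\alpha\beta}=-h^{-3}\,T^\sigma(\mathcal S\cdot\mathcal S)_{\sigma\beta}-3h^{-1}E^\rho\mathcal H_{\rho\beta},$$ where $(\mathcal S\cdot\mathcal S)_{\sigma\beta}=\mathcal S_\beta{}^{\rho\mu\nu}\mathcal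 S_{\sigma\rho\mu\nu}$ and $$E_\rho:=\sigma_\rho+D_\rho h=-\tfrac12C^4\,T^\sigma\mathcal H_{\sigma\rho}.$$ In particular the right-hand side of the equation is quadratic in $\mathcal S$: it equals $$-h^{-3}\,T^\sigma(\mathcal S\cdot\mathcal S)_{\sigma\beta}+\tfrac32C^4h^{-7}\,T^\sigma\big(\mathcal S_{\sigma}{}^{\rho}{}_{\mu\nu}\mathcal F^{\mu\nu}\big)\big(\mathcal S_{\rho\beta\gamma\delta}\mathcal F^{\gamma\delta}\big).$$ -/

import Mathlib

open scoped Manifold ContDiff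

noncomputable section

namespace MarsSimon

/-- The model space `ℝ⁴`. -/
abbrev E4 : Type := EuclideanSpace ℝ (Fin 4)

/-! ### Oriented Lorentzian four-manifolds -/

section Manifold

variable {M : Type*} [TopologicalSpace M] [ChartedSpace E4 M] [IsManifold (𝓡 4) ∞ M]

variable (M) in
/-- A smooth Lorentzian metric, of signature `(-,+,+,+)`, on a four-dimensional manifold. -/
structure LorentzMetric where
  inner : ∀ x : M, TangentSpace (𝓡 4) x →L[ℝ] TangentSpace (𝓡 4) x →L[ℝ] ℝ
  symm : ∀ (x : M) (v w : TangentSpace (𝓡 4) x), inner x v w = inner x w v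
  signature : ∀ x : M, ∃ b : Module.Basis (Fin 4) ℝ (TangentSpace (𝓡 4) x),
    ∀ i j, inner x (b i) (b j) = if i = j then (if i = 0 then -1 else 1) else 0
  contMDiff : ContMDiff (𝓡 4) ((𝓡 4).prod 𝓘(ℝ, E4 →L[ℝ] E4 →L[ℝ] ℝ)) ∞
    (fun x => Bundle.TotalSpace.mk' (E4 →L[ℝ] E4 →L[ℝ] ℝ)
      (E := fun x : M => TangentSpace (𝓡 4) x →L[ℝ] TangentSpace (𝓡 4) x →L[ℝ] ℝ)
      x (inner x))

/-- The coordinate frame `∂₀, …, ∂₃` of the chart `e` at the point with coordinates `y`. -/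
def chartFrame (e : OpenPartialHomeomorph M E4) (y : E4) (i : Fin 4) :
    TangentSpace (𝓡 4) (e.symm y) :=
  mfderiv (𝓡 4) (𝓡 4) e.symm y (EuclideanSpace.single i (1 : ℝ))

/-- A metric volume form `ε`, i.e. the volume form of the Lorentzian metric `g` with respect to
an orientation: a continuous (hence smooth) `4`-form of unit length, that is, equal to `±1` on
every `g`-orthonormal frame. -/
structure VolumeForm (g : LorentzMetric M) where
  form : ∀ x : M, (TangentSpace (𝓡 4) x) [⋀^Fin 4]→ₗ[ℝ] ℝ
  sq_eq : ∀ (x : M) (v : Fin 4 → TangentSpace (𝓡 4) x),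
    form x v ^ 2 = -(Matrix.of fun i j => g.inner x (v i) (v j)).det
  continuousOn : ∀ e ∈ IsManifold.maximalAtlas (𝓡 4) ∞ M,
    ContinuousOn (fun y => form (e.symm y) (chartFrame e y)) e.target

/-- The components `g_{ij}` of the metric in the chart `e`. -/
def metricComp (g : LorentzMetric M) (e : OpenPartialHomeomorph M E4) (y : E4) :
    Matrix (Fin 4) (Fin 4) ℝ :=
  Matrix.of fun i j => g.inner (e.symm y) (chartFrame e y i) (chartFrame e y j)

/-- The components `ε_{abcd}` of the volume form in the chart `e`. -/
def volComp {g : LorentzMetric M} (ε : VolumeForm g) (e : OpenPartialHomeomorph M E4)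
    (a b c d : Fin 4) (y : E4) : ℝ :=
  ε.form (e.symm y) (fun i => chartFrame e y (![a, b, c, d] i))

/-- The components `T_i = g(T, ∂_i)` of (the covector dual to) the vector field `T`
in the chart `e`. -/
def lowerComp (g : LorentzMetric M) (T : ∀ x : M, TangentSpace (𝓡 4) x)
    (e : OpenPartialHomeomorph M E4) (i : Fin 4) (y : E4) : ℝ :=
  g.inner (e.symm y) (T (e.symm y)) (chartFrame e y i)

end Manifold

/-! ### Tensor calculus in a coordinate system

`G` stands for the components of the metric, `ε` for those of the volume form and `T` for the
covariant components of a vector field.  Components of a tensor field carry their indices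
first; unless otherwise said all indices are lower indices. -/

/-- The partial derivative `∂_i f`. -/
def pderiv {V : Type*} [NormedAddCommGroup V] [NormedSpace ℝ V] (i : Fin 4) (f : E4 → V)
    (y : E4) : V :=
  fderiv ℝ f y (EuclideanSpace.single i (1 : ℝ))

section Coordinates

variable (G : E4 → Matrix (Fin 4) (Fin 4) ℝ)
  (ε : Fin 4 → Fin 4 → Fin 4 → Fin 4 → E4 → ℝ)
  (T : Fin 4 → E4 → ℝ)

/-- The Christoffel symbols `Γᵏ_{ij}` of the Levi-Civita connection. -/
def christoffel (k i j : Fin 4) (y : E4) : ℝ :=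
  (1 / 2) * ∑ l, (G y)⁻¹ k l *
    (pderiv i (fun z => G z j l) y + pderiv j (fun z => G z i l) y - pderiv l (fun z => G z i j) y)

/-- The curvature `Rᵃ_{bcd} = ∂_c Γᵃ_{db} - ∂_d Γᵃ_{cb} + Γᵃ_{ce} Γᵉ_{db} - Γᵃ_{de} Γᵉ_{cb}`. -/
def riemannUp (a b c d : Fin 4) (y : E4) : ℝ :=
  pderiv c (christoffel G a d b) y - pderiv d (christoffel G a c b) y
    + ∑ e, (christoffel G a c e y * christoffel G e d b y
      - christoffel G a d e y * christoffel G e c b y)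

/-- The curvature tensor `R_{abcd} = g_{ae} Rᵉ_{bcd}`. -/
def riemann (a b c d : Fin 4) (y : E4) : ℝ := ∑ e, G y a e * riemannUp G e b c d y

/-- The Ricci tensor `Ric_{bd} = Rᵃ_{bad}`. -/
def ricci (b d : Fin 4) (y : E4) : ℝ := ∑ a, riemannUp G a b a d y

/-- The covariant derivative `D_i θ_j` of a covector field. -/
def covDeriv₁ (θ : Fin 4 → E4 → ℝ) (i j : Fin 4) (y : E4) : ℝ :=
  pderiv i (θ j) y - ∑ k, christoffel G k i j y * θ k y

/-- The covariant derivative `D_c A_{ab}` of a complex covariant `2`-tensor field. -/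
def covDeriv₂ (A : Fin 4 → Fin 4 → E4 → ℂ) (c a b : Fin 4) (y : E4) : ℂ :=
  pderiv c (A a b) y - ∑ k, ((christoffel G k c a y : ℂ) * A k b y
    + (christoffel G k c b y : ℂ) * A a k y)

/-- The inverse metric `g^{ij}`, as complex numbers. -/
def invMetric (i j : Fin 4) (y : E4) : ℂ := (((G y)⁻¹ i j : ℝ) : ℂ)

/-- The divergence `D^a A_{ab}` of a complex covariant `2`-tensor field. -/
def divergence (A : Fin 4 → Fin 4 → E4 → ℂ) (b : Fin 4) (y : E4) : ℂ :=
  ∑ a, ∑ c, invMetric G a c y * covDeriv₂ G A c a b y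

/-- `T^a = g^{ab} T_b`. -/
def upT (a : Fin 4) (y : E4) : ℂ := ∑ b, invMetric G a b y * (T b y : ℂ)

/-- `A^{mn}`, both indices raised. -/
def raise₂ (A : Fin 4 → Fin 4 → E4 → ℂ) (m n : Fin 4) (y : E4) : ℂ :=
  ∑ a, ∑ b, invMetric G m a y * invMetric G n b y * A a b y

/-- The Hodge dual `*A_{ab} = ½ ε_{ab}{}^{mn} A_{mn}`. -/
def hodge (A : Fin 4 → Fin 4 → E4 → ℂ) (a b : Fin 4) (y : E4) : ℂ :=
  (1 / 2) * ∑ m, ∑ n, (ε a b m n y : ℂ) * raise₂ G A m n y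

/-- The real `2`-form `F_{ab} = D_a T_b`, as complex numbers. -/
def twoF (a b : Fin 4) (y : E4) : ℂ := (covDeriv₁ G T a b y : ℂ)

/-- The complex self-dual `2`-form `𝓕 = F + i *F`. -/
def calF (a b : Fin 4) (y : E4) : ℂ :=
  twoF G T a b y + Complex.I * hodge G ε (twoF G T) a b y

/-- The scalar `𝓕² = 𝓕_{ab} 𝓕^{ab}`. -/
def calFsq (y : E4) : ℂ := ∑ a, ∑ b, calF G ε T a b y * raise₂ G (calF G ε T) a b y

/-- The Ernst `1`-form `σ_m = 2 T^a 𝓕_{am}`. -/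
def ernst (m : Fin 4) (y : E4) : ℂ := 2 * ∑ a, upT G T a y * calF G ε T a m y

/-- The complex self-dual curvature `𝓡 = R + i *R`, the dual being taken on the
first pair of indices. -/
def calR (a b c d : Fin 4) (y : E4) : ℂ :=
  (riemann G a b c d y : ℂ)
    + Complex.I * hodge G ε (fun m n z => (riemann G m n c d z : ℂ)) a b y

/-- `𝓘_{abcd} = (g_{ac} g_{bd} - g_{ad} g_{bc} + i ε_{abcd}) / 4`. -/
def calI (a b c d : Fin 4) (y : E4) : ℂ :=
  ((G y a c : ℂ) * (G y b d : ℂ) - (G y a d : ℂ) * (G y b c : ℂ)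
    + Complex.I * (ε a b c d y : ℂ)) / 4

/-- `𝓠_{abcd} = 𝓕_{ab} 𝓕_{cd} - ⅓ 𝓕² 𝓘_{abcd}`. -/
def calQ (a b c d : Fin 4) (y : E4) : ℂ :=
  calF G ε T a b y * calF G ε T c d y - (1 / 3) * calFsq G ε T y * calI G ε a b c d y

/-- The generalized Mars–Simon tensor `𝓢 = 𝓡 + 6 h⁻¹ 𝓠`. -/
def calS (h : E4 → ℂ) (a b c d : Fin 4) (y : E4) : ℂ :=
  calR G ε a b c d y + 6 * (h y)⁻¹ * calQ G ε T a b c d y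

/-- The contraction `𝓢_{abmn} 𝓕^{mn}`. -/
def calSF (h : E4 → ℂ) (a b : Fin 4) (y : E4) : ℂ :=
  ∑ m, ∑ n, calS G ε T h a b m n y * raise₂ G (calF G ε T) m n y

/-- The complex `2`-form `𝓗_{ab} = h⁻³ 𝓢_{abmn} 𝓕^{mn}`. -/
def calH (h : E4 → ℂ) (a b : Fin 4) (y : E4) : ℂ := (h y ^ 3)⁻¹ * calSF G ε T h a b y

/-- `(𝓢·𝓢)_{sb} = 𝓢_b{}^{rmn} 𝓢_{srmn}`. -/
def calSS (h : E4 → ℂ) (s b : Fin 4) (y : E4) : ℂ :=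
  ∑ r, ∑ m, ∑ n, ∑ r', ∑ m', ∑ n',
    invMetric G r r' y * invMetric G m m' y * invMetric G n n' y
      * calS G ε T h b r' m' n' y * calS G ε T h s r m n y

/-- The `1`-form `E_r = σ_r + D_r h`. -/
def formE (h : E4 → ℂ) (r : Fin 4) (y : E4) : ℂ := ernst G ε T r y + pderiv r h y

end Coordinates

/-! ### Vacuum and Killing fields -/

section Spacetime

variable {M : Type*} [TopologicalSpace M] [ChartedSpace E4 M] [IsManifold (𝓡 4) ∞ M]

/-- The metric is a solution of the vacuum Einstein equations: `Ric = 0`. -/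
def IsVacuum (g : LorentzMetric M) : Prop :=
  ∀ e ∈ IsManifold.maximalAtlas (𝓡 4) ∞ M, ∀ y ∈ e.target, ∀ i j,
    ricci (metricComp g e) i j y = 0

/-- `T` is a smooth Killing vector field: `D_i T_j + D_j T_i = 0`. -/
structure IsKilling (g : LorentzMetric M) (T : ∀ x : M, TangentSpace (𝓡 4) x) : Prop where
  contMDiff : ContMDiff (𝓡 4) (𝓡 4).tangent ∞
    (fun x => (⟨x, T x⟩ : TangentBundle (𝓡 4) M))
  killing : ∀ e ∈ IsManifold.maximalAtlas (𝓡 4) ∞ M, ∀ y ∈ e.target, ∀ i j,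
    covDeriv₁ (metricComp g e) (lowerComp g T e) i j y
      + covDeriv₁ (metricComp g e) (lowerComp g T e) j i y = 0

end Spacetime

end MarsSimon

end

open MarsSimon

/-! Write `F` for 𝓕, `W` for 𝓡, `WF` for the contraction W·F and f for 𝓕². Since 𝓘 is the projector
onto self-dual forms, 𝓠·F = (1 - 1/3) f F, so S·F = WF + 4h⁻¹ f F. As h⁴ = -C⁴ f, this gives 𝓗 = h⁻³
WF - 4C⁻⁴ F (`calH_eq`): the second term has a constant coefficient. Differentiability, antisymmetry
and self-duality of 𝓗 are read off from this form.

In vacuum the left and right duals of the curvature agree (`starMat_firstTwo_eq`) and the Hodge dual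
is parallel (`covMat_starMat`), so the Killing identity becomes D_c F_{ab} = T^l W_{lcab}
(`covMat_sdKill`). Three facts follow. F is divergence free, because W is trace free. Df = 2 T·WF,
so Dh = -½ C⁴ h⁻³ T·WF, which together with σ = 2 T·F is the formula for E. Finally, in div 𝓗 the F
term drops, the derivative of the curvature drops by the contracted Bianchi identity, and only the
derivatives of h⁻³ and of the contracting F remain (`divergence_calH`).

What is left is algebra at a point (`maxwell_identity`). Self-dual forms obey the Clifford relation
X g⁻¹ Y + Y g⁻¹ X = -½⟨X,Y⟩ g (`selfDual_anticomm`). Hence S·S and W·W differ by a multiple of g,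
and the contractions of WF with itself and of S·F with itself are multiples of g as well. Both sides
then share the term T·(W·W), and the remaining multiples of T_b agree because C⁴ f = -h⁴.

The geometry is carried out in one chart, with tensors encoded as matrices of functions: `pd`
differentiates entrywise, and connection and curvature are matrix valued, so that the Bianchi
identities become identities in a noncommutative ring. -/

namespace MarsSimon

open Matrix

/-! ### Euclidean duality of antisymmetric 4 × 4 matrices. -/

section Algebra

variable {K : Type*} [Field K]

/-- The Euclidean Hodge dual of an antisymmetric `4 × 4` matrix. -/
def dualMat (X : Matrix (Fin 4) (Fin 4) K) : Matrix (Fin 4) (Fin 4) K :=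
  !![0, X 2 3, -X 1 3, X 1 2;
    -X 2 3, 0, X 0 3, -X 0 2;
    X 1 3, -X 0 3, 0, X 0 1;
    -X 1 2, X 0 2, -X 0 1, 0]

/-- The matrix `X` with both indices raised. -/
def sharp (gi X : Matrix (Fin 4) (Fin 4) K) : Matrix (Fin 4) (Fin 4) K := gi * X * giᵀ

/-- The Hodge dual of a `2`-form with respect to a metric with inverse `gi` and
volume element `e`. -/
def starMat (e : K) (gi X : Matrix (Fin 4) (Fin 4) K) : Matrix (Fin 4) (Fin 4) K :=
  e • dualMat (sharp gi X)

/-- The full contraction of two matrices. -/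
def pair (gi X Y : Matrix (Fin 4) (Fin 4) K) : K := ∑ m, ∑ n, X m n * sharp gi Y m n

theorem antisymm_apply [CharZero K] {X : Matrix (Fin 4) (Fin 4) K} (hX : Xᵀ = -X) :
    X 0 0 = 0 ∧ X 1 1 = 0 ∧ X 2 2 = 0 ∧ X 3 3 = 0 ∧ X 1 0 = -X 0 1 ∧ X 2 0 = -X 0 2 ∧
      X 3 0 = -X 0 3 ∧ X 2 1 = -X 1 2 ∧ X 3 1 = -X 1 3 ∧ X 3 2 = -X 2 3 := by
  have h : ∀ i j, X j i = -X i j := fun i j => congrFun (congrFun hX i) j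
  have h0 : ∀ i, X i i = 0 := fun i => self_eq_neg.1 (h i i)
  exact ⟨h0 _, h0 _, h0 _, h0 _, h _ _, h _ _, h _ _, h _ _, h _ _, h _ _⟩

theorem antisymm_ext [CharZero K] {X Y : Matrix (Fin 4) (Fin 4) K} (hX : Xᵀ = -X)
    (hY : Yᵀ = -Y) (h01 : X 0 1 = Y 0 1) (h02 : X 0 2 = Y 0 2) (h03 : X 0 3 = Y 0 3)
    (h12 : X 1 2 = Y 1 2) (h13 : X 1 3 = Y 1 3) (h23 : X 2 3 = Y 2 3) : X = Y := by
  obtain ⟨x0, x1, x2, x3, x4, x5, x6, x7, x8, x9⟩ := antisymm_apply hX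
  obtain ⟨y0, y1, y2, y3, y4, y5, y6, y7, y8, y9⟩ := antisymm_apply hY
  ext i j
  fin_cases i <;> fin_cases j <;> simp [*]

theorem dualMat_apply (X : Matrix (Fin 4) (Fin 4) K) :
    dualMat X 0 0 = 0 ∧ dualMat X 0 1 = X 2 3 ∧ dualMat X 0 2 = -X 1 3 ∧ dualMat X 0 3 = X 1 2 ∧
    dualMat X 1 0 = -X 2 3 ∧ dualMat X 1 1 = 0 ∧ dualMat X 1 2 = X 0 3 ∧ dualMat X 1 3 = -X 0 2 ∧
    dualMat X 2 0 = X 1 3 ∧ dualMat X 2 1 = -X 0 3 ∧ dualMat X 2 2 = 0 ∧ dualMat X 2 3 = X 0 1 ∧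
    dualMat X 3 0 = -X 1 2 ∧ dualMat X 3 1 = X 0 2 ∧ dualMat X 3 2 = -X 0 1 ∧ dualMat X 3 3 = 0 :=
  ⟨rfl, rfl, rfl, rfl, rfl, rfl, rfl, rfl, rfl, rfl, rfl, rfl, rfl, rfl, rfl, rfl⟩

theorem dualMat_antisymm (X : Matrix (Fin 4) (Fin 4) K) : (dualMat X)ᵀ = -dualMat X := by
  ext i j
  fin_cases i <;> fin_cases j <;> simp [dualMat]

theorem dualMat_dualMat [CharZero K] {X : Matrix (Fin 4) (Fin 4) K} (hX : Xᵀ = -X) :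
    dualMat (dualMat X) = X := by
  apply antisymm_ext (dualMat_antisymm _) hX <;> simp [dualMat]

theorem dualMat_add (X Y : Matrix (Fin 4) (Fin 4) K) :
    dualMat (X + Y) = dualMat X + dualMat Y := by
  ext i j
  fin_cases i <;> fin_cases j <;> simp [dualMat, add_comm]

theorem dualMat_smul (c : K) (X : Matrix (Fin 4) (Fin 4) K) :
    dualMat (c • X) = c • dualMat X := by
  ext i j
  fin_cases i <;> fin_cases j <;> simp [dualMat]

/-- This is the polarised Pfaffian identity: an antisymmetric matrix times its dual is a scalar
matrix. It is the source of the Clifford relation for self-dual forms. -/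
theorem dualMat_mul_dualMat [CharZero K] {P Q : Matrix (Fin 4) (Fin 4) K}
    (hP : Pᵀ = -P) (hQ : Qᵀ = -Q) :
    dualMat P * dualMat Q = -(Q * P) + ((1 / 2) * (Q * P).trace) • (1 : Matrix (Fin 4) (Fin 4) K) := by
  have p := antisymm_apply hP
  have q := antisymm_apply hQ
  ext i j
  fin_cases i <;> fin_cases j <;>
    simp [dualMat_apply, Matrix.mul_apply, Fin.sum_univ_four, Matrix.trace, p, q] <;> ring

/-- The infinitesimal form of `mul_dualMat_mul`, taken along 1 + tAᵀ. With A a connection matrix,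
the trace term is what the derivative of the volume element compensates. -/
theorem dualMat_derivation [CharZero K] {P : Matrix (Fin 4) (Fin 4) K} (hP : Pᵀ = -P)
    (A : Matrix (Fin 4) (Fin 4) K) :
    dualMat (A * P + P * Aᵀ) + Aᵀ * dualMat P + dualMat P * A = A.trace • dualMat P := by
  have p := antisymm_apply hP
  have d := dualMat_antisymm P
  apply antisymm_ext
  · simp [dualMat_antisymm, d]; abel
  · simp [d]
  all_goals
    simp [dualMat_apply, Matrix.mul_apply, Fin.sum_univ_four, Matrix.trace, p]; ring

/-- The Levi-Civita symbol is a density: a change of frame multiplies it by the determinant. -/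
theorem mul_dualMat_mul [CharZero K] {X : Matrix (Fin 4) (Fin 4) K} (hX : Xᵀ = -X)
    (A : Matrix (Fin 4) (Fin 4) K) :
    A * dualMat (Aᵀ * X * A) * Aᵀ = A.det • dualMat X := by
  have p := antisymm_apply hX
  apply antisymm_ext
  · simp [dualMat_antisymm, Matrix.mul_assoc]
  · simp [dualMat_antisymm]
  all_goals
    simp only [dualMat_apply, Matrix.mul_apply, Fin.sum_univ_four, p, Matrix.transpose_apply,
      Matrix.smul_apply, smul_eq_mul, Matrix.det_succ_row_zero (n := 3), Matrix.det_fin_three,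
      Matrix.submatrix_apply, Fin.succ_zero_eq_one, Fin.succ_one_eq_two, mul_zero, add_zero, zero_add]
    simp [Fin.succAbove]
    ring

end Algebra

/-! ### The Hodge star and the pairing of 2-forms at a point. -/

section PointwiseDual

variable {g gi : Matrix (Fin 4) (Fin 4) ℂ} {e : ℂ}

theorem sharp_antisymm (gi : Matrix (Fin 4) (Fin 4) ℂ) {X : Matrix (Fin 4) (Fin 4) ℂ}
    (hX : Xᵀ = -X) : (sharp gi X)ᵀ = -sharp gi X := by
  simp [sharp, Matrix.transpose_mul, hX, Matrix.mul_assoc]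

theorem sharp_apply (gi X : Matrix (Fin 4) (Fin 4) ℂ) (m n : Fin 4) :
    sharp gi X m n = ∑ a, ∑ b, gi m a * gi n b * X a b := by
  simp only [sharp, Matrix.mul_apply, Finset.sum_mul, Matrix.transpose_apply]
  rw [Finset.sum_comm]
  exact Finset.sum_congr rfl fun a _ => Finset.sum_congr rfl fun b _ => by ring

theorem sharp_add (gi X Y : Matrix (Fin 4) (Fin 4) ℂ) :
    sharp gi (X + Y) = sharp gi X + sharp gi Y := by
  simp [sharp, Matrix.mul_add, Matrix.add_mul]

theorem sharp_smul (gi : Matrix (Fin 4) (Fin 4) ℂ) (c : ℂ) (X : Matrix (Fin 4) (Fin 4) ℂ) :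
    sharp gi (c • X) = c • sharp gi X := by
  simp [sharp]

theorem starMat_antisymm (e : ℂ) (gi X : Matrix (Fin 4) (Fin 4) ℂ) :
    (starMat e gi X)ᵀ = -starMat e gi X := by
  simp [starMat, dualMat_antisymm]

theorem starMat_add (e : ℂ) (gi X Y : Matrix (Fin 4) (Fin 4) ℂ) :
    starMat e gi (X + Y) = starMat e gi X + starMat e gi Y := by
  simp [starMat, sharp_add, dualMat_add]

theorem starMat_smul (e : ℂ) (gi : Matrix (Fin 4) (Fin 4) ℂ) (c : ℂ)
    (X : Matrix (Fin 4) (Fin 4) ℂ) : starMat e gi (c • X) = c • starMat e gi X := by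
  simp only [starMat, sharp_smul, dualMat_smul]
  exact smul_comm _ _ _

theorem starMat_zero (e : ℂ) (gi : Matrix (Fin 4) (Fin 4) ℂ) : starMat e gi 0 = 0 := by
  simpa using starMat_smul e gi 0 0

theorem starMat_sum {ι : Type*} (e : ℂ) (gi : Matrix (Fin 4) (Fin 4) ℂ) (s : Finset ι)
    (X : ι → Matrix (Fin 4) (Fin 4) ℂ) :
    starMat e gi (∑ i ∈ s, X i) = ∑ i ∈ s, starMat e gi (X i) := by
  classical
  induction s using Finset.induction_on with
  | empty => simp [starMat_zero]
  | insert i s hi ih => rw [Finset.sum_insert hi, Finset.sum_insert hi, starMat_add, ih]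

/-- The case A = `gi` of `mul_dualMat_mul` produces e · det `gi`, which equals -e⁻¹ because e² =
-det g. This sign is the reason why the star squares to -1. -/
theorem sharp_starMat (hgi : giᵀ = gi) (hg : g * gi = 1) (he : e ^ 2 = -g.det)
    {X : Matrix (Fin 4) (Fin 4) ℂ} (hX : Xᵀ = -X) :
    sharp gi (starMat e gi X) = -e⁻¹ • dualMat X := by
  have hd : g.det * gi.det = 1 := by rw [← Matrix.det_mul, hg, Matrix.det_one]
  have he0 : e ≠ 0 := by
    rintro rfl
    have : g.det = 0 := by simpa using he.symm
    simp [this] at hd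
  have hed : e * gi.det = -e⁻¹ := by
    field_simp
    linear_combination gi.det * he - hd
  have h := mul_dualMat_mul hX gi
  rw [hgi] at h
  simp only [sharp, starMat, hgi, Matrix.mul_smul, Matrix.smul_mul, h, smul_smul, hed]

theorem starMat_starMat (hgi : giᵀ = gi) (hg : g * gi = 1) (he : e ^ 2 = -g.det)
    {X : Matrix (Fin 4) (Fin 4) ℂ} (hX : Xᵀ = -X) :
    starMat e gi (starMat e gi X) = -X := by
  have hd : g.det * gi.det = 1 := by rw [← Matrix.det_mul, hg, Matrix.det_one]
  have he0 : e ≠ 0 := by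
    rintro rfl
    have : g.det = 0 := by simpa using he.symm
    simp [this] at hd
  rw [starMat, sharp_starMat hgi hg he hX, dualMat_smul, dualMat_dualMat hX, smul_smul]
  simp [he0]

theorem starMat_selfDual (hgi : giᵀ = gi) (hg : g * gi = 1) (he : e ^ 2 = -g.det)
    {X : Matrix (Fin 4) (Fin 4) ℂ} (hX : Xᵀ = -X) :
    starMat e gi (X + Complex.I • starMat e gi X) =
      -Complex.I • (X + Complex.I • starMat e gi X) := by
  rw [starMat_add, starMat_smul, starMat_starMat hgi hg he hX, smul_add, smul_smul]
  simp [add_comm]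

theorem pair_eq_trace (gi X Y : Matrix (Fin 4) (Fin 4) ℂ) :
    pair gi X Y = (X * (sharp gi Y)ᵀ).trace := by
  simp [pair, Matrix.trace, Matrix.mul_apply]

theorem pair_comm (hgi : giᵀ = gi) (X Y : Matrix (Fin 4) (Fin 4) ℂ) :
    pair gi X Y = pair gi Y X := by
  rw [pair_eq_trace, pair_eq_trace, ← Matrix.trace_transpose]
  simp only [sharp, Matrix.transpose_mul, Matrix.transpose_transpose, Matrix.mul_assoc, hgi]
  rw [Matrix.trace_mul_comm, Matrix.mul_assoc, Matrix.mul_assoc, Matrix.trace_mul_comm]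

theorem pair_add_left (gi X X' Y : Matrix (Fin 4) (Fin 4) ℂ) :
    pair gi (X + X') Y = pair gi X Y + pair gi X' Y := by
  simp [pair_eq_trace, Matrix.add_mul]

theorem pair_smul_left (gi : Matrix (Fin 4) (Fin 4) ℂ) (c : ℂ)
    (X Y : Matrix (Fin 4) (Fin 4) ℂ) : pair gi (c • X) Y = c * pair gi X Y := by
  simp [pair_eq_trace]

theorem pair_add_right (hgi : giᵀ = gi) (X Y Y' : Matrix (Fin 4) (Fin 4) ℂ) :
    pair gi X (Y + Y') = pair gi X Y + pair gi X Y' := by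
  rw [pair_comm hgi, pair_add_left, pair_comm hgi Y, pair_comm hgi Y']

theorem pair_smul_right (hgi : giᵀ = gi) (c : ℂ)
    (X Y : Matrix (Fin 4) (Fin 4) ℂ) : pair gi X (c • Y) = c * pair gi X Y := by
  rw [pair_comm hgi, pair_smul_left, pair_comm hgi]

theorem sum_dualMat_mul {P Q : Matrix (Fin 4) (Fin 4) ℂ} (hP : Pᵀ = -P) (hQ : Qᵀ = -Q) :
    ∑ m, ∑ n, dualMat P m n * Q m n = ∑ m, ∑ n, P m n * dualMat Q m n := by
  have p := antisymm_apply hP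
  have q := antisymm_apply hQ
  simp only [Fin.sum_univ_four, dualMat_apply, p, q]
  ring

theorem pair_starMat_left (hgi : giᵀ = gi) (e : ℂ) {X Y : Matrix (Fin 4) (Fin 4) ℂ} (hX : Xᵀ = -X)
    (hY : Yᵀ = -Y) : pair gi (starMat e gi X) Y = pair gi X (starMat e gi Y) := by
  rw [pair_comm hgi X]
  simp only [pair, starMat, Matrix.smul_apply, smul_eq_mul, mul_assoc, ← Finset.mul_sum]
  rw [sum_dualMat_mul (sharp_antisymm gi hX) (sharp_antisymm gi hY)]
  simp only [mul_comm]

/-- The star is symmetric for the pairing, so its term contributes i · (-i) = 1 times the original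
one. Against a self-dual form, 𝓡 may therefore be replaced by twice the real curvature. -/
theorem pair_selfDual_left (hgi : giᵀ = gi) (e : ℂ) {X Y : Matrix (Fin 4) (Fin 4) ℂ} (hX : Xᵀ = -X)
    (hY : Yᵀ = -Y) (hsY : starMat e gi Y = -Complex.I • Y) :
    pair gi (X + Complex.I • starMat e gi X) Y = 2 * pair gi X Y := by
  rw [pair_add_left, pair_smul_left, pair_starMat_left hgi e hX hY, hsY, pair_smul_right hgi]
  linear_combination -pair gi X Y * Complex.I_mul_I

/-- Self-dual `2`-forms satisfy a Clifford relation. -/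
theorem selfDual_anticomm (hgi : giᵀ = gi) (hg : g * gi = 1) (he : e ^ 2 = -g.det)
    {X Y : Matrix (Fin 4) (Fin 4) ℂ} (hX : Xᵀ = -X) (hY : Yᵀ = -Y)
    (hsX : starMat e gi X = -Complex.I • X) (hsY : starMat e gi Y = -Complex.I • Y) :
    X * gi * Y + Y * gi * X = (-(1 / 2) * pair gi X Y) • g := by
  have hd : g.det * gi.det = 1 := by rw [← Matrix.det_mul, hg, Matrix.det_one]
  have he0 : e ≠ 0 := by
    rintro rfl
    have : g.det = 0 := by simpa using he.symm
    simp [this] at hd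
  have h1 : dualMat (sharp gi X) = (-Complex.I * e⁻¹) • X := by
    have : e • dualMat (sharp gi X) = -Complex.I • X := hsX
    rw [mul_comm, mul_smul, ← this, smul_smul, inv_mul_cancel₀ he0, one_smul]
  have h2 : dualMat Y = (Complex.I * e) • sharp gi Y := by
    have h := sharp_starMat hgi hg he hY
    rw [hsY, sharp_smul] at h
    have h3 : -e • (-Complex.I • sharp gi Y) = dualMat Y := by
      rw [h, smul_smul]; simp [he0]
    rw [← h3, smul_smul]
    congr 1; ring
  -- By `h1` and `h2`, self-duality removes both duals, up to the factors -i/e and ie, whose product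
  -- is 1. What remains of the Pfaffian identity is X Y♯ + Y♯♭ X♯ = scalar, and multiplying by g on
  -- the right lowers the index.
  have h := dualMat_mul_dualMat (sharp_antisymm gi hX) hY
  rw [h1, h2, Matrix.smul_mul, Matrix.mul_smul, smul_smul] at h
  have hc : -Complex.I * e⁻¹ * (Complex.I * e) = 1 := by
    field_simp; simp
  have ht : (Y * sharp gi X).trace = -pair gi X Y := by
    rw [pair_comm hgi, pair_eq_trace, sharp_antisymm gi hX]; simp
  rw [hc, one_smul, ht] at h
  have hgi' : gi * g = 1 := mul_eq_one_comm.1 hg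
  have h4 := congrArg (· * g) h
  simp only [sharp, hgi, Matrix.add_mul, Matrix.neg_mul, Matrix.mul_assoc, hgi', Matrix.mul_one,
    Matrix.smul_mul, Matrix.one_mul] at h4
  rw [Matrix.mul_assoc, Matrix.mul_assoc, h4]
  rw [show (1 / 2 * -pair gi X Y) = -(1 / 2) * pair gi X Y by ring]
  abel

end PointwiseDual

/-! ### Algebra of Ricci-flat curvature tensors. -/

section Curvature

/-- The matrix of a four-index array in its last two indices. -/
def lastTwo (R : Fin 4 → Fin 4 → Fin 4 → Fin 4 → ℂ) (a b : Fin 4) : Matrix (Fin 4) (Fin 4) ℂ :=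
  Matrix.of fun c d => R a b c d

/-- The matrix of a four-index array in its first two indices. -/
def firstTwo (R : Fin 4 → Fin 4 → Fin 4 → Fin 4 → ℂ) (c d : Fin 4) : Matrix (Fin 4) (Fin 4) ℂ :=
  Matrix.of fun a b => R a b c d

/-- Dualising a double 2-form on both pairs transposes it, up to trace terms. Placing one pair up
and one pair down makes the trace metric-free, so the Euclidean dual suffices; each component
equation is a combination of the vanishing traces. -/
theorem doubleDual_eq (N : Fin 4 → Fin 4 → Fin 4 → Fin 4 → ℂ)
    (h1 : ∀ a b c d, N b a c d = -N a b c d) (h2 : ∀ a b c d, N a b d c = -N a b c d)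
    (htr : ∀ b d, ∑ a, N a b a d = 0) (a b c d : Fin 4) :
    dualMat (Matrix.of fun p q => dualMat (firstTwo N p q) a b) c d = N c d a b := by
  have key : ∀ a b, (Matrix.of fun c d => N c d a b) =
      dualMat (Matrix.of fun p q => dualMat (firstTwo N p q) a b) := by
    have hz1 : ∀ a c d, N a a c d = 0 := fun a c d => self_eq_neg.1 (h1 a a c d)
    have hz2 : ∀ a b c, N a b c c = 0 := fun a b c => self_eq_neg.1 (h2 a b c c)
    simp only [Fin.sum_univ_four] at htr
    have r1 : ∀ c d, (N 1 0 c d = -N 0 1 c d ∧ N 2 0 c d = -N 0 2 c d ∧ N 3 0 c d = -N 0 3 c d) ∧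
        N 2 1 c d = -N 1 2 c d ∧ N 3 1 c d = -N 1 3 c d ∧ N 3 2 c d = -N 2 3 c d :=
      fun c d => ⟨⟨h1 _ _ _ _, h1 _ _ _ _, h1 _ _ _ _⟩, h1 _ _ _ _, h1 _ _ _ _, h1 _ _ _ _⟩
    have r2 : ∀ a b, (N a b 1 0 = -N a b 0 1 ∧ N a b 2 0 = -N a b 0 2 ∧ N a b 3 0 = -N a b 0 3) ∧
        N a b 2 1 = -N a b 1 2 ∧ N a b 3 1 = -N a b 1 3 ∧ N a b 3 2 = -N a b 2 3 :=
      fun a b => ⟨⟨h2 _ _ _ _, h2 _ _ _ _, h2 _ _ _ _⟩, h2 _ _ _ _, h2 _ _ _ _, h2 _ _ _ _⟩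
    have t := fun b d => htr b d
    have t00 := t 0 0
    have t01 := t 0 1
    have t02 := t 0 2
    have t03 := t 0 3
    have t10 := t 1 0
    have t11 := t 1 1
    have t12 := t 1 2
    have t13 := t 1 3
    have t20 := t 2 0
    have t21 := t 2 1
    have t22 := t 2 2
    have t23 := t 2 3
    have t30 := t 3 0
    have t31 := t 3 1
    have t32 := t 3 2
    have t33 := t 3 3
    simp only [r1, r2, hz1, hz2] at t00 t01 t02 t03 t10 t11 t12 t13 t20 t21 t22 t23 t30 t31 t32 t33
    have h1' := h1
    clear t htr h1
    have hN : ∀ a b, (lastTwo N a b)ᵀ = -lastTwo N a b := fun a b => by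
      ext c d; exact h2 _ _ _ _
    have e01 : lastTwo N 0 1 = dualMat (firstTwo N 2 3) := by
      apply antisymm_ext (hN _ _) (dualMat_antisymm _) <;>
        simp only [dualMat_apply, Matrix.of_apply, firstTwo, lastTwo] <;> grind
    have e02 : lastTwo N 0 2 = -dualMat (firstTwo N 1 3) := by
      apply antisymm_ext (hN _ _) (by simp [dualMat_antisymm]) <;>
        simp only [dualMat_apply, Matrix.neg_apply, Matrix.of_apply, firstTwo, lastTwo] <;> grind
    have e03 : lastTwo N 0 3 = dualMat (firstTwo N 1 2) := by
      apply antisymm_ext (hN _ _) (dualMat_antisymm _) <;>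
        simp only [dualMat_apply, Matrix.of_apply, firstTwo, lastTwo] <;> grind
    have e12 : lastTwo N 1 2 = dualMat (firstTwo N 0 3) := by
      apply antisymm_ext (hN _ _) (dualMat_antisymm _) <;>
        simp only [dualMat_apply, Matrix.of_apply, firstTwo, lastTwo] <;> grind
    have e13 : lastTwo N 1 3 = -dualMat (firstTwo N 0 2) := by
      apply antisymm_ext (hN _ _) (by simp [dualMat_antisymm]) <;>
        simp only [dualMat_apply, Matrix.neg_apply, Matrix.of_apply, firstTwo, lastTwo] <;> grind
    have e23 : lastTwo N 2 3 = dualMat (firstTwo N 0 1) := by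
      apply antisymm_ext (hN _ _) (dualMat_antisymm _) <;>
        simp only [dualMat_apply, Matrix.of_apply, firstTwo, lastTwo] <;> grind
    intro a b
    apply antisymm_ext (by ext c d; exact h1' _ _ _ _) (dualMat_antisymm _) <;>
      simp only [dualMat_apply, Matrix.of_apply]
    · exact congrFun (congrFun e01 a) b
    · exact congrFun (congrFun e02 a) b
    · exact congrFun (congrFun e03 a) b
    · exact congrFun (congrFun e12 a) b
    · exact congrFun (congrFun e13 a) b
    · exact congrFun (congrFun e23 a) b
  exact (congrFun (congrFun (key a b) c) d).symm

variable {gi : Matrix (Fin 4) (Fin 4) ℂ} {R : Fin 4 → Fin 4 → Fin 4 → Fin 4 → ℂ}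

/-- For a Ricci-flat algebraic curvature tensor the left dual equals the right dual. -/
theorem starMat_firstTwo_eq (e : ℂ)
    (h1 : ∀ a b c d, R b a c d = -R a b c d) (h2 : ∀ a b c d, R a b d c = -R a b c d)
    (hp : ∀ a b c d, R c d a b = R a b c d)
    (hric : ∀ b d, ∑ a, ∑ c, gi a c * R c b a d = 0) (a b c d : Fin 4) :
    starMat e gi (firstTwo R c d) a b = starMat e gi (lastTwo R a b) c d := by
  have hF : ∀ c d, (firstTwo R c d)ᵀ = -firstTwo R c d := fun c d => by
    ext a b; exact h1 _ _ _ _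
  have hL : ∀ a b, (lastTwo R a b)ᵀ = -lastTwo R a b := fun a b => by
    ext c d; exact h2 _ _ _ _
  have hFL : ∀ a b, firstTwo R a b = lastTwo R a b := fun a b => by
    ext c d; exact hp _ _ _ _
  have hF' : ∀ c d, firstTwo R d c = -firstTwo R c d := fun c d => by
    ext a b; exact h2 _ _ _ _
  -- Raising the first pair turns the Ricci contraction into the plain trace required by
  -- `doubleDual_eq`.
  set N : Fin 4 → Fin 4 → Fin 4 → Fin 4 → ℂ := fun a b c d => sharp gi (firstTwo R c d) a b
    with hN
  have hsn : ∀ c d, sharp gi (firstTwo R d c) = -sharp gi (firstTwo R c d) := fun c d => by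
    rw [hF', ← neg_one_smul ℂ, sharp_smul, neg_one_smul]
  have key := doubleDual_eq N
    (fun a b c d => congrFun (congrFun (sharp_antisymm gi (hF c d)) a) b)
    (fun a b c d => congrFun (congrFun (hsn c d) a) b) (fun b d => by
      simp only [hN, sharp_apply, firstTwo, Matrix.of_apply]
      have : ∀ a, ∑ p, ∑ q, gi a p * gi b q * R p q a d
          = ∑ q, gi b q * ∑ p, gi a p * R p q a d := fun a => by
        rw [Finset.sum_comm]
        simp only [Finset.mul_sum]
        exact Finset.sum_congr rfl fun _ _ => Finset.sum_congr rfl fun _ _ => by ring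
      simp only [this]
      rw [Finset.sum_comm]
      simp only [← Finset.mul_sum, hric, mul_zero, Finset.sum_const_zero])
  -- Up to the factor e, `Z` is the left dual with its first pair fixed at a, b. Its Euclidean dual
  -- is the raised curvature, so dualising once more identifies it with the right dual.
  set Z : Matrix (Fin 4) (Fin 4) ℂ := Matrix.of fun p q => dualMat (firstTwo N p q) a b
  have hZ : Zᵀ = -Z := by
    ext p q
    have : firstTwo N q p = (-1 : ℂ) • firstTwo N p q := by
      rw [neg_one_smul]
      exact hsn p q
    simp only [Z, Matrix.transpose_apply, Matrix.of_apply, Matrix.neg_apply, this, dualMat_smul]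
    simp
  have h : dualMat Z = sharp gi (lastTwo R a b) := by
    ext c d
    rw [key a b c d, ← hFL]
  have hZ' := dualMat_dualMat hZ
  rw [h] at hZ'
  simp only [starMat, hZ', Matrix.smul_apply]
  rfl

/-- This contraction of the dualised tensor antisymmetrises its last three indices, and the first
Bianchi identity kills the result. Ricci-flatness plays no role. -/
theorem trace_starMat_lastTwo (e : ℂ) (h2 : ∀ a b c d, R a b d c = -R a b c d)
    (hb : ∀ a b c d, R a b c d + R a c d b + R a d b c = 0) (b s : Fin 4) :
    ∑ r, ∑ r', gi r r' * starMat e gi (lastTwo R b r') s r = 0 := by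
  set V : Fin 4 → Matrix (Fin 4) (Fin 4) ℂ := fun r =>
    ∑ x, gi r x • sharp gi (lastTwo R b x) with hV
  have hVa : ∀ r, (V r)ᵀ = -V r := fun r => by
    simp only [hV, Matrix.transpose_sum, Matrix.transpose_smul, ← Finset.sum_neg_distrib]
    exact Finset.sum_congr rfl fun x _ => by
      rw [sharp_antisymm gi (by ext c d; exact h2 _ _ _ _), smul_neg]
  have hVe : ∀ r m n, V r m n = ∑ x, ∑ y, ∑ z, gi r x * gi m y * gi n z * R b x y z := by
    intro r m n
    simp only [hV, Matrix.sum_apply, Matrix.smul_apply, sharp_apply, smul_eq_mul, Finset.mul_sum,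
      lastTwo, Matrix.of_apply, mul_assoc]
  have hcyc : ∀ r m n, V r m n + V m n r + V n r m = 0 := by
    intro r m n
    have e2 : V m n r = ∑ x, ∑ y, ∑ z, gi r x * gi m y * gi n z * R b y z x := by
      rw [hVe]
      conv_rhs => rw [Finset.sum_comm]
      refine Finset.sum_congr rfl fun y _ => ?_
      conv_rhs => rw [Finset.sum_comm]
      exact Finset.sum_congr rfl fun z _ => Finset.sum_congr rfl fun x _ => by ring
    have e3 : V n r m = ∑ x, ∑ y, ∑ z, gi r x * gi m y * gi n z * R b z x y := by
      rw [hVe, Finset.sum_comm]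
      refine Finset.sum_congr rfl fun x _ => ?_
      rw [Finset.sum_comm]
      exact Finset.sum_congr rfl fun y _ => Finset.sum_congr rfl fun z _ => by ring
    rw [hVe, e2, e3]
    simp only [← Finset.sum_add_distrib]
    refine Finset.sum_eq_zero fun x _ => Finset.sum_eq_zero fun y _ => Finset.sum_eq_zero
      fun z _ => ?_
    linear_combination gi r x * gi m y * gi n z * hb b x y z
  have hs : ∑ r, ∑ r', gi r r' * starMat e gi (lastTwo R b r') s r
      = e * ∑ r, dualMat (V r) s r := by
    have hd : ∀ r, dualMat (V r) = ∑ x, gi r x • dualMat (sharp gi (lastTwo R b x)) := by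
      intro r
      -- With unit volume and the identity metric, `starMat` is `dualMat`, so additivity can be
      -- borrowed.
      have := starMat_sum (1 : ℂ) 1 Finset.univ fun x => gi r x • sharp gi (lastTwo R b x)
      simpa [starMat, sharp, dualMat_smul, hV] using this
    simp only [hd, Matrix.sum_apply, Matrix.smul_apply, smul_eq_mul, starMat, Finset.mul_sum]
    exact Finset.sum_congr rfl fun _ _ => Finset.sum_congr rfl fun _ _ => by ring
  rw [hs]
  have v := fun r => antisymm_apply (hVa r)
  have c012 := hcyc 0 1 2
  have c013 := hcyc 0 1 3
  have c023 := hcyc 0 2 3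
  have c123 := hcyc 1 2 3
  simp only [v] at c012 c013 c023 c123
  have : ∑ r, dualMat (V r) s r = 0 := by
    fin_cases s <;> simp only [Fin.sum_univ_four, Fin.mk_one, Fin.zero_eta, Fin.reduceFinMk,
      dualMat_apply]
    · linear_combination c123
    · linear_combination -c023
    · linear_combination c013
    · linear_combination -c012
  rw [this, mul_zero]

end Curvature

/-! ### The projector 𝓘 onto self-dual 2-forms. -/

section Projector

variable {g gi : Matrix (Fin 4) (Fin 4) ℂ} {e : ℂ}

/-- The tensor `g_{ac} g_{bd} - g_{ad} g_{bc}`. -/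
noncomputable def wedgeMetric (g : Matrix (Fin 4) (Fin 4) ℂ) (a b : Fin 4) : Matrix (Fin 4) (Fin 4) ℂ :=
  Matrix.of fun c d => g a c * g b d - g a d * g b c

/-- The projector onto self-dual `2`-forms. -/
noncomputable def projSD (e : ℂ) (g gi : Matrix (Fin 4) (Fin 4) ℂ) (a b : Fin 4) : Matrix (Fin 4) (Fin 4) ℂ :=
  (1 / 4 : ℂ) • (wedgeMetric g a b + Complex.I • starMat e gi (wedgeMetric g a b))

theorem wedgeMetric_antisymm (g : Matrix (Fin 4) (Fin 4) ℂ) (a b : Fin 4) :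
    (wedgeMetric g a b)ᵀ = -wedgeMetric g a b := by
  ext c d; simp [wedgeMetric]

theorem sharp_wedgeMetric (hgs : gᵀ = g) (hg : g * gi = 1) (a b m n : Fin 4) :
    sharp gi (wedgeMetric g a b) m n =
      (if m = a then 1 else 0) * (if n = b then 1 else 0)
        - (if m = b then 1 else 0) * (if n = a then 1 else 0) := by
  have hgi' : gi * g = 1 := mul_eq_one_comm.1 hg
  have h : ∀ m a, ∑ p, gi m p * g a p = if m = a then 1 else 0 := fun m a => by
    have := congrFun (congrFun hgi' m) a
    rw [Matrix.mul_apply, Matrix.one_apply] at this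
    rw [← this]
    exact Finset.sum_congr rfl fun p _ => by rw [← congrFun (congrFun hgs p) a]; rfl
  rw [sharp_apply, ← h m a, ← h n b, ← h m b, ← h n a, Finset.sum_mul_sum, Finset.sum_mul_sum,
    ← Finset.sum_sub_distrib]
  refine Finset.sum_congr rfl fun p _ => ?_
  rw [← Finset.sum_sub_distrib]
  exact Finset.sum_congr rfl fun q _ => by simp [wedgeMetric]; ring

theorem pair_wedgeMetric (hgi : giᵀ = gi) (hgs : gᵀ = g) (hg : g * gi = 1)
    {X : Matrix (Fin 4) (Fin 4) ℂ} (hX : Xᵀ = -X) (a b : Fin 4) :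
    pair gi (wedgeMetric g a b) X = 2 * X a b := by
  have h : X b a = -X a b := congrFun (congrFun hX a) b
  rw [pair_comm hgi]
  simp only [pair, sharp_wedgeMetric hgs hg]
  simp [mul_sub, Finset.sum_sub_distrib, h]
  ring

theorem projSD_antisymm (e : ℂ) (g gi : Matrix (Fin 4) (Fin 4) ℂ) (a b : Fin 4) :
    (projSD e g gi a b)ᵀ = -projSD e g gi a b := by
  simp only [projSD, Matrix.transpose_smul, Matrix.transpose_add, wedgeMetric_antisymm,
    starMat_antisymm, smul_neg, ← neg_add]

theorem projSD_selfDual (hgi : giᵀ = gi) (hg : g * gi = 1) (he : e ^ 2 = -g.det) (a b : Fin 4) :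
    starMat e gi (projSD e g gi a b) = -Complex.I • projSD e g gi a b := by
  rw [projSD, starMat_smul, starMat_selfDual hgi hg he (wedgeMetric_antisymm g a b)]
  exact smul_comm _ _ _

theorem pair_projSD (hgi : giᵀ = gi) (hgs : gᵀ = g) (hg : g * gi = 1)
    {X : Matrix (Fin 4) (Fin 4) ℂ} (hX : Xᵀ = -X) (hsX : starMat e gi X = -Complex.I • X)
    (a b : Fin 4) : pair gi (projSD e g gi a b) X = X a b := by
  rw [projSD, pair_smul_left, pair_selfDual_left hgi e (wedgeMetric_antisymm g a b) hX hsX,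
    pair_wedgeMetric hgi hgs hg hX]
  ring

end Projector

/-! ### The pointwise algebra behind the Maxwell equation. -/

section Maxwell

variable {g gi : Matrix (Fin 4) (Fin 4) ℂ} {e : ℂ}

theorem sum_contract (hgi : giᵀ = gi) (u : Fin 4 → ℂ) (X Y : Matrix (Fin 4) (Fin 4) ℂ)
    (b : Fin 4) :
    ∑ a, ∑ c, gi a c * (∑ s, u s * X s c) * Y a b = ∑ s, u s * (X * gi * Y) s b := by
  have hs : ∀ a c, gi a c = gi c a := fun a c => congrFun (congrFun hgi c) a
  simp only [Matrix.mul_apply, Finset.mul_sum, Finset.sum_mul]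
  conv_rhs => rw [Finset.sum_comm]
  refine Finset.sum_congr rfl fun a _ => ?_
  conv_rhs => rw [Finset.sum_comm]
  exact Finset.sum_congr rfl fun c _ => Finset.sum_congr rfl fun s _ => by rw [hs a c]; ring

/-- The algebraic data at a point: the self-dual Killing form `F` and the self-dual Weyl tensor
`W`, the latter as a matrix in its last two indices. -/
structure SelfDualData (e : ℂ) (g gi F : Matrix (Fin 4) (Fin 4) ℂ)
    (W : Fin 4 → Fin 4 → Matrix (Fin 4) (Fin 4) ℂ) : Prop where
  symm : gᵀ = g
  inv_symm : giᵀ = gi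
  mul_inv : g * gi = 1
  vol_sq : e ^ 2 = -g.det
  F_antisymm : Fᵀ = -F
  F_selfDual : starMat e gi F = -Complex.I • F
  W_swap : ∀ a b, W b a = -W a b
  W_antisymm : ∀ a b, (W a b)ᵀ = -W a b
  W_selfDual : ∀ a b, starMat e gi (W a b) = -Complex.I • W a b
  W_selfDual_left : ∀ c d, starMat e gi (Matrix.of fun a b => W a b c d) =
    -Complex.I • (Matrix.of fun a b => W a b c d)
  W_trace : ∀ b s, ∑ r, ∑ r', gi r r' * W b r' s r = 0
  proj_trace : ∀ b s, ∑ r, ∑ r', gi r r' * projSD e g gi b r' s r = 3 / 4 * g b s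

namespace SelfDualData

variable {F : Matrix (Fin 4) (Fin 4) ℂ} {W : Fin 4 → Fin 4 → Matrix (Fin 4) (Fin 4) ℂ}

/-- The contraction of the Weyl tensor with the Killing form. -/
noncomputable def WF (gi F : Matrix (Fin 4) (Fin 4) ℂ) (W : Fin 4 → Fin 4 → Matrix (Fin 4) (Fin 4) ℂ) :
    Matrix (Fin 4) (Fin 4) ℂ :=
  Matrix.of fun a b => pair gi (W a b) F

/-- The Mars–Simon tensor as a matrix in its last two indices. -/
noncomputable def marsSimon (e : ℂ) (g gi F : Matrix (Fin 4) (Fin 4) ℂ)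
    (W : Fin 4 → Fin 4 → Matrix (Fin 4) (Fin 4) ℂ) (h : ℂ) (a b : Fin 4) :
    Matrix (Fin 4) (Fin 4) ℂ :=
  W a b + (6 * h⁻¹) • (F a b • F + (-(1 / 3) * pair gi F F) • projSD e g gi a b)

theorem WF_antisymm (D : SelfDualData e g gi F W) : (WF gi F W)ᵀ = -WF gi F W := by
  ext a b
  simp only [WF, Matrix.transpose_apply, Matrix.of_apply, Matrix.neg_apply]
  rw [D.W_swap, ← neg_one_smul ℂ, pair_smul_left, neg_one_mul]

theorem WF_selfDual (D : SelfDualData e g gi F W) :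
    starMat e gi (WF gi F W) = -Complex.I • WF gi F W := by
  have : WF gi F W = ∑ c, ∑ d, sharp gi F c d • Matrix.of fun a b => W a b c d := by
    ext a b
    simp only [WF, Matrix.of_apply, Matrix.sum_apply, Matrix.smul_apply, pair, smul_eq_mul, mul_comm]
  rw [this]
  simp only [starMat_sum, starMat_smul, D.W_selfDual_left, Finset.smul_sum]
  exact Finset.sum_congr rfl fun _ _ => Finset.sum_congr rfl fun _ _ => smul_comm _ _ _

/-- The projector fixes F, so the coefficient is 6(1 - 1/3) = 4. -/
theorem pair_marsSimon (D : SelfDualData e g gi F W) (h : ℂ) (a b : Fin 4) :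
    pair gi (marsSimon e g gi F W h a b) F
      = WF gi F W a b + 4 * h⁻¹ * pair gi F F * F a b := by
  simp only [marsSimon, pair_add_left, pair_smul_left,
    pair_projSD D.inv_symm D.symm D.mul_inv D.F_antisymm D.F_selfDual, WF, Matrix.of_apply]
  ring

theorem pair_projSD_projSD (D : SelfDualData e g gi F W) (a b c d : Fin 4) :
    pair gi (projSD e g gi a b) (projSD e g gi c d) = projSD e g gi c d a b :=
  pair_projSD D.inv_symm D.symm D.mul_inv (projSD_antisymm _ _ _ _ _)
    (projSD_selfDual D.inv_symm D.mul_inv D.vol_sq _ _) _ _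

/-- Self-dual forms are reproduced by the projector. The coefficient of F ⊗ F is f(1 - 2/3), and the
projector paired with itself is again the projector. -/
theorem pair_marsSimon_marsSimon (D : SelfDualData e g gi F W) (h : ℂ) (s r b r' : Fin 4) :
    pair gi (marsSimon e g gi F W h s r) (marsSimon e g gi F W h b r') =
      pair gi (W s r) (W b r')
      + 6 * h⁻¹ * (WF gi F W s r * F b r' + F s r * WF gi F W b r')
      + (6 * h⁻¹) ^ 2 * (1 / 3) * pair gi F F * (F s r * F b r')
      - 2 * h⁻¹ * pair gi F F * (W b r' s r + W s r b r')
      + (6 * h⁻¹) ^ 2 * (1 / 9) * pair gi F F ^ 2 * projSD e g gi b r' s r := by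
  have h1 := fun {X : Matrix (Fin 4) (Fin 4) ℂ} (hX : Xᵀ = -X)
    (hsX : starMat e gi X = -Complex.I • X) =>
      pair_projSD D.inv_symm D.symm D.mul_inv hX hsX
  have c := pair_comm D.inv_symm
  simp only [marsSimon, pair_add_left, pair_smul_left, pair_add_right D.inv_symm,
    pair_smul_right D.inv_symm, h1 (D.W_antisymm _ _) (D.W_selfDual _ _),
    h1 D.F_antisymm D.F_selfDual, D.pair_projSD_projSD, c (W s r) (projSD _ _ _ _ _),
    c F (projSD _ _ _ _ _), c F (W _ _), WF, Matrix.of_apply]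
  ring

theorem contract_eq (gi : Matrix (Fin 4) (Fin 4) ℂ) {X Y : Matrix (Fin 4) (Fin 4) ℂ}
    (hY : Yᵀ = -Y) (s b : Fin 4) :
    ∑ r, ∑ r', gi r r' * (X s r * Y b r') = -(X * gi * Y) s b := by
  have hs : ∀ a, Y b a = -Y a b := fun a => congrFun (congrFun hY a) b
  simp only [Matrix.mul_apply, Finset.sum_mul]
  rw [Finset.sum_comm, ← Finset.sum_neg_distrib]
  refine Finset.sum_congr rfl fun r' _ => ?_
  rw [← Finset.sum_neg_distrib]
  exact Finset.sum_congr rfl fun r _ => by rw [hs]; ring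

/-- After contraction only W·W is not a multiple of g: W is trace free, the products of F and `WF`
collapse by the Clifford relation, and the projector has trace ¾ g. The F ⊗ F and projector terms
give 3 h⁻² f² each, hence the 6. -/
theorem sum_pair_marsSimon (D : SelfDualData e g gi F W) (h : ℂ) (s b : Fin 4) :
    ∑ r, ∑ r', gi r r' * pair gi (marsSimon e g gi F W h s r) (marsSimon e g gi F W h b r') =
      ∑ r, ∑ r', gi r r' * pair gi (W s r) (W b r')
      + (3 * h⁻¹ * pair gi (WF gi F W) F + 6 * (h⁻¹) ^ 2 * pair gi F F ^ 2) * g s b := by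
  have hWs : ∑ r, ∑ r', gi r r' * W s r b r' = 0 := by
    rw [Finset.sum_comm, ← D.W_trace s b]
    exact Finset.sum_congr rfl fun x _ => Finset.sum_congr rfl fun y _ => by
      rw [← congrFun (congrFun D.inv_symm x) y]; rfl
  have hgs : g b s = g s b := congrFun (congrFun D.symm s) b
  have c1 := selfDual_anticomm D.inv_symm D.mul_inv D.vol_sq D.WF_antisymm D.F_antisymm
    D.WF_selfDual D.F_selfDual
  have c2 := selfDual_anticomm D.inv_symm D.mul_inv D.vol_sq D.F_antisymm D.F_antisymm
    D.F_selfDual D.F_selfDual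
  have c1' := congrFun (congrFun c1 s) b
  have c2' := congrFun (congrFun c2 s) b
  have w1 := D.W_trace b s
  have w2 := D.proj_trace b s
  have f1 := contract_eq gi (X := WF gi F W) D.F_antisymm s b
  have f2 := contract_eq gi (X := F) D.WF_antisymm s b
  have f3 := contract_eq gi (X := F) D.F_antisymm s b
  simp only [Matrix.add_apply, Matrix.smul_apply, smul_eq_mul] at c1' c2'
  have expand : ∑ r, ∑ r', gi r r' *
        pair gi (marsSimon e g gi F W h s r) (marsSimon e g gi F W h b r') =
      ∑ r, ∑ r', gi r r' * pair gi (W s r) (W b r')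
      + 6 * h⁻¹ * (∑ r, ∑ r', gi r r' * (WF gi F W s r * F b r')
        + ∑ r, ∑ r', gi r r' * (F s r * WF gi F W b r'))
      + (6 * h⁻¹) ^ 2 * (1 / 3) * pair gi F F * ∑ r, ∑ r', gi r r' * (F s r * F b r')
      - 2 * h⁻¹ * pair gi F F * (∑ r, ∑ r', gi r r' * W b r' s r
        + ∑ r, ∑ r', gi r r' * W s r b r')
      + (6 * h⁻¹) ^ 2 * (1 / 9) * pair gi F F ^ 2 *
        ∑ r, ∑ r', gi r r' * projSD e g gi b r' s r := by
    simp only [D.pair_marsSimon_marsSimon, Finset.mul_sum, ← Finset.sum_add_distrib,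
      ← Finset.sum_sub_distrib]
    exact Finset.sum_congr rfl fun _ _ => Finset.sum_congr rfl fun _ _ => by ring
  rw [expand, w1, w2, hWs, f1, f2, f3, hgs]
  linear_combination (-6 * h⁻¹) * c1' - 6 * (h⁻¹) ^ 2 * pair gi F F * c2'

/-- The left side is div 𝓗 once the vanishing terms are removed. With SF = WF + 4h⁻¹ f F, each
quadratic contraction reduces to a scalar times the lowered vector u, apart from the W·W term common
to both sides. -/
theorem maxwell_identity (D : SelfDualData e g gi F W) (u : Fin 4 → ℂ) {h C : ℂ}
    (hh : h ≠ 0) (hC : h ^ 4 = -C ^ 4 * pair gi F F) (b : Fin 4) :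
    ∑ a, ∑ c, gi a c * (-3 * (h ^ 4)⁻¹
          * (-(1 / 2) * C ^ 4 * (h ^ 3)⁻¹ * ∑ s, u s * WF gi F W s c) * WF gi F W a b
        + (h ^ 3)⁻¹ * pair gi (W a b) (∑ s, u s • W s c)) =
      -(h ^ 3)⁻¹ * ∑ s, u s * ∑ r, ∑ r', gi r r' *
          pair gi (marsSimon e g gi F W h s r) (marsSimon e g gi F W h b r')
      - 3 * h⁻¹ * ∑ r, ∑ r', gi r r' * (-(1 / 2) * C ^ 4 * ∑ s, u s *
            ((h ^ 3)⁻¹ * pair gi (marsSimon e g gi F W h s r') F)) *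
          ((h ^ 3)⁻¹ * pair gi (marsSimon e g gi F W h r b) F) := by
  set SF : Matrix (Fin 4) (Fin 4) ℂ := WF gi F W + (4 * h⁻¹ * pair gi F F) • F with hSF
  have hSFa : SFᵀ = -SF := by
    rw [hSF, Matrix.transpose_add, Matrix.transpose_smul, D.WF_antisymm, D.F_antisymm]
    simp [add_comm]
  have hSFs : starMat e gi SF = -Complex.I • SF := by
    rw [hSF, starMat_add, starMat_smul, D.WF_selfDual, D.F_selfDual, smul_add]
    congr 1
    exact smul_comm _ _ _
  have hSFe : ∀ a b, pair gi (marsSimon e g gi F W h a b) F = SF a b := fun a b => by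
    rw [D.pair_marsSimon]; simp [hSF]
  have c1 := selfDual_anticomm D.inv_symm D.mul_inv D.vol_sq D.WF_antisymm D.WF_antisymm
    D.WF_selfDual D.WF_selfDual
  have c2 := selfDual_anticomm D.inv_symm D.mul_inv D.vol_sq hSFa hSFa hSFs hSFs
  have hn : pair gi SF SF = pair gi (WF gi F W) (WF gi F W)
      + 8 * h⁻¹ * pair gi F F * pair gi (WF gi F W) F
      + 16 * h⁻¹ ^ 2 * pair gi F F ^ 3 := by
    simp only [hSF, pair_add_left, pair_smul_left, pair_add_right D.inv_symm,
      pair_smul_right D.inv_symm, pair_comm D.inv_symm F (WF gi F W)]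
    ring
  have e1 : ∀ s, (WF gi F W * gi * WF gi F W) s b =
      -(1 / 4) * pair gi (WF gi F W) (WF gi F W) * g s b := fun s => by
    have := congrFun (congrFun c1 s) b
    simp only [Matrix.add_apply, Matrix.smul_apply, smul_eq_mul] at this
    linear_combination this / 2
  have e2 : ∀ s, (SF * gi * SF) s b = -(1 / 4) * pair gi SF SF * g s b := fun s => by
    have := congrFun (congrFun c2 s) b
    simp only [Matrix.add_apply, Matrix.smul_apply, smul_eq_mul] at this
    linear_combination this / 2
  have hWW : ∑ a, ∑ c, gi a c * pair gi (W a b) (∑ s, u s • W s c)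
      = -∑ s, u s * ∑ r, ∑ r', gi r r' * pair gi (W s r) (W b r') := by
    have hp : ∀ a c, pair gi (W a b) (∑ s, u s • W s c)
        = ∑ s, u s * pair gi (W a b) (W s c) := fun a c => by
      simp only [pair_comm D.inv_symm (W a b), pair_eq_trace, Finset.sum_mul, Matrix.trace_sum,
        Matrix.smul_mul, Matrix.trace_smul, smul_eq_mul]
    have hq : ∀ a s c, pair gi (W a b) (W s c) = -pair gi (W s c) (W b a) := fun a s c => by
      rw [D.W_swap b a, ← neg_one_smul ℂ, pair_smul_left, pair_comm D.inv_symm, neg_one_mul]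
    simp only [hp, hq, Finset.mul_sum, ← Finset.sum_neg_distrib]
    have hs : ∀ a c, gi a c = gi c a := fun a c => congrFun (congrFun D.inv_symm c) a
    rw [Finset.sum_comm]
    conv_rhs => rw [Finset.sum_comm]
    refine Finset.sum_congr rfl fun c _ => ?_
    rw [Finset.sum_comm]
    refine Finset.sum_congr rfl fun s _ => Finset.sum_congr rfl fun a _ => ?_
    rw [hs a c]; ring
  have l1 : ∑ a, ∑ c, gi a c * (-3 * (h ^ 4)⁻¹
          * (-(1 / 2) * C ^ 4 * (h ^ 3)⁻¹ * ∑ s, u s * WF gi F W s c) * WF gi F W a b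
        + (h ^ 3)⁻¹ * pair gi (W a b) (∑ s, u s • W s c))
      = 3 / 2 * (h ^ 4)⁻¹ * C ^ 4 * (h ^ 3)⁻¹ *
          ∑ a, ∑ c, gi a c * (∑ s, u s * WF gi F W s c) * WF gi F W a b
        + (h ^ 3)⁻¹ * ∑ a, ∑ c, gi a c * pair gi (W a b) (∑ s, u s • W s c) := by
    rw [Finset.mul_sum, Finset.mul_sum, ← Finset.sum_add_distrib]
    refine Finset.sum_congr rfl fun a _ => ?_
    rw [Finset.mul_sum, Finset.mul_sum, ← Finset.sum_add_distrib]
    exact Finset.sum_congr rfl fun c _ => by ring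
  have l2 : ∑ r, ∑ r', gi r r' * (-(1 / 2) * C ^ 4 * ∑ s, u s *
            ((h ^ 3)⁻¹ * pair gi (marsSimon e g gi F W h s r') F)) *
          ((h ^ 3)⁻¹ * pair gi (marsSimon e g gi F W h r b) F)
      = -(1 / 2) * C ^ 4 * (h ^ 3)⁻¹ ^ 2 *
        ∑ a, ∑ c, gi a c * (∑ s, u s * SF s c) * SF a b := by
    simp only [hSFe]
    rw [Finset.mul_sum]
    refine Finset.sum_congr rfl fun a _ => ?_
    rw [Finset.mul_sum]
    refine Finset.sum_congr rfl fun c _ => ?_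
    have : ∑ s, u s * ((h ^ 3)⁻¹ * SF s c) = (h ^ 3)⁻¹ * ∑ s, u s * SF s c := by
      rw [Finset.mul_sum]
      exact Finset.sum_congr rfl fun _ _ => by ring
    rw [this]; ring
  rw [l1, l2, hWW, sum_contract D.inv_symm, sum_contract D.inv_symm]
  simp only [e1, e2, hn, D.sum_pair_marsSimon, mul_add, Finset.sum_add_distrib]
  have t1 : ∀ k : ℂ, ∑ s, u s * (k * g s b) = k * ∑ s, u s * g s b := fun k => by
    rw [Finset.mul_sum]; exact Finset.sum_congr rfl fun _ _ => by ring
  rw [t1, t1, t1]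
  generalize pair gi (WF gi F W) (WF gi F W) = x
  generalize pair gi (WF gi F W) F = y
  generalize ∑ s, u s * g s b = z
  generalize ∑ s, u s * ∑ r, ∑ r', gi r r' * pair gi (W s r) (W b r') = w
  generalize pair gi F F = f at *
  -- The ⟨WF,WF⟩ terms already cancel. The excess of ⟨SF,SF⟩ carries a factor C⁴ f, and replacing it
  -- by -h⁴ matches it with the g-multiple coming from S·S.
  have hC' : C ^ 4 * f = -h ^ 4 := by rw [hC]; ring
  have hk : h⁻¹ ^ 4 * h ^ 4 = 1 := by rw [← mul_pow, inv_mul_cancel₀ hh, one_pow]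
  simp only [← inv_pow]
  generalize h⁻¹ = k at *
  linear_combination (3 * k ^ 8 * y * z + 6 * k ^ 9 * f ^ 2 * z) * hC'
    - (3 * k ^ 4 * y * z + 6 * k ^ 5 * f ^ 2 * z) * hk

end SelfDualData
end Maxwell

/-! ### Calculus of coordinate partial derivatives. -/

section PartialDerivatives

variable {A : Type*} [NormedRing A] [NormedAlgebra ℝ A] {V : Type*} [NormedAddCommGroup V]
  [NormedSpace ℝ V] {y : E4} (c : Fin 4)

theorem pderiv_add {f g : E4 → V} (hf : DifferentiableAt ℝ f y) (hg : DifferentiableAt ℝ g y) :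
    pderiv c (fun z => f z + g z) y = pderiv c f y + pderiv c g y := by
  simp [pderiv, fderiv_fun_add hf hg]

theorem pderiv_sub {f g : E4 → V} (hf : DifferentiableAt ℝ f y) (hg : DifferentiableAt ℝ g y) :
    pderiv c (fun z => f z - g z) y = pderiv c f y - pderiv c g y := by
  simp [pderiv, fderiv_fun_sub hf hg]

theorem pderiv_neg (f : E4 → V) : pderiv c (fun z => -f z) y = -pderiv c f y := by
  simp [pderiv, fderiv_fun_neg]

theorem pderiv_const (v : V) : pderiv c (fun _ => v) y = 0 := by
  simp [pderiv]

theorem pderiv_mul {f g : E4 → A} (hf : DifferentiableAt ℝ f y) (hg : DifferentiableAt ℝ g y) :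
    pderiv c (fun z => f z * g z) y = pderiv c f y * g y + f y * pderiv c g y := by
  simp [pderiv, fderiv_fun_mul' hf hg, add_comm]

theorem pderiv_sum {ι : Type*} {s : Finset ι} {f : ι → E4 → V}
    (hf : ∀ i ∈ s, DifferentiableAt ℝ (f i) y) :
    pderiv c (fun z => ∑ i ∈ s, f i z) y = ∑ i ∈ s, pderiv c (f i) y := by
  simp [pderiv, fderiv_fun_sum hf]

theorem pderiv_congr {f g : E4 → V} (h : f =ᶠ[nhds y] g) : pderiv c f y = pderiv c g y := by
  simp [pderiv, h.fderiv_eq]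

theorem pderiv_congr_on {Ω : Set E4} (hΩ : IsOpen Ω) (hy : y ∈ Ω) {f g : E4 → V}
    (h : ∀ z ∈ Ω, f z = g z) : pderiv c f y = pderiv c g y :=
  pderiv_congr c (Filter.eventuallyEq_of_mem (hΩ.mem_nhds hy) h)

theorem pderiv_ofReal {f : E4 → ℝ} (hf : DifferentiableAt ℝ f y) :
    pderiv c (fun z => (f z : ℂ)) y = ((pderiv c f y : ℝ) : ℂ) := by
  have := (Complex.ofRealCLM.hasFDerivAt.comp y hf.hasFDerivAt).fderiv
  simp only [pderiv]
  rw [show (fun z => (f z : ℂ)) = Complex.ofRealCLM ∘ f from rfl, this]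
  rfl

theorem contDiffOn_pderiv {Ω : Set E4} (hΩ : IsOpen Ω) {f : E4 → V} (hf : ContDiffOn ℝ ∞ f Ω) :
    ContDiffOn ℝ ∞ (pderiv c f) Ω :=
  (hf.fderiv_of_isOpen hΩ (by simp)).clm_apply contDiffOn_const

theorem pderiv_comm {Ω : Set E4} (hΩ : IsOpen Ω) (hy : y ∈ Ω) {f : E4 → V}
    (hf : ContDiffOn ℝ ∞ f Ω) (d : Fin 4) :
    pderiv c (pderiv d f) y = pderiv d (pderiv c f) y := by
  have h2 : ContDiffAt ℝ ∞ f y := hf.contDiffAt (hΩ.mem_nhds hy)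
  have hs : IsSymmSndFDerivAt ℝ f y := h2.isSymmSndFDerivAt
    (by rw [minSmoothness_of_isRCLikeNormedField]; exact WithTop.coe_le_coe.2 le_top)
  have hd : DifferentiableAt ℝ (fderiv ℝ f) y :=
    (h2.fderiv_right (m := ∞) (by simp)).differentiableAt (by simp)
  have key : ∀ c d : Fin 4, pderiv c (pderiv d f) y =
      fderiv ℝ (fderiv ℝ f) y (EuclideanSpace.single c 1) (EuclideanSpace.single d 1) := by
    intro c d
    change fderiv ℝ (fun z => fderiv ℝ f z (EuclideanSpace.single d (1 : ℝ))) y _ = _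
    rw [fderiv_clm_apply hd (differentiableAt_const _)]
    simp
  rw [key, key]
  exact hs _ _

end PartialDerivatives

/-! ### Entrywise calculus of matrix-valued functions. -/

section MatrixFields

variable {ι κ μ : Type*} {A : Type*} [NormedRing A] [NormedAlgebra ℝ A] {y : E4} {Ω : Set E4}

/-- The partial derivative of a matrix-valued function. -/
noncomputable def pd (c : Fin 4) (X : E4 → Matrix ι κ A) (y : E4) : Matrix ι κ A :=
  Matrix.of fun i j => pderiv c (fun z => X z i j) y

/-- Differentiability at `y` of all entries. -/
def EntryDiff (X : E4 → Matrix ι κ A) (y : E4) : Prop :=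
  ∀ i j, DifferentiableAt ℝ (fun z => X z i j) y

/-- Smoothness on `Ω` of all entries. -/
def EntrySmooth (X : E4 → Matrix ι κ A) (Ω : Set E4) : Prop :=
  ∀ i j, ContDiffOn ℝ ∞ (fun z => X z i j) Ω

theorem EntrySmooth.entryDiff {X : E4 → Matrix ι κ A} (hX : EntrySmooth X Ω)
    (hΩ : IsOpen Ω) (hy : y ∈ Ω) : EntryDiff X y := fun i j =>
  ((hX i j).contDiffAt (hΩ.mem_nhds hy)).differentiableAt (by simp)

theorem EntryDiff.add {X Y : E4 → Matrix ι κ A} (hX : EntryDiff X y) (hY : EntryDiff Y y) :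
    EntryDiff (fun z => X z + Y z) y := fun i j => (hX i j).add (hY i j)

theorem EntryDiff.sub {X Y : E4 → Matrix ι κ A} (hX : EntryDiff X y) (hY : EntryDiff Y y) :
    EntryDiff (fun z => X z - Y z) y := fun i j => (hX i j).sub (hY i j)

theorem EntryDiff.transpose {X : E4 → Matrix ι κ A} (hX : EntryDiff X y) :
    EntryDiff (fun z => (X z)ᵀ) y := fun i j => hX j i

theorem EntryDiff.mul [Fintype κ] {X : E4 → Matrix ι κ A} {Y : E4 → Matrix κ μ A}
    (hX : EntryDiff X y) (hY : EntryDiff Y y) : EntryDiff (fun z => X z * Y z) y := fun i j => by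
  simp only [Matrix.mul_apply]
  exact DifferentiableAt.fun_sum fun k _ => (hX i k).mul (hY k j)

theorem EntrySmooth.add {X Y : E4 → Matrix ι κ A} (hX : EntrySmooth X Ω) (hY : EntrySmooth Y Ω) :
    EntrySmooth (fun z => X z + Y z) Ω := fun i j => (hX i j).add (hY i j)

theorem EntrySmooth.sub {X Y : E4 → Matrix ι κ A} (hX : EntrySmooth X Ω) (hY : EntrySmooth Y Ω) :
    EntrySmooth (fun z => X z - Y z) Ω := fun i j => (hX i j).sub (hY i j)

theorem EntrySmooth.mul [Fintype κ] {X : E4 → Matrix ι κ A} {Y : E4 → Matrix κ μ A}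
    (hX : EntrySmooth X Ω) (hY : EntrySmooth Y Ω) : EntrySmooth (fun z => X z * Y z) Ω :=
  fun i j => by
    simp only [Matrix.mul_apply]
    exact ContDiffOn.sum fun k _ => (hX i k).mul (hY k j)

theorem EntrySmooth.pd (hΩ : IsOpen Ω) {X : E4 → Matrix ι κ A} (hX : EntrySmooth X Ω)
    (c : Fin 4) : EntrySmooth (pd c X) Ω := fun i j => contDiffOn_pderiv c hΩ (hX i j)

theorem pd_add (c : Fin 4) {X Y : E4 → Matrix ι κ A} (hX : EntryDiff X y) (hY : EntryDiff Y y) :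
    pd c (fun z => X z + Y z) y = pd c X y + pd c Y y := by
  ext i j; exact pderiv_add c (hX i j) (hY i j)

theorem pd_sub (c : Fin 4) {X Y : E4 → Matrix ι κ A} (hX : EntryDiff X y) (hY : EntryDiff Y y) :
    pd c (fun z => X z - Y z) y = pd c X y - pd c Y y := by
  ext i j; exact pderiv_sub c (hX i j) (hY i j)

theorem pd_transpose (c : Fin 4) (X : E4 → Matrix ι κ A) :
    pd c (fun z => (X z)ᵀ) y = (pd c X y)ᵀ := rfl

theorem pd_mul [Fintype κ] (c : Fin 4) {X : E4 → Matrix ι κ A} {Y : E4 → Matrix κ μ A}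
    (hX : EntryDiff X y) (hY : EntryDiff Y y) :
    pd c (fun z => X z * Y z) y = pd c X y * Y y + X y * pd c Y y := by
  ext i j
  simp only [pd, Matrix.of_apply, Matrix.mul_apply, Matrix.add_apply]
  have h : ∀ k ∈ Finset.univ, DifferentiableAt ℝ (fun z => X z i k * Y z k j) y := fun k _ =>
    (hX i k).mul (hY k j)
  rw [pderiv_sum c h, ← Finset.sum_add_distrib]
  exact Finset.sum_congr rfl fun k _ => pderiv_mul c (hX i k) (hY k j)

theorem pd_congr_on (c : Fin 4) (hΩ : IsOpen Ω) (hy : y ∈ Ω) {X Y : E4 → Matrix ι κ A}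
    (h : ∀ z ∈ Ω, X z = Y z) : pd c X y = pd c Y y := by
  ext i j
  exact pderiv_congr_on c hΩ hy fun z hz => by rw [h z hz]

theorem pd_comm (c d : Fin 4) (hΩ : IsOpen Ω) (hy : y ∈ Ω) {X : E4 → Matrix ι κ A}
    (hX : EntrySmooth X Ω) : pd c (pd d X) y = pd d (pd c X) y := by
  ext i j
  exact pderiv_comm c hΩ hy (hX i j) d

end MatrixFields

section Inverse

variable {Ω : Set E4} {n : ℕ} {X : E4 → Matrix (Fin n) (Fin n) ℝ}

theorem contDiffOn_det (hX : EntrySmooth X Ω) : ContDiffOn ℝ ∞ (fun z => (X z).det) Ω := by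
  simp only [Matrix.det_apply']
  exact ContDiffOn.sum fun σ _ => contDiffOn_const.mul (contDiffOn_prod fun i _ => hX _ _)

theorem EntrySmooth.inv (hX : EntrySmooth X Ω) (hd : ∀ z ∈ Ω, (X z).det ≠ 0) :
    EntrySmooth (fun z => (X z)⁻¹) Ω := fun i j => by
  have h : ContDiffOn ℝ ∞ (fun z => (X z).adjugate i j) Ω := by
    simp only [Matrix.adjugate_apply]
    refine contDiffOn_det fun k l => ?_
    by_cases hk : k = j
    · subst hk; simpa using contDiffOn_const
    · simpa [Matrix.updateRow_ne hk] using hX k l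
  refine (((contDiffOn_det hX).inv hd).mul h).congr fun z _ => ?_
  simp [Matrix.inv_def, Ring.inverse_eq_inv']

end Inverse

/-! ### Metric compatibility of the Christoffel symbols. -/

section LeviCivita

/-- The metric components on a coordinate domain. -/
structure IsMetricOn (G : E4 → Matrix (Fin 4) (Fin 4) ℝ) (Ω : Set E4) : Prop where
  isOpen : IsOpen Ω
  smooth : EntrySmooth G Ω
  symm : ∀ y ∈ Ω, (G y)ᵀ = G y
  det_ne : ∀ y ∈ Ω, (G y).det ≠ 0

/-- The connection matrices `(Γ_c)ᵏ_b = Γᵏ_{cb}`. -/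
noncomputable def connMat (G : E4 → Matrix (Fin 4) (Fin 4) ℝ) (c : Fin 4) (y : E4) :
    Matrix (Fin 4) (Fin 4) ℝ :=
  Matrix.of fun k b => christoffel G k c b y

/-- The curvature matrices `(R_{cd})ᵃ_b = Rᵃ_{bcd}`. -/
noncomputable def curvMat (G : E4 → Matrix (Fin 4) (Fin 4) ℝ) (c d : Fin 4) (y : E4) :
    Matrix (Fin 4) (Fin 4) ℝ :=
  pd c (connMat G d) y - pd d (connMat G c) y + connMat G c y * connMat G d y
    - connMat G d y * connMat G c y

theorem riemannUp_eq (G : E4 → Matrix (Fin 4) (Fin 4) ℝ) (a b c d : Fin 4) (y : E4) :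
    riemannUp G a b c d y = curvMat G c d y a b := by
  simp only [riemannUp, curvMat, pd, connMat, Matrix.sub_apply, Matrix.add_apply, Matrix.mul_apply,
    Matrix.of_apply, Finset.sum_sub_distrib]
  ring

theorem riemann_eq (G : E4 → Matrix (Fin 4) (Fin 4) ℝ) (a b c d : Fin 4) (y : E4) :
    riemann G a b c d y = (G y * curvMat G c d y) a b := by
  simp only [riemann, riemannUp_eq, Matrix.mul_apply]

namespace IsMetricOn

variable {G : E4 → Matrix (Fin 4) (Fin 4) ℝ} {Ω : Set E4} (hG : IsMetricOn G Ω) {y : E4}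
include hG

theorem mul_inv (hy : y ∈ Ω) : G y * (G y)⁻¹ = 1 :=
  Matrix.mul_nonsing_inv _ (isUnit_iff_ne_zero.2 (hG.det_ne y hy))

theorem inv_mul (hy : y ∈ Ω) : (G y)⁻¹ * G y = 1 :=
  Matrix.nonsing_inv_mul _ (isUnit_iff_ne_zero.2 (hG.det_ne y hy))

theorem inv_symm (hy : y ∈ Ω) : ((G y)⁻¹)ᵀ = (G y)⁻¹ := by
  rw [Matrix.transpose_nonsing_inv, hG.symm y hy]

theorem symm_apply (hy : y ∈ Ω) (i j : Fin 4) : G y i j = G y j i :=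
  congrFun (congrFun (hG.symm y hy) j) i

theorem pderiv_symm (hy : y ∈ Ω) (c i j : Fin 4) :
    pderiv c (fun z => G z i j) y = pderiv c (fun z => G z j i) y :=
  pderiv_congr_on c hG.isOpen hy fun _ hz => hG.symm_apply hz i j

theorem christoffel_symm (hy : y ∈ Ω) (k i j : Fin 4) :
    christoffel G k i j y = christoffel G k j i y := by
  simp only [christoffel, hG.pderiv_symm hy _ i j, add_comm]

theorem smooth_connMat (c : Fin 4) : EntrySmooth (connMat G c) Ω := fun k b => by
  have h := fun c i j => contDiffOn_pderiv c hG.isOpen (hG.smooth i j)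
  exact contDiffOn_const.mul (ContDiffOn.sum fun l _ => ((hG.smooth.inv hG.det_ne) k l).mul
    (((h _ _ _).add (h _ _ _)).sub (h _ _ _)))

theorem smooth_curvMat (c d : Fin 4) : EntrySmooth (curvMat G c d) Ω :=
  ((((hG.smooth_connMat d).pd hG.isOpen c).sub ((hG.smooth_connMat c).pd hG.isOpen d)).add
    ((hG.smooth_connMat c).mul (hG.smooth_connMat d))).sub
      ((hG.smooth_connMat d).mul (hG.smooth_connMat c))

/-- Lowering cancels the inverse metric inside `christoffel` and leaves the symbols of the first
kind; symmetrising these yields metric compatibility. -/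
theorem mul_connMat (hy : y ∈ Ω) (c i j : Fin 4) : (G y * connMat G c y) i j =
    (1 / 2) * (pderiv c (fun z => G z j i) y + pderiv j (fun z => G z c i) y
      - pderiv i (fun z => G z c j) y) := by
  set v : Fin 4 → ℝ := fun l => pderiv c (fun z => G z j l) y + pderiv j (fun z => G z c l) y
      - pderiv l (fun z => G z c j) y with hv
  have h : (fun k => connMat G c y k j) = (1 / 2 : ℝ) • ((G y)⁻¹ *ᵥ v) := by
    ext k
    simp [connMat, christoffel, Matrix.mulVec, dotProduct, hv]
  have h2 : (G y * connMat G c y) i j = (G y *ᵥ fun k => connMat G c y k j) i := rfl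
  rw [h2, h, Matrix.mulVec_smul, Matrix.mulVec_mulVec, hG.mul_inv hy]
  simp [hv]

/-- Metric compatibility of the Levi-Civita connection. -/
theorem pd_metric (hy : y ∈ Ω) (c : Fin 4) :
    pd c G y = (connMat G c y)ᵀ * G y + G y * connMat G c y := by
  have h : (connMat G c y)ᵀ * G y = (G y * connMat G c y)ᵀ := by
    rw [Matrix.transpose_mul, hG.symm y hy]
  rw [h]
  ext i j
  rw [Matrix.add_apply, Matrix.transpose_apply, hG.mul_connMat hy, hG.mul_connMat hy]
  simp only [pd, Matrix.of_apply, hG.pderiv_symm hy c j i]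
  ring

theorem pd_inv (hy : y ∈ Ω) (c : Fin 4) : pd c (fun z => (G z)⁻¹) y =
    -(connMat G c y * (G y)⁻¹) - (G y)⁻¹ * (connMat G c y)ᵀ := by
  have hd := hG.smooth.entryDiff hG.isOpen hy
  have hi := (hG.smooth.inv hG.det_ne).entryDiff hG.isOpen hy
  have h : pd c (fun z => G z * (G z)⁻¹) y = 0 := by
    rw [pd_congr_on c hG.isOpen hy (Y := fun _ => 1) fun z hz => hG.mul_inv hz]
    ext i j; exact pderiv_const c _
  rw [pd_mul c hd hi, hG.pd_metric hy] at h
  have h2 := congrArg ((G y)⁻¹ * ·) h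
  simp only [Matrix.mul_add, Matrix.add_mul, ← Matrix.mul_assoc, hG.inv_mul hy, Matrix.one_mul,
    Matrix.mul_zero] at h2
  rw [Matrix.mul_assoc ((G y)⁻¹ * (connMat G c y)ᵀ), hG.mul_inv hy, Matrix.mul_one] at h2
  rw [eq_neg_of_add_eq_zero_right h2]
  abel

end IsMetricOn
end LeviCivita

/-! ### Bianchi identities and symmetries of the curvature. -/

namespace IsMetricOn

variable {G : E4 → Matrix (Fin 4) (Fin 4) ℝ} {Ω : Set E4} (hG : IsMetricOn G Ω) {y : E4}
include hG

theorem pd_curvMat (hy : y ∈ Ω) (e c d : Fin 4) : pd e (curvMat G c d) y =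
    pd e (pd c (connMat G d)) y - pd e (pd d (connMat G c)) y
      + (pd e (connMat G c) y * connMat G d y + connMat G c y * pd e (connMat G d) y)
      - (pd e (connMat G d) y * connMat G c y + connMat G d y * pd e (connMat G c) y) := by
  have s := fun c => (hG.smooth_connMat c).entryDiff hG.isOpen hy
  have s' := fun c d => ((hG.smooth_connMat d).pd hG.isOpen c).entryDiff hG.isOpen hy
  rw [← pd_mul e (s c) (s d), ← pd_mul e (s d) (s c), ← pd_sub e (s' c d) (s' d c),
    ← pd_add e ((s' c d).sub (s' d c)) ((s c).mul (s d)),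
    ← pd_sub e (((s' c d).sub (s' d c)).add ((s c).mul (s d))) ((s d).mul (s c))]
  rfl

/-- The differential Bianchi identity. -/
theorem bianchi_second (hy : y ∈ Ω) (e c d : Fin 4) :
    (pd e (curvMat G c d) y + connMat G e y * curvMat G c d y - curvMat G c d y * connMat G e y)
    + (pd c (curvMat G d e) y + connMat G c y * curvMat G d e y - curvMat G d e y * connMat G c y)
    + (pd d (curvMat G e c) y + connMat G d y * curvMat G e c y - curvMat G e c y * connMat G d y)
    = 0 := by
  rw [hG.pd_curvMat hy, hG.pd_curvMat hy, hG.pd_curvMat hy,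
    pd_comm e c hG.isOpen hy (hG.smooth_connMat d), pd_comm e d hG.isOpen hy (hG.smooth_connMat c),
    pd_comm c d hG.isOpen hy (hG.smooth_connMat e)]
  -- Once the mixed partials are commuted, dR + [Γ, R] = 0 is a formal identity for R = dΓ + Γ ∧ Γ.
  -- Corrections on the form indices are absent here; they cancel in the cyclic sum by symmetry of
  -- Γ.
  simp only [curvMat]
  noncomm_ring

omit hG in
theorem curvMat_swap (G : E4 → Matrix (Fin 4) (Fin 4) ℝ) (c d : Fin 4) : curvMat G d c y = -curvMat G c d y := by
  simp only [curvMat]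
  abel

theorem bianchi_first_up (hy : y ∈ Ω) (a b c d : Fin 4) :
    curvMat G c d y a b + curvMat G d b y a c + curvMat G b c y a d = 0 := by
  have h : ∀ c a d b, pderiv c (fun z => connMat G d z a b) y
      = pderiv c (fun z => connMat G b z a d) y := fun c a d b =>
    pderiv_congr_on c hG.isOpen hy fun z hz => hG.christoffel_symm hz _ _ _
  have h' : ∀ a d b, connMat G d y a b = connMat G b y a d := fun a d b =>
    hG.christoffel_symm hy _ _ _
  simp only [curvMat, pd, Matrix.add_apply, Matrix.sub_apply, Matrix.of_apply, Matrix.mul_apply]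
  rw [h c a d b, h d a c b, h b a d c]
  simp only [h' _ d b, h' _ c b, h' _ d c]
  ring

/-- Applying metric compatibility twice, the commutator of second derivatives of the metric is GR +
(GR)ᵀ, and mixed partials commute. -/
theorem lower_curvMat_antisymm (hy : y ∈ Ω) (c d : Fin 4) :
    (G y * curvMat G c d y)ᵀ = -(G y * curvMat G c d y) := by
  have s := fun c => (hG.smooth_connMat c).entryDiff hG.isOpen hy
  have sG := hG.smooth.entryDiff hG.isOpen hy
  have h : ∀ c d, pd c (pd d G) y =
      (pd c (connMat G d) y)ᵀ * G y
      + (connMat G d y)ᵀ * ((connMat G c y)ᵀ * G y + G y * connMat G c y)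
      + (((connMat G c y)ᵀ * G y + G y * connMat G c y) * connMat G d y
      + G y * pd c (connMat G d) y) := fun c d => by
    rw [pd_congr_on c hG.isOpen hy fun z hz => hG.pd_metric hz d,
      pd_add c ((s d).transpose.mul sG) (sG.mul (s d)), pd_mul c (s d).transpose sG,
      pd_mul c sG (s d), pd_transpose, hG.pd_metric hy]
  have h0 := pd_comm c d hG.isOpen hy hG.smooth
  rw [h, h] at h0
  rw [Matrix.transpose_mul, hG.symm y hy]
  simp only [curvMat, Matrix.transpose_sub, Matrix.transpose_add, Matrix.transpose_mul]
  rw [← sub_eq_zero] at h0 ⊢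
  rw [← h0]
  noncomm_ring

omit hG in
theorem riemann_swap_right (G : E4 → Matrix (Fin 4) (Fin 4) ℝ) (a b c d : Fin 4) :
    riemann G a b d c y = -riemann G a b c d y := by
  rw [riemann_eq, riemann_eq, curvMat_swap G c d, Matrix.mul_neg, Matrix.neg_apply]

theorem riemann_swap_left (hy : y ∈ Ω) (a b c d : Fin 4) :
    riemann G b a c d y = -riemann G a b c d y := by
  rw [riemann_eq, riemann_eq]
  exact congrFun (congrFun (hG.lower_curvMat_antisymm hy c d) a) b

theorem bianchi_first (hy : y ∈ Ω) (a b c d : Fin 4) :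
    riemann G a b c d y + riemann G a c d b y + riemann G a d b c y = 0 := by
  simp only [riemann, riemannUp_eq, ← Finset.sum_add_distrib, ← mul_add,
    hG.bianchi_first_up hy, mul_zero, Finset.sum_const_zero]

/-- The classical octahedron argument: four instances of the first Bianchi identity, combined using
antisymmetry in each pair. -/
theorem riemann_pair (hy : y ∈ Ω) (a b c d : Fin 4) :
    riemann G c d a b y = riemann G a b c d y := by
  have s1 := hG.riemann_swap_left hy
  have s2 := fun a b c d => riemann_swap_right (y := y) G a b c d
  linarith [hG.bianchi_first hy a b c d, hG.bianchi_first hy b c d a, hG.bianchi_first hy c d a b,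
    hG.bianchi_first hy d a b c, s1 a b c d, s1 b c a d, s1 c d a b, s1 a d b c, s1 a c d b,
    s1 b d c a, s2 a b c d, s2 c d a b, s2 b c d a, s2 a d c b, s2 a c b d, s2 b d a c,
    s1 a b d c, s1 b c d a, s1 c d b a, s1 a d c b, s1 a c b d, s1 b d a c,
    s2 b a c d, s2 d c a b, s2 c b d a, s2 d a c b, s2 c a b d, s2 d b a c]

theorem sum_inv_riemann (hy : y ∈ Ω) (c b m n : Fin 4) :
    ∑ a, (G y)⁻¹ c a * riemann G a b m n y = curvMat G m n y c b := by
  have : ∑ a, (G y)⁻¹ c a * riemann G a b m n y = ((G y)⁻¹ * (G y * curvMat G m n y)) c b := by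
    simp only [riemann_eq, Matrix.mul_apply]
  rw [this, ← Matrix.mul_assoc, hG.inv_mul hy, Matrix.one_mul]

/-- The covariant derivative `D_c R_{abmn}` of the curvature tensor. -/
noncomputable def _root_.MarsSimon.covDerivRiemann (G : E4 → Matrix (Fin 4) (Fin 4) ℝ)
    (c a b m n : Fin 4) (y : E4) : ℝ :=
  pderiv c (riemann G a b m n) y
    - ∑ k, christoffel G k c a y * riemann G k b m n y
    - ∑ k, christoffel G k c b y * riemann G a k m n y
    - ∑ k, christoffel G k c m y * riemann G a b k n y
    - ∑ k, christoffel G k c n y * riemann G a b m k y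

/-- Metric compatibility cancels the correction for the lowered first index, so G factors out and
the matrix form of the Bianchi identity becomes applicable. -/
theorem covDerivRiemann_eq (hy : y ∈ Ω) (c a b m n : Fin 4) :
    covDerivRiemann G c a b m n y = (G y * ((pd c (curvMat G m n) y
      + connMat G c y * curvMat G m n y - curvMat G m n y * connMat G c y)
      - ∑ k, connMat G c y k m • curvMat G k n y
      - ∑ k, connMat G c y k n • curvMat G m k y)) a b := by
  have sG := hG.smooth.entryDiff hG.isOpen hy
  have sR := (hG.smooth_curvMat m n).entryDiff hG.isOpen hy
  have h1 : pderiv c (riemann G a b m n) y = pd c (fun z => G z * curvMat G m n z) y a b := by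
    simp only [pd, Matrix.of_apply, ← riemann_eq]
  have h2 : ∑ k, christoffel G k c a y * riemann G k b m n y =
      ((connMat G c y)ᵀ * (G y * curvMat G m n y)) a b := by
    simp only [riemann_eq, Matrix.mul_apply (M := (connMat G c y)ᵀ)]
    rfl
  have h3 : ∑ k, christoffel G k c b y * riemann G a k m n y =
      ((G y * curvMat G m n y) * connMat G c y) a b := by
    simp only [riemann_eq, Matrix.mul_apply (N := connMat G c y)]
    exact Finset.sum_congr rfl fun k _ => mul_comm _ _
  have h4 : ∀ (f : Fin 4 → ℝ) (M : Fin 4 → Matrix (Fin 4) (Fin 4) ℝ),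
      ∑ k, f k * (G y * M k) a b = (G y * ∑ k, f k • M k) a b := fun f M => by
    simp [Finset.mul_sum, Matrix.sum_apply]
  rw [covDerivRiemann, h1, h2, h3, pd_mul c sG sR, hG.pd_metric hy]
  simp only [riemann_eq]
  rw [h4 (fun k => christoffel G k c m y), h4 (fun k => christoffel G k c n y)]
  simp only [← Matrix.sub_apply]
  simp only [connMat, Matrix.of_apply]
  noncomm_ring

/-- The curvature tensor of a Ricci-flat metric is divergence free. -/
theorem div_riemann (hric : ∀ z ∈ Ω, ∀ i j, ricci G i j z = 0) (hy : y ∈ Ω) (b m n : Fin 4) :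
    ∑ a, ∑ c, (G y)⁻¹ a c * covDerivRiemann G c a b m n y = 0 := by
  have hr : ∀ z ∈ Ω, ∀ i j, ∑ a, curvMat G a j z a i = 0 := fun z hz i j => by
    simpa only [ricci, riemannUp_eq] using hric z hz i j
  set Z : Fin 4 → Matrix (Fin 4) (Fin 4) ℝ := fun c => (pd c (curvMat G m n) y
      + connMat G c y * curvMat G m n y - curvMat G m n y * connMat G c y)
      - ∑ k, connMat G c y k m • curvMat G k n y
      - ∑ k, connMat G c y k n • curvMat G m k y with hZ
  have h1 : ∑ a, ∑ c, (G y)⁻¹ a c * covDerivRiemann G c a b m n y = ∑ c, Z c c b := by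
    rw [Finset.sum_comm]
    refine Finset.sum_congr rfl fun c _ => ?_
    have : ∀ a, (G y)⁻¹ a c * covDerivRiemann G c a b m n y
        = (G y)⁻¹ c a * (G y * Z c) a b := fun a => by
      rw [hG.covDerivRiemann_eq hy, ← congrFun (congrFun (hG.inv_symm hy) a) c]; rfl
    simp only [this]
    rw [← Matrix.mul_apply, ← Matrix.mul_assoc, hG.inv_mul hy, Matrix.one_mul]
  rw [h1]
  have hsw := fun c d => curvMat_swap (y := y) G c d
  have hd := fun c d => (hG.smooth_curvMat c d).entryDiff hG.isOpen hy
  -- Ricci vanishes on the whole open set, so the derivatives of its components vanish too.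
  have p1 : ∑ c, pd m (curvMat G n c) y c b = 0 := by
    simp only [pd, Matrix.of_apply]
    rw [← pderiv_sum m fun c _ => hd n c c b, pderiv_congr_on m hG.isOpen hy (g := fun _ => 0),
      pderiv_const]
    intro z hz
    simpa [curvMat_swap G _ n] using hr z hz b n
  have p2 : ∑ c, pd n (curvMat G c m) y c b = 0 := by
    simp only [pd, Matrix.of_apply]
    rw [← pderiv_sum n fun c _ => hd c m c b, pderiv_congr_on n hG.isOpen hy (g := fun _ => 0),
      pderiv_const]
    exact fun z hz => hr z hz b m
  have q1 : ∑ c, (curvMat G n c y * connMat G m y) c b = 0 := by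
    simp only [Matrix.mul_apply]
    rw [Finset.sum_comm]
    simp only [← Finset.sum_mul]
    refine Finset.sum_eq_zero fun k _ => ?_
    have : ∑ i, curvMat G n i y i k = 0 := by
      simpa [curvMat_swap G _ n] using hr y hy k n
    rw [this, zero_mul]
  have q2 : ∑ c, (curvMat G c m y * connMat G n y) c b = 0 := by
    simp only [Matrix.mul_apply]
    rw [Finset.sum_comm]
    simp only [← Finset.sum_mul, hr y hy, zero_mul, Finset.sum_const_zero]
  -- Torsion-freeness identifies these commutator terms with the connection corrections on the form
  -- indices m and n, which the matrix Bianchi identity does not contain.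
  have t1 : ∑ c, (connMat G m y * curvMat G n c y) c b
      = -∑ c, ∑ k, connMat G c y k m * curvMat G k n y c b := by
    simp only [Matrix.mul_apply]
    rw [Finset.sum_comm, ← Finset.sum_neg_distrib]
    refine Finset.sum_congr rfl fun k _ => ?_
    rw [← Finset.sum_neg_distrib]
    refine Finset.sum_congr rfl fun c _ => ?_
    rw [hsw c n, show connMat G k y c m = connMat G m y c k from hG.christoffel_symm hy _ _ _]
    simp
  have t2 : ∑ c, (connMat G n y * curvMat G c m y) c b
      = -∑ c, ∑ k, connMat G c y k n * curvMat G m k y c b := by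
    simp only [Matrix.mul_apply]
    rw [Finset.sum_comm, ← Finset.sum_neg_distrib]
    refine Finset.sum_congr rfl fun k _ => ?_
    rw [← Finset.sum_neg_distrib]
    refine Finset.sum_congr rfl fun c _ => ?_
    rw [hsw c m, show connMat G k y c n = connMat G n y c k from hG.christoffel_symm hy _ _ _]
    simp
  have hB : ∑ c, ((pd c (curvMat G m n) y + connMat G c y * curvMat G m n y
      - curvMat G m n y * connMat G c y)
    + (pd m (curvMat G n c) y + connMat G m y * curvMat G n c y - curvMat G n c y * connMat G m y)
    + (pd n (curvMat G c m) y + connMat G n y * curvMat G c m y - curvMat G c m y * connMat G n y))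
      c b = 0 := Finset.sum_eq_zero fun c _ => by rw [hG.bianchi_second hy c m n]; rfl
  simp only [hZ, Matrix.add_apply, Matrix.sub_apply, Matrix.sum_apply, Matrix.smul_apply,
    smul_eq_mul, Finset.sum_add_distrib, Finset.sum_sub_distrib] at hB ⊢
  linarith

end IsMetricOn

/-! ### Second derivatives of a Killing field. -/

section Killing

variable {G : E4 → Matrix (Fin 4) (Fin 4) ℝ} {Ω : Set E4} {τ : Fin 4 → E4 → ℝ} {y : E4}

/-- The second covariant derivative of a Killing field is determined by the curvature. -/
theorem IsMetricOn.covDeriv_killing (hG : IsMetricOn G Ω) (hτ : ∀ i, ContDiffOn ℝ ∞ (τ i) Ω)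
    (hK : ∀ z ∈ Ω, ∀ i j, covDeriv₁ G τ i j z + covDeriv₁ G τ j i z = 0) (hy : y ∈ Ω)
    (c a b : Fin 4) :
    pderiv c (covDeriv₁ G τ a b) y - ∑ k, (christoffel G k c a y * covDeriv₁ G τ k b y
      + christoffel G k c b y * covDeriv₁ G τ a k y)
      = ∑ l, (∑ m, (G y)⁻¹ l m * τ m y) * riemann G l c a b y := by
  -- Treating the covector as a one-row matrix lets the Ricci identity be proved by matrix algebra.
  set t : E4 → Matrix Unit (Fin 4) ℝ := fun z => Matrix.of fun _ i => τ i z with ht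
  have st : EntrySmooth t Ω := fun _ i => hτ i
  set Fr : Fin 4 → E4 → Matrix Unit (Fin 4) ℝ := fun a z => pd a t z - t z * connMat G a z with hFr
  have hF : ∀ a b z, covDeriv₁ G τ a b z = Fr a z () b := fun a b z => by
    simp only [covDeriv₁, hFr, Matrix.sub_apply, pd, Matrix.of_apply, Matrix.mul_apply, ht, connMat,
      mul_comm]
  have s := fun c => (hG.smooth_connMat c).entryDiff hG.isOpen hy
  have st' := st.entryDiff hG.isOpen hy
  have spt := fun a => (st.pd hG.isOpen a).entryDiff hG.isOpen hy
  have hpF : ∀ c a, pd c (Fr a) y = pd c (pd a t) y - (pd c t y * connMat G a y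
      + t y * pd c (connMat G a) y) := fun c a => by
    rw [← pd_mul c st' (s a), ← pd_sub c (spt a) (st'.mul (s a))]
  have ricciId : ∀ c a, (pd c (Fr a) y - Fr a y * connMat G c y)
      - (pd a (Fr c) y - Fr c y * connMat G a y) = -(t y * curvMat G c a y) := fun c a => by
    rw [hpF, hpF, pd_comm c a hG.isOpen hy st]
    simp only [hFr, curvMat, Matrix.sub_mul, Matrix.mul_sub, Matrix.mul_add, Matrix.mul_assoc]
    abel
  set K : Fin 4 → Fin 4 → Fin 4 → ℝ := fun c a b =>
    pderiv c (covDeriv₁ G τ a b) y - ∑ k, (christoffel G k c a y * covDeriv₁ G τ k b y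
      + christoffel G k c b y * covDeriv₁ G τ a k y) with hKd
  have hFd : ∀ z, z ∈ Ω → ∀ i j, covDeriv₁ G τ i j z = -covDeriv₁ G τ j i z := fun z hz i j => by
    linarith [hK z hz i j]
  have hanti : ∀ c a b, K c b a = -K c a b := fun c a b => by
    simp only [hKd]
    have hs : ∑ k, (christoffel G k c b y * covDeriv₁ G τ k a y
        + christoffel G k c a y * covDeriv₁ G τ b k y)
        = -∑ k, (christoffel G k c a y * covDeriv₁ G τ k b y
        + christoffel G k c b y * covDeriv₁ G τ a k y) := by
      rw [← Finset.sum_neg_distrib]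
      refine Finset.sum_congr rfl fun k _ => ?_
      rw [hFd y hy k a, hFd y hy k b]; ring
    rw [pderiv_congr_on c hG.isOpen hy (fun z hz => hFd z hz b a), pderiv_neg, hs]
    ring
  have hKF : ∀ c a b, K c a b = (pd c (Fr a) y - Fr a y * connMat G c y) () b
      - ∑ k, christoffel G k c a y * covDeriv₁ G τ k b y := fun c a b => by
    have e1 : covDeriv₁ G τ a b = fun z => Fr a z () b := funext (hF a b)
    simp only [hKd, Matrix.sub_apply, Matrix.mul_apply, pd, Matrix.of_apply, Finset.sum_add_distrib,
      e1, hF a _ y]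
    simp only [connMat, Matrix.of_apply, mul_comm]
    ring
  set u : Fin 4 → ℝ := fun l => ∑ m, (G y)⁻¹ l m * τ m y with hu
  have hlow : ∀ c a b, (t y * curvMat G c a y) () b = ∑ l, u l * riemann G l b c a y :=
      fun c a b => by
    have h1 : ∀ k, ∑ l, u l * G y l k = τ k y := fun k => by
      have h2 : ∑ l, u l * G y l k = (G y *ᵥ ((G y)⁻¹ *ᵥ fun m => τ m y)) k := by
        simp only [Matrix.mulVec, dotProduct, hu]
        exact Finset.sum_congr rfl fun l _ => by rw [hG.symm_apply hy k l, mul_comm]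
      rw [h2, Matrix.mulVec_mulVec, hG.mul_inv hy, Matrix.one_mulVec]
    simp only [riemann_eq, Matrix.mul_apply, Finset.mul_sum]
    rw [Finset.sum_comm]
    refine Finset.sum_congr rfl fun k _ => ?_
    simp only [← mul_assoc, ← Finset.sum_mul, h1]
    rfl
  have hdiff : ∀ c a b, K c a b - K a c b = -∑ l, u l * riemann G l b c a y := fun c a b => by
    rw [hKF, hKF, ← hlow, ← Matrix.neg_apply, ← ricciId, Matrix.sub_apply]
    have : ∀ k, christoffel G k a c y = christoffel G k c a y := fun k => hG.christoffel_symm hy _ _ _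
    simp only [this, Matrix.sub_apply]
    ring
  have hcyc : ∑ l, u l * riemann G l b c a y + ∑ l, u l * riemann G l c a b y
      + ∑ l, u l * riemann G l a b c y = 0 := by
    rw [← Finset.sum_add_distrib, ← Finset.sum_add_distrib]
    refine Finset.sum_eq_zero fun l _ => ?_
    linear_combination u l * hG.bianchi_first hy l b c a
  change K c a b = _
  -- As in Koszul's formula: DDT is antisymmetric in its last two slots and its commutator in the
  -- first two is known, so cyclic permutations determine it. The cyclic identity `hcyc` merges the
  -- three curvature terms into one.
  linarith [hdiff c a b, hdiff a b c, hdiff b c a, hanti c a b, hanti a b c, hanti b c a]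

end Killing

/-! ### Derivatives of determinants and of roots. -/

section Determinant

variable {y : E4}

/-- Jacobi's formula. -/
theorem pderiv_det (c : Fin 4) {X : E4 → Matrix (Fin 4) (Fin 4) ℝ} (hX : EntryDiff X y) :
    pderiv c (fun z => (X z).det) y = ((X y).adjugate * pd c X y).trace := by
  -- By Cramer's rule the trace is a sum of determinants with one column differentiated, which
  -- matches the Leibniz rule on each permutation product.
  have h1 : ((X y).adjugate * pd c X y).trace
      = ∑ j, ((X y).updateCol j fun i => pd c X y i j).det := by
    simp only [← cramer_apply, cramer_eq_adjugate_mulVec]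
    rfl
  rw [h1]
  simp only [Matrix.det_apply', Fin.prod_univ_four]
  have hp : ∀ σ : Equiv.Perm (Fin 4), DifferentiableAt ℝ (fun z =>
      X z (σ 0) 0 * X z (σ 1) 1 * X z (σ 2) 2 * X z (σ 3) 3) y := fun σ =>
    (((hX _ _).mul (hX _ _)).mul (hX _ _)).mul (hX _ _)
  have hs : ∀ σ ∈ (Finset.univ : Finset (Equiv.Perm (Fin 4))), DifferentiableAt ℝ (fun z =>
      ((Equiv.Perm.sign σ : ℤ) : ℝ) * (X z (σ 0) 0 * X z (σ 1) 1 * X z (σ 2) 2 * X z (σ 3) 3)) y :=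
    fun σ _ => (differentiableAt_const _).mul (hp σ)
  rw [pderiv_sum c hs, Finset.sum_comm]
  refine Finset.sum_congr rfl fun σ _ => ?_
  have m1 : DifferentiableAt ℝ (fun z => X z (σ 0) 0 * X z (σ 1) 1) y := (hX _ _).mul (hX _ _)
  have m2 : DifferentiableAt ℝ (fun z => X z (σ 0) 0 * X z (σ 1) 1 * X z (σ 2) 2) y :=
    m1.mul (hX _ _)
  rw [pderiv_mul c (differentiableAt_const _) (hp σ), pderiv_mul c m2 (hX _ _),
    pderiv_mul c m1 (hX _ _), pderiv_mul c (hX _ _) (hX _ _), pderiv_const, ← Finset.mul_sum]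
  simp [Fin.sum_univ_four, Matrix.updateCol_apply, pd]
  ring_nf

theorem IsMetricOn.pderiv_det_metric {G : E4 → Matrix (Fin 4) (Fin 4) ℝ} {Ω : Set E4}
    (hG : IsMetricOn G Ω) (hy : y ∈ Ω) (c : Fin 4) :
    pderiv c (fun z => (G z).det) y = 2 * (connMat G c y).trace * (G y).det := by
  rw [pderiv_det c (hG.smooth.entryDiff hG.isOpen hy), hG.pd_metric hy, Matrix.mul_add,
    Matrix.trace_add, ← Matrix.mul_assoc, ← Matrix.mul_assoc, Matrix.adjugate_mul,
    Matrix.trace_mul_comm, ← Matrix.mul_assoc, Matrix.mul_adjugate]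
  simp
  ring

end Determinant

section Roots

variable {𝕜 : Type*} [RCLike 𝕜] {y : E4}

/-- A continuous branch of an `n`-th root of a differentiable function is differentiable. -/
theorem differentiableAt_of_pow {u : E4 → 𝕜} {n : ℕ} (hn : n ≠ 0) (hu : ContinuousAt u y)
    (h0 : u y ≠ 0) (hp : DifferentiableAt ℝ (fun z => u z ^ n) y) : DifferentiableAt ℝ u y := by
  have hd : HasStrictDerivAt (fun w : 𝕜 => w ^ n) (n * u y ^ (n - 1)) (u y) :=
    hasStrictDerivAt_pow n (u y)
  have hd0 : (n : 𝕜) * u y ^ (n - 1) ≠ 0 := mul_ne_zero (by exact_mod_cast hn) (pow_ne_zero _ h0)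
  have hl := hd.eventually_left_inverse hd0
  have hli : DifferentiableAt ℝ (hd.localInverse _ _ _ hd0) (u y ^ n) :=
    ((hd.to_localInverse hd0).hasDerivAt.differentiableAt).restrictScalars ℝ
  have hcomp := DifferentiableAt.comp y (f := fun z => u z ^ n) hli hp
  -- Continuity keeps u z near u y, where the local inverse of the power map recovers it from its
  -- n-th power.
  exact hcomp.congr_of_eventuallyEq ((hu.eventually hl).mono fun z hz => hz.symm)

theorem pderiv_pow {u : E4 → 𝕜} (hu : DifferentiableAt ℝ u y) (c : Fin 4) (n : ℕ) :
    pderiv c (fun z => u z ^ n) y = n * u y ^ (n - 1) * pderiv c u y := by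
  simp only [pderiv, fderiv_fun_pow n hu]
  simp

theorem pderiv_inv_pow {u : E4 → 𝕜} (hu : DifferentiableAt ℝ u y) (h0 : u y ≠ 0) (c : Fin 4)
    (n : ℕ) : pderiv c (fun z => (u z ^ n)⁻¹) y = -n * (u y ^ (n + 1))⁻¹ * pderiv c u y := by
  have hd : DifferentiableAt ℝ (fun z => u z ^ n) y := hu.pow n
  have hi : DifferentiableAt ℝ (fun z => (u z ^ n)⁻¹) y := hd.inv (pow_ne_zero _ h0)
  have hne : ∀ᶠ z in nhds y, u z ≠ 0 := hu.continuousAt.eventually_ne h0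
  have h1 : pderiv c (fun z => u z ^ n * (u z ^ n)⁻¹) y = 0 := by
    rw [pderiv_congr c (g := fun _ => 1) (hne.mono fun z hz => mul_inv_cancel₀ (pow_ne_zero _ hz)),
      pderiv_const]
  rw [pderiv_mul c hd hi, pderiv_pow hu] at h1
  rcases n with _ | n
  · simpa using h1
  · have h2 : u y ^ (n + 1) * pderiv c (fun z => (u z ^ (n + 1))⁻¹) y
        = -((n + 1 : ℕ) * u y ^ n * pderiv c u y * (u y ^ (n + 1))⁻¹) := by
      simp only [Nat.add_sub_cancel] at h1
      linear_combination h1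
    refine mul_left_cancel₀ (pow_ne_zero (n + 1) h0) ?_
    rw [h2]
    field_simp
    ring

end Roots

/-! ### Covariant derivatives of complex 2-tensors. -/

section ComplexFields

variable {Ω : Set E4} {G : E4 → Matrix (Fin 4) (Fin 4) ℝ} {y : E4}

/-- Complexification of a real matrix. -/
def cplx {ι κ : Type*} (X : Matrix ι κ ℝ) : Matrix ι κ ℂ := X.map Complex.ofReal

/-- The covariant derivative of a covariant `2`-tensor field, as a matrix. -/
noncomputable def covMat (G : E4 → Matrix (Fin 4) (Fin 4) ℝ) (c : Fin 4)
    (X : E4 → Matrix (Fin 4) (Fin 4) ℂ) (y : E4) : Matrix (Fin 4) (Fin 4) ℂ :=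
  pd c X y - (cplx (connMat G c y))ᵀ * X y - X y * cplx (connMat G c y)

theorem cplx_mul (X Y : Matrix (Fin 4) (Fin 4) ℝ) : cplx (X * Y) = cplx X * cplx Y :=
  Matrix.map_mul (f := Complex.ofRealHom)

theorem cplx_transpose {ι κ : Type*} (X : Matrix ι κ ℝ) : cplx Xᵀ = (cplx X)ᵀ := rfl

theorem cplx_one : cplx (1 : Matrix (Fin 4) (Fin 4) ℝ) = 1 := by
  simp [cplx]

theorem cplx_det (X : Matrix (Fin 4) (Fin 4) ℝ) : (cplx X).det = (X.det : ℂ) :=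
  (Complex.ofRealHom.map_det X).symm

theorem cplx_trace (X : Matrix (Fin 4) (Fin 4) ℝ) : (cplx X).trace = (X.trace : ℂ) := by
  simp [cplx, Matrix.trace]

theorem differentiableAt_ofReal {f : E4 → ℝ} (hf : DifferentiableAt ℝ f y) :
    DifferentiableAt ℝ (fun z => (f z : ℂ)) y :=
  Complex.ofRealCLM.differentiableAt.comp y hf

theorem EntryDiff.cplx {ι κ : Type*} {X : E4 → Matrix ι κ ℝ} (hX : EntryDiff X y) :
    EntryDiff (fun z => cplx (X z)) y := fun i j => differentiableAt_ofReal (hX i j)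

theorem pd_cplx {ι κ : Type*} (c : Fin 4) {X : E4 → Matrix ι κ ℝ} (hX : EntryDiff X y) :
    pd c (fun z => cplx (X z)) y = cplx (pd c X y) := by
  ext i j; exact pderiv_ofReal c (hX i j)

theorem covDeriv₂_eq (A : Fin 4 → Fin 4 → E4 → ℂ) (c a b : Fin 4) :
    covDeriv₂ G A c a b y = covMat G c (fun z => Matrix.of fun a b => A a b z) y a b := by
  simp only [covDeriv₂, covMat, pd, cplx, Matrix.sub_apply, Matrix.of_apply, Matrix.mul_apply,
    Matrix.transpose_apply, Matrix.map_apply, connMat, Finset.sum_add_distrib, sub_sub, mul_comm]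

theorem EntryDiff.sharp {gi X : E4 → Matrix (Fin 4) (Fin 4) ℂ} (hg : EntryDiff gi y)
    (hX : EntryDiff X y) : EntryDiff (fun z => sharp (gi z) (X z)) y :=
  (hg.mul hX).mul hg.transpose

theorem EntryDiff.starMat {gi X : E4 → Matrix (Fin 4) (Fin 4) ℂ} {e : E4 → ℂ}
    (he : DifferentiableAt ℝ e y) (hg : EntryDiff gi y) (hX : EntryDiff X y) :
    EntryDiff (fun z => starMat (e z) (gi z) (X z)) y := fun i j => by
  have h := hg.sharp hX
  refine he.mul ?_
  fin_cases i <;> fin_cases j <;> simp only [Fin.mk_one, Fin.zero_eta, Fin.reduceFinMk,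
    dualMat_apply] <;> first | exact differentiableAt_const _ | exact h _ _ | exact (h _ _).neg

theorem differentiableAt_pair {gi X Y : E4 → Matrix (Fin 4) (Fin 4) ℂ} (hg : EntryDiff gi y)
    (hX : EntryDiff X y) (hY : EntryDiff Y y) :
    DifferentiableAt ℝ (fun z => pair (gi z) (X z) (Y z)) y :=
  DifferentiableAt.fun_sum fun m _ => DifferentiableAt.fun_sum fun n _ =>
    (hX m n).mul (hg.sharp hY m n)

theorem pd_dualMat (c : Fin 4) (X : E4 → Matrix (Fin 4) (Fin 4) ℂ) :
    pd c (fun z => dualMat (X z)) y = dualMat (pd c X y) := by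
  ext i j
  fin_cases i <;> fin_cases j <;> simp only [Fin.mk_one, Fin.zero_eta, Fin.reduceFinMk, pd,
    Matrix.of_apply, dualMat_apply, pderiv_const, pderiv_neg]

theorem pd_smul (c : Fin 4) {f : E4 → ℂ} {X : E4 → Matrix (Fin 4) (Fin 4) ℂ}
    (hf : DifferentiableAt ℝ f y) (hX : EntryDiff X y) :
    pd c (fun z => f z • X z) y = pderiv c f y • X y + f y • pd c X y := by
  ext i j; exact pderiv_mul c hf (hX i j)

theorem covMat_add (c : Fin 4) {X Y : E4 → Matrix (Fin 4) (Fin 4) ℂ} (hX : EntryDiff X y)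
    (hY : EntryDiff Y y) :
    covMat G c (fun z => X z + Y z) y = covMat G c X y + covMat G c Y y := by
  simp only [covMat, pd_add c hX hY, Matrix.mul_add, Matrix.add_mul]
  abel

theorem covMat_smul (c : Fin 4) {f : E4 → ℂ} {X : E4 → Matrix (Fin 4) (Fin 4) ℂ}
    (hf : DifferentiableAt ℝ f y) (hX : EntryDiff X y) :
    covMat G c (fun z => f z • X z) y = pderiv c f y • X y + f y • covMat G c X y := by
  simp only [covMat, pd_smul c hf hX, Matrix.mul_smul, Matrix.smul_mul, smul_sub]
  abel

namespace IsMetricOn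

variable (hG : IsMetricOn G Ω)
include hG

theorem entryDiff_cinv (hy : y ∈ Ω) : EntryDiff (fun z => cplx (G z)⁻¹) y :=
  ((hG.smooth.inv hG.det_ne).entryDiff hG.isOpen hy).cplx

/-- Raising indices commutes with the covariant derivative; the two subtracted terms are the
connection corrections for the upper indices. -/
theorem pd_sharp (hy : y ∈ Ω) (c : Fin 4) {X : E4 → Matrix (Fin 4) (Fin 4) ℂ}
    (hX : EntryDiff X y) : pd c (fun z => sharp (cplx (G z)⁻¹) (X z)) y =
      sharp (cplx (G y)⁻¹) (covMat G c X y)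
        - cplx (connMat G c y) * sharp (cplx (G y)⁻¹) (X y)
        - sharp (cplx (G y)⁻¹) (X y) * (cplx (connMat G c y))ᵀ := by
  have hi := hG.entryDiff_cinv hy
  have h1 : pd c (fun z => cplx (G z)⁻¹) y = -(cplx (connMat G c y) * cplx (G y)⁻¹)
      - cplx (G y)⁻¹ * (cplx (connMat G c y))ᵀ := by
    rw [pd_cplx c ((hG.smooth.inv hG.det_ne).entryDiff hG.isOpen hy), hG.pd_inv hy,
      ← cplx_transpose, ← cplx_mul, ← cplx_mul]
    ext i j; simp [cplx]
  have hsi : (cplx (G y)⁻¹)ᵀ = cplx (G y)⁻¹ := by rw [← cplx_transpose, hG.inv_symm hy]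
  simp only [sharp]
  rw [pd_mul c (hi.mul hX) hi.transpose, pd_mul c hi hX, pd_transpose, h1]
  simp only [covMat, Matrix.transpose_sub, Matrix.transpose_neg, Matrix.transpose_mul,
    Matrix.transpose_transpose, hsi]
  noncomm_ring

/-- The pairing is a scalar, so the connection terms cancel cyclically under the trace. -/
theorem pderiv_pair (hy : y ∈ Ω) (c : Fin 4) {X Y : E4 → Matrix (Fin 4) (Fin 4) ℂ}
    (hX : EntryDiff X y) (hY : EntryDiff Y y) :
    pderiv c (fun z => pair (cplx (G z)⁻¹) (X z) (Y z)) y =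
      pair (cplx (G y)⁻¹) (covMat G c X y) (Y y)
        + pair (cplx (G y)⁻¹) (X y) (covMat G c Y y) := by
  have hs := (hG.entryDiff_cinv hy).sharp hY
  have h1 : pderiv c (fun z => pair (cplx (G z)⁻¹) (X z) (Y z)) y
      = (pd c (fun z => X z * (sharp (cplx (G z)⁻¹) (Y z))ᵀ) y).trace := by
    simp only [pair_eq_trace, Matrix.trace, Matrix.diag_apply]
    rw [pderiv_sum c fun i _ => (hX.mul hs.transpose) i i]
    rfl
  rw [h1, pd_mul c hX hs.transpose, pd_transpose, hG.pd_sharp hy c hY]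
  simp only [pair_eq_trace, covMat, Matrix.transpose_sub, Matrix.transpose_mul,
    Matrix.transpose_transpose, Matrix.mul_sub, Matrix.sub_mul, Matrix.trace_add, Matrix.trace_sub]
  generalize (sharp (cplx (G y)⁻¹) (Y y))ᵀ = S
  rw [Matrix.mul_assoc (cplx (connMat G c y))ᵀ, Matrix.trace_mul_comm (cplx (connMat G c y))ᵀ,
    Matrix.mul_assoc (X y) (cplx (connMat G c y)), Matrix.mul_assoc (X y) S]
  ring

end IsMetricOn
end ComplexFields

/-! ### Totally antisymmetric symbols and the Hodge dual. -/

section Volume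

/-- A function of four indices is totally antisymmetric. -/
structure IsAlternating₄ (E : Fin 4 → Fin 4 → Fin 4 → Fin 4 → ℝ) : Prop where
  swap₁ : ∀ a b c d, E b a c d = -E a b c d
  swap₂ : ∀ a b c d, E a c b d = -E a b c d
  swap₃ : ∀ a b c d, E a b d c = -E a b c d

namespace IsAlternating₄

variable {E : Fin 4 → Fin 4 → Fin 4 → Fin 4 → ℝ} (hE : IsAlternating₄ E)
include hE

theorem pair_swap (a b c d : Fin 4) : E c d a b = E a b c d := by
  rw [hE.swap₂ c a d b, hE.swap₁ a c d b, hE.swap₃ a c b d, hE.swap₂ a b c d]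
  ring

theorem swap_second_fourth (a b c d : Fin 4) : E a d c b = -E a b c d := by
  rw [hE.swap₂ a c d b, hE.swap₃ a c b d, hE.swap₂ a b c d, neg_neg]

theorem half_sum (X : Matrix (Fin 4) (Fin 4) ℂ) (hX : Xᵀ = -X) (a b : Fin 4) :
    (1 / 2) * ∑ m, ∑ n, (E a b m n : ℂ) * X m n = E 0 1 2 3 * dualMat X a b := by
  have h : (Matrix.of fun a b => (1 / 2) * ∑ m, ∑ n, (E a b m n : ℂ) * X m n)
      = (E 0 1 2 3 : ℂ) • dualMat X := by
    have x := antisymm_apply hX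
    have z₂ : ∀ a b d, E a b b d = 0 := fun a b d => self_eq_neg.1 (hE.swap₂ a b b d)
    have z₃ : ∀ a b c, E a b c c = 0 := fun a b c => self_eq_neg.1 (hE.swap₃ a b c c)
    have z₄ : ∀ a b c, E a b c b = 0 := fun a b c => self_eq_neg.1 (hE.swap_second_fourth a b c b)
    have z₅ : ∀ a b d, E a b a d = 0 := fun a b d => by rw [hE.swap₁ b a, z₂, neg_zero]
    have z₆ : ∀ a b c, E a b c a = 0 := fun a b c => by rw [hE.swap₁ b a, z₄, neg_zero]
    have r : ∀ a b, E a b 1 0 = -E a b 0 1 ∧ E a b 2 0 = -E a b 0 2 ∧ E a b 3 0 = -E a b 0 3 ∧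
        E a b 2 1 = -E a b 1 2 ∧ E a b 3 1 = -E a b 1 3 ∧ E a b 3 2 = -E a b 2 3 := fun a b =>
      ⟨hE.swap₃ _ _ _ _, hE.swap₃ _ _ _ _, hE.swap₃ _ _ _ _, hE.swap₃ _ _ _ _,
        hE.swap₃ _ _ _ _, hE.swap₃ _ _ _ _⟩
    have v02 : E 0 2 1 3 = -E 0 1 2 3 := hE.swap₂ _ _ _ _
    have v03 : E 0 3 1 2 = E 0 1 2 3 := by rw [hE.swap₂ 0 1 3 2, hE.swap₃ 0 1 2 3]; ring
    have v12 : E 1 2 0 3 = E 0 1 2 3 := by rw [hE.pair_swap 0 3 1 2, v03]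
    have v13 : E 1 3 0 2 = -E 0 1 2 3 := by rw [hE.pair_swap 0 2 1 3, v02]
    have v23 : E 2 3 0 1 = E 0 1 2 3 := hE.pair_swap _ _ _ _
    apply antisymm_ext
    · ext a b
      simp only [Matrix.transpose_apply, Matrix.of_apply, Matrix.neg_apply]
      simp [hE.swap₁ a b]
    · simp [dualMat_antisymm]
    all_goals
      simp only [Matrix.of_apply, Fin.sum_univ_four, Matrix.smul_apply, smul_eq_mul, dualMat_apply,
        x, z₂, z₃, z₄, z₅, z₆, r, v02, v03, v12, v13, v23]
      push_cast
      ring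
  exact congrFun (congrFun h a) b

/-- The volume form is the star of the metric wedge tensor, which is why 𝓘 is the self-dual
projector `projSD`. -/
theorem eq_starMat {g gi : Matrix (Fin 4) (Fin 4) ℂ} (hgs : gᵀ = g) (hg : g * gi = 1)
    (a b c d : Fin 4) : (E a b c d : ℂ) = starMat (E 0 1 2 3 : ℂ) gi (wedgeMetric g a b) c d := by
  rw [starMat, Matrix.smul_apply, smul_eq_mul,
    ← hE.half_sum _ (sharp_antisymm gi (wedgeMetric_antisymm g a b))]
  simp only [sharp_wedgeMetric hgs hg]
  simp [mul_sub, Finset.sum_sub_distrib, hE.swap₃ c d a b, hE.pair_swap a b c d]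
  ring

end IsAlternating₄
end Volume

/-! ### Translation of the coordinate tensors into pointwise self-dual data. -/

/-- The local data of the theorem: a Ricci-flat metric with volume form and a Killing field on a
coordinate domain. -/
structure IsKillingVacuumOn (G : E4 → Matrix (Fin 4) (Fin 4) ℝ)
    (ε : Fin 4 → Fin 4 → Fin 4 → Fin 4 → E4 → ℝ) (τ : Fin 4 → E4 → ℝ) (Ω : Set E4) : Prop
    extends IsMetricOn G Ω where
  alternating : ∀ y, IsAlternating₄ fun a b c d => ε a b c d y
  vol_sq : ∀ y ∈ Ω, ε 0 1 2 3 y ^ 2 = -(G y).det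
  vol_cont : ContinuousOn (ε 0 1 2 3) Ω
  smooth_cov : ∀ i, ContDiffOn ℝ ∞ (τ i) Ω
  killing : ∀ y ∈ Ω, ∀ i j, covDeriv₁ G τ i j y + covDeriv₁ G τ j i y = 0
  ricci : ∀ y ∈ Ω, ∀ i j, ricci G i j y = 0

namespace IsKillingVacuumOn

variable {G : E4 → Matrix (Fin 4) (Fin 4) ℝ} {ε : Fin 4 → Fin 4 → Fin 4 → Fin 4 → E4 → ℝ}
  {τ : Fin 4 → E4 → ℝ} {Ω : Set E4} (hD : IsKillingVacuumOn G ε τ Ω) {y : E4}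

/-- The complexified volume element. -/
noncomputable def volEl (ε : Fin 4 → Fin 4 → Fin 4 → Fin 4 → E4 → ℝ) (y : E4) : ℂ :=
  (ε 0 1 2 3 y : ℂ)

/-- The complexified inverse metric. -/
noncomputable def cinv (G : E4 → Matrix (Fin 4) (Fin 4) ℝ) (y : E4) : Matrix (Fin 4) (Fin 4) ℂ :=
  cplx (G y)⁻¹

/-- The Killing form as a real matrix, complexified. -/
noncomputable def killMat (G : E4 → Matrix (Fin 4) (Fin 4) ℝ) (τ : Fin 4 → E4 → ℝ) (y : E4) :
    Matrix (Fin 4) (Fin 4) ℂ := Matrix.of fun a b => twoF G τ a b y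

/-- The self-dual Killing form. -/
noncomputable def sdKill (G : E4 → Matrix (Fin 4) (Fin 4) ℝ)
    (ε : Fin 4 → Fin 4 → Fin 4 → Fin 4 → E4 → ℝ) (τ : Fin 4 → E4 → ℝ) (y : E4) :
    Matrix (Fin 4) (Fin 4) ℂ :=
  killMat G τ y + Complex.I • starMat (volEl ε y) (cinv G y) (killMat G τ y)

/-- The complexified curvature tensor. -/
noncomputable def cRiem (G : E4 → Matrix (Fin 4) (Fin 4) ℝ) (y : E4) (a b c d : Fin 4) : ℂ :=
  (riemann G a b c d y : ℂ)

/-- The self-dual curvature tensor. -/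
noncomputable def sdRiem (G : E4 → Matrix (Fin 4) (Fin 4) ℝ)
    (ε : Fin 4 → Fin 4 → Fin 4 → Fin 4 → E4 → ℝ) (y : E4) (a b : Fin 4) :
    Matrix (Fin 4) (Fin 4) ℂ :=
  lastTwo (cRiem G y) a b
    + Complex.I • starMat (volEl ε y) (cinv G y) (lastTwo (cRiem G y) a b)

theorem raise₂_eq (A : Fin 4 → Fin 4 → E4 → ℂ) (m n : Fin 4) :
    raise₂ G A m n y = sharp (cinv G y) (Matrix.of fun a b => A a b y) m n := by
  rw [sharp_apply]; rfl

include hD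

theorem mul_cinv (hy : y ∈ Ω) : cplx (G y) * cinv G y = 1 := by
  rw [cinv, ← cplx_mul, hD.mul_inv hy, cplx_one]

theorem cinv_symm (hy : y ∈ Ω) : (cinv G y)ᵀ = cinv G y := by
  rw [cinv, ← cplx_transpose, hD.inv_symm hy]

theorem cmetric_symm (hy : y ∈ Ω) : (cplx (G y))ᵀ = cplx (G y) := by
  rw [← cplx_transpose, hD.symm y hy]

theorem volEl_sq (hy : y ∈ Ω) : volEl ε y ^ 2 = -(cplx (G y)).det := by
  rw [cplx_det, volEl]
  exact_mod_cast hD.vol_sq y hy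

theorem volEl_ne (hy : y ∈ Ω) : ε 0 1 2 3 y ≠ 0 := fun h => by
  have := hD.vol_sq y hy
  rw [h] at this
  exact hD.det_ne y hy (by linarith)

theorem hodge_eq {A : Fin 4 → Fin 4 → E4 → ℂ} {X : Matrix (Fin 4) (Fin 4) ℂ}
    (hA : ∀ a b, A a b y = X a b) (hX : Xᵀ = -X) (a b : Fin 4) :
    hodge G ε A a b y = starMat (volEl ε y) (cinv G y) X a b := by
  have h : (Matrix.of fun a b => A a b y) = X := by ext a b; exact hA a b
  simp only [hodge, raise₂_eq, h]
  exact (hD.alternating y).half_sum _ (sharp_antisymm _ hX) a b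

theorem killMat_antisymm (hy : y ∈ Ω) : (killMat G τ y)ᵀ = -killMat G τ y := by
  ext a b
  have := hD.killing y hy a b
  simp only [killMat, twoF, Matrix.transpose_apply, Matrix.of_apply, Matrix.neg_apply]
  rw [eq_neg_of_add_eq_zero_right this]
  simp

omit hD in
theorem lastTwo_antisymm (a b : Fin 4) :
    (lastTwo (cRiem G y) a b)ᵀ = -lastTwo (cRiem G y) a b := by
  ext c d
  simp [lastTwo, cRiem, IsMetricOn.riemann_swap_right G a b c d]

theorem calF_eq (hy : y ∈ Ω) (a b : Fin 4) : calF G ε τ a b y = sdKill G ε τ y a b := by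
  rw [calF, hD.hodge_eq (fun _ _ => rfl) (hD.killMat_antisymm hy)]
  rfl

theorem sum_cinv_riem (hy : y ∈ Ω) (b d : Fin 4) :
    ∑ a, ∑ c, cinv G y a c * cRiem G y c b a d = 0 := by
  have h : ∑ a, ∑ c, (G y)⁻¹ a c * riemann G c b a d y = 0 := by
    simp only [hD.sum_inv_riemann hy, ← riemannUp_eq]
    exact hD.ricci y hy b d
  have := congrArg (fun x : ℝ => (x : ℂ)) h
  push_cast at this
  exact this

theorem cRiem_swap_left (hy : y ∈ Ω) (a b c d : Fin 4) :
    cRiem G y b a c d = -cRiem G y a b c d := by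
  simp [cRiem, hD.riemann_swap_left hy a b c d]

theorem cRiem_pair (hy : y ∈ Ω) (a b c d : Fin 4) : cRiem G y c d a b = cRiem G y a b c d := by
  simp [cRiem, hD.riemann_pair hy a b c d]

theorem star_left_eq_right (hy : y ∈ Ω) (a b c d : Fin 4) :
    starMat (volEl ε y) (cinv G y) (firstTwo (cRiem G y) c d) a b
      = starMat (volEl ε y) (cinv G y) (lastTwo (cRiem G y) a b) c d :=
  starMat_firstTwo_eq _ (hD.cRiem_swap_left hy)
    (fun a b c d => by simp [cRiem, IsMetricOn.riemann_swap_right G a b c d]) (hD.cRiem_pair hy)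
    (hD.sum_cinv_riem hy) a b c d

theorem firstTwo_antisymm (hy : y ∈ Ω) (c d : Fin 4) :
    (firstTwo (cRiem G y) c d)ᵀ = -firstTwo (cRiem G y) c d := by
  ext a b
  exact hD.cRiem_swap_left hy a b c d

/-- 𝓡 is defined by the dual on the first pair, `sdRiem` by the dual on the last. Vacuum makes them
equal, and the right dual is the one compatible with pairing and differentiating F. -/
theorem calR_eq (hy : y ∈ Ω) (a b c d : Fin 4) : calR G ε a b c d y = sdRiem G ε y a b c d := by
  rw [calR, hD.hodge_eq (X := firstTwo (cRiem G y) c d) (fun _ _ => rfl)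
    (hD.firstTwo_antisymm hy c d), hD.star_left_eq_right hy]
  rfl

theorem calI_eq (hy : y ∈ Ω) (a b c d : Fin 4) :
    calI G ε a b c d y = projSD (volEl ε y) (cplx (G y)) (cinv G y) a b c d := by
  have := (hD.alternating y).eq_starMat (hD.cmetric_symm hy) (hD.mul_cinv hy) a b c d
  simp only [calI, this, projSD, Matrix.smul_apply, Matrix.add_apply, wedgeMetric, Matrix.of_apply,
    smul_eq_mul, cplx, Matrix.map_apply, volEl]
  ring

/-- The two metric terms contribute 4 - 1 copies of g, divided by 4. The volume term vanishes as an
antisymmetric array contracted with the symmetric inverse metric. -/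
theorem proj_trace (hy : y ∈ Ω) (b s : Fin 4) : ∑ r, ∑ r', cinv G y r r' *
    projSD (volEl ε y) (cplx (G y)) (cinv G y) b r' s r = 3 / 4 * cplx (G y) b s := by
  have hgi := mul_eq_one_comm.1 (hD.mul_cinv hy)
  have hsi : ∀ r r', cinv G y r r' = cinv G y r' r := fun r r' =>
    congrFun (congrFun (hD.cinv_symm hy) r') r
  have hsg : ∀ r r', cplx (G y) r r' = cplx (G y) r' r := fun r r' =>
    congrFun (congrFun (hD.cmetric_symm hy) r') r
  have t1 : ∑ r, ∑ r', cinv G y r r' * cplx (G y) r' r = 4 := by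
    have : ∑ r, ∑ r', cinv G y r r' * cplx (G y) r' r = (cinv G y * cplx (G y)).trace := by
      simp [Matrix.trace, Matrix.mul_apply]
    rw [this, hgi]; simp
  have t2 : ∑ r, ∑ r', cinv G y r r' * (cplx (G y) b r * cplx (G y) r' s) = cplx (G y) b s := by
    have : ∑ r, ∑ r', cinv G y r r' * (cplx (G y) b r * cplx (G y) r' s)
        = (cplx (G y) * (cinv G y * cplx (G y))) b s := by
      simp only [Matrix.mul_apply, Finset.mul_sum]
      exact Finset.sum_congr rfl fun _ _ => Finset.sum_congr rfl fun _ _ => by ring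
    rw [this, hgi, Matrix.mul_one]
  have t3 : ∑ r, ∑ r', cinv G y r r' * (ε b r' s r y : ℂ) = 0 := by
    have h : ∑ r, ∑ r', cinv G y r r' * (ε b r' s r y : ℂ)
        = -∑ r, ∑ r', cinv G y r r' * (ε b r' s r y : ℂ) := by
      conv_lhs => rw [Finset.sum_comm]
      simp only [← Finset.sum_neg_distrib]
      refine Finset.sum_congr rfl fun r _ => Finset.sum_congr rfl fun r' _ => ?_
      rw [hsi r' r, (hD.alternating y).swap_second_fourth b r' s r]
      push_cast; ring
    exact self_eq_neg.1 h
  have e : ∀ r r', cinv G y r r' * projSD (volEl ε y) (cplx (G y)) (cinv G y) b r' s r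
      = 1 / 4 * (cplx (G y) b s * (cinv G y r r' * cplx (G y) r' r)
        - cinv G y r r' * (cplx (G y) b r * cplx (G y) r' s)
        + Complex.I * (cinv G y r r' * (ε b r' s r y : ℂ))) := fun r r' => by
    rw [← hD.calI_eq hy]
    simp only [calI, cplx, Matrix.map_apply]
    ring
  simp only [e, ← Finset.mul_sum, Finset.sum_add_distrib, Finset.sum_sub_distrib, t1, t2, t3]
  ring

theorem selfDualData (hy : y ∈ Ω) : SelfDualData (volEl ε y) (cplx (G y)) (cinv G y)
    (sdKill G ε τ y) (sdRiem G ε y) where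
  symm := hD.cmetric_symm hy
  inv_symm := hD.cinv_symm hy
  mul_inv := hD.mul_cinv hy
  vol_sq := hD.volEl_sq hy
  F_antisymm := by
    simp only [sdKill, Matrix.transpose_add, Matrix.transpose_smul, starMat_antisymm,
      hD.killMat_antisymm hy, smul_neg, neg_add]
  F_selfDual :=
    starMat_selfDual (hD.cinv_symm hy) (hD.mul_cinv hy) (hD.volEl_sq hy) (hD.killMat_antisymm hy)
  W_swap a b := by
    have : lastTwo (cRiem G y) b a = (-1 : ℂ) • lastTwo (cRiem G y) a b := by
      ext c d
      simp [lastTwo, hD.cRiem_swap_left hy a b]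
    simp only [sdRiem, this, starMat_smul]
    simp [add_comm]
  W_antisymm a b := by
    simp only [sdRiem, Matrix.transpose_add, Matrix.transpose_smul, starMat_antisymm,
      lastTwo_antisymm, smul_neg, neg_add]
  W_selfDual a b :=
    starMat_selfDual (hD.cinv_symm hy) (hD.mul_cinv hy) (hD.volEl_sq hy) (lastTwo_antisymm a b)
  W_selfDual_left c d := by
    have : (Matrix.of fun a b => sdRiem G ε y a b c d) = firstTwo (cRiem G y) c d
        + Complex.I • starMat (volEl ε y) (cinv G y) (firstTwo (cRiem G y) c d) := by
      ext a b
      simp only [sdRiem, Matrix.of_apply, Matrix.add_apply, Matrix.smul_apply,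
        hD.star_left_eq_right hy]
      rfl
    rw [this]
    exact starMat_selfDual (hD.cinv_symm hy) (hD.mul_cinv hy) (hD.volEl_sq hy)
      (hD.firstTwo_antisymm hy c d)
  W_trace b s := by
    have h1 := trace_starMat_lastTwo (gi := cinv G y) (R := cRiem G y) (volEl ε y)
      (fun a b c d => by simp [cRiem, IsMetricOn.riemann_swap_right G a b c d])
      (fun a b c d => by simp only [cRiem]; exact_mod_cast hD.bianchi_first hy a b c d) b s
    have h2 : ∑ r, ∑ r', cinv G y r r' * cRiem G y b r' s r = 0 := by
      rw [← hD.sum_cinv_riem hy b s]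
      refine Finset.sum_congr rfl fun r _ => Finset.sum_congr rfl fun r' _ => ?_
      rw [hD.cRiem_swap_left hy r' b]
      simp [cRiem, IsMetricOn.riemann_swap_right G r' b r s]
    have e : ∀ r r', cinv G y r r' * sdRiem G ε y b r' s r = cinv G y r r' * cRiem G y b r' s r
        + Complex.I * (cinv G y r r' *
          starMat (volEl ε y) (cinv G y) (lastTwo (cRiem G y) b r') s r) := fun r r' => by
      simp only [sdRiem, Matrix.add_apply, Matrix.smul_apply, smul_eq_mul, lastTwo, Matrix.of_apply]
      ring
    simp only [e, Finset.sum_add_distrib, ← Finset.mul_sum, h1, h2]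
    simp
  proj_trace := hD.proj_trace hy

end IsKillingVacuumOn

/-! ### Differentiating the self-dual Killing form and its contraction with curvature. -/

namespace IsKillingVacuumOn

variable {G : E4 → Matrix (Fin 4) (Fin 4) ℝ} {ε : Fin 4 → Fin 4 → Fin 4 → Fin 4 → E4 → ℝ}
  {τ : Fin 4 → E4 → ℝ} {Ω : Set E4} (hD : IsKillingVacuumOn G ε τ Ω) {y : E4}
include hD

theorem differentiableAt_vol (hy : y ∈ Ω) : DifferentiableAt ℝ (ε 0 1 2 3) y := by
  refine differentiableAt_of_pow two_ne_zero
    (hD.vol_cont.continuousAt (hD.isOpen.mem_nhds hy)) (hD.volEl_ne hy) ?_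
  have h : DifferentiableAt ℝ (fun z => -(G z).det) y :=
    (((contDiffOn_det hD.smooth).contDiffAt (hD.isOpen.mem_nhds hy)).differentiableAt
      (by simp)).neg
  exact h.congr_of_eventuallyEq
    (Filter.eventuallyEq_of_mem (hD.isOpen.mem_nhds hy) fun z hz => hD.vol_sq z hz)

theorem differentiableAt_volEl (hy : y ∈ Ω) : DifferentiableAt ℝ (volEl ε) y :=
  differentiableAt_ofReal (hD.differentiableAt_vol hy)

/-- The volume form is parallel. -/
theorem pderiv_volEl (hy : y ∈ Ω) (c : Fin 4) :
    pderiv c (volEl ε) y = (cplx (connMat G c y)).trace * volEl ε y := by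
  have h1 := pderiv_pow (hD.differentiableAt_vol hy) c 2
  rw [pderiv_congr_on c hD.isOpen hy fun z hz => hD.vol_sq z hz, pderiv_neg,
    hD.pderiv_det_metric hy] at h1
  have h2 := hD.vol_sq y hy
  have h3 : pderiv c (ε 0 1 2 3) y = (connMat G c y).trace * ε 0 1 2 3 y := by
    refine mul_left_cancel₀ (hD.volEl_ne hy) ?_
    simp only [Nat.cast_ofNat, Nat.add_one_sub_one, pow_one] at h1
    linear_combination -(1 / 2) * h1 - (connMat G c y).trace * h2
  rw [cplx_trace]
  change pderiv c (fun z => (ε 0 1 2 3 z : ℂ)) y = _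
  rw [pderiv_ofReal c (hD.differentiableAt_vol hy), h3, Complex.ofReal_mul]
  rfl

/-- The Hodge star is parallel: the trace term from differentiating the volume element cancels the
upper-index connection terms by `dualMat_derivation`. -/
theorem covMat_starMat (hy : y ∈ Ω) (c : Fin 4) {X : E4 → Matrix (Fin 4) (Fin 4) ℂ}
    (hX : EntryDiff X y) (hXa : (X y)ᵀ = -X y) :
    covMat G c (fun z => starMat (volEl ε z) (cinv G z) (X z)) y =
      starMat (volEl ε y) (cinv G y) (covMat G c X y) := by
  have hs : EntryDiff (fun z => sharp (cinv G z) (X z)) y := (hD.entryDiff_cinv hy).sharp hX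
  have hd : EntryDiff (fun z => dualMat (sharp (cinv G z) (X z))) y := fun i j => by
    have := EntryDiff.starMat (e := fun _ => 1) (differentiableAt_const _) (hD.entryDiff_cinv hy) hX
    simpa [starMat, cinv] using this i j
  have h1 : pd c (fun z => starMat (volEl ε z) (cinv G z) (X z)) y =
      pderiv c (volEl ε) y • dualMat (sharp (cinv G y) (X y))
        + volEl ε y • dualMat (pd c (fun z => sharp (cinv G z) (X z)) y) := by
    rw [← pd_dualMat, ← pd_smul c (hD.differentiableAt_volEl hy) hd]
    rfl
  have h2 := hD.pd_sharp hy c hX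
  change pd c (fun z => sharp (cinv G z) (X z)) y = sharp (cinv G y) _
        - cplx (connMat G c y) * sharp (cinv G y) (X y)
        - sharp (cinv G y) (X y) * (cplx (connMat G c y))ᵀ at h2
  have h3 := dualMat_derivation (sharp_antisymm (cinv G y) hXa) (cplx (connMat G c y))
  rw [covMat, h1, h2, hD.pderiv_volEl hy, mul_comm, mul_smul, ← h3]
  set P := sharp (cinv G y) (X y)
  set A := cplx (connMat G c y)
  have h4 : sharp (cinv G y) (covMat G c X y) - A * P - P * Aᵀ
      = sharp (cinv G y) (covMat G c X y) + (-1 : ℂ) • (A * P + P * Aᵀ) := by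
    rw [neg_one_smul]; abel
  rw [h4, dualMat_add (sharp (cinv G y) (covMat G c X y)), dualMat_smul]
  simp only [starMat, Matrix.mul_smul, Matrix.smul_mul, smul_add, neg_one_smul, smul_neg]
  abel

theorem smooth_covDeriv (a b : Fin 4) : ContDiffOn ℝ ∞ (covDeriv₁ G τ a b) Ω :=
  (contDiffOn_pderiv a hD.isOpen (hD.smooth_cov b)).sub
    (ContDiffOn.sum fun k _ => (hD.smooth_connMat a k b).mul (hD.smooth_cov k))

theorem entryDiff_killMat (hy : y ∈ Ω) : EntryDiff (killMat G τ) y := fun a b =>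
  differentiableAt_ofReal (((hD.smooth_covDeriv a b).contDiffAt
    (hD.isOpen.mem_nhds hy)).differentiableAt (by simp))

theorem entryDiff_sdKill (hy : y ∈ Ω) : EntryDiff (sdKill G ε τ) y :=
  (hD.entryDiff_killMat hy).add fun a b => (differentiableAt_const _).mul
    (EntryDiff.starMat (hD.differentiableAt_volEl hy) (hD.entryDiff_cinv hy)
      (hD.entryDiff_killMat hy) a b)

theorem differentiableAt_riemann (hy : y ∈ Ω) (a b c d : Fin 4) :
    DifferentiableAt ℝ (riemann G a b c d) y := by
  have h := (hD.smooth.mul (hD.smooth_curvMat c d)).entryDiff hD.isOpen hy a b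
  simp only [← riemann_eq] at h
  exact h

theorem entryDiff_lastTwo (hy : y ∈ Ω) (a b : Fin 4) :
    EntryDiff (fun z => lastTwo (cRiem G z) a b) y := fun c d =>
  differentiableAt_ofReal (hD.differentiableAt_riemann hy a b c d)

theorem covMat_killMat (hy : y ∈ Ω) (c : Fin 4) :
    covMat G c (killMat G τ) y = ∑ l, upT G τ l y • lastTwo (cRiem G y) l c := by
  ext a b
  have h := hD.covDeriv_killing hD.smooth_cov hD.killing hy c a b
  have h' := congrArg (fun x : ℝ => (x : ℂ)) h
  have hd : DifferentiableAt ℝ (covDeriv₁ G τ a b) y := ((hD.smooth_covDeriv a b).contDiffAt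
    (hD.isOpen.mem_nhds hy)).differentiableAt (by simp)
  have hp : pd c (killMat G τ) y a b = ((pderiv c (covDeriv₁ G τ a b) y : ℝ) : ℂ) :=
    pderiv_ofReal c hd
  simp only [covMat, Matrix.sub_apply, hp, Matrix.sum_apply, Matrix.smul_apply, smul_eq_mul]
  push_cast [Finset.sum_add_distrib] at h'
  simp only [upT, invMetric, lastTwo, cRiem, Matrix.of_apply]
  rw [← h', ← sub_sub]
  simp only [Matrix.mul_apply, Matrix.transpose_apply, cplx, Matrix.map_apply, connMat,
    Matrix.of_apply, killMat, twoF, mul_comm]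

/-- As the star is parallel, the Killing identity passes to self-dual parts, with the curvature
dualised on its last pair. -/
theorem covMat_sdKill (hy : y ∈ Ω) (c : Fin 4) :
    covMat G c (sdKill G ε τ) y = ∑ l, upT G τ l y • sdRiem G ε y l c := by
  have hs : EntryDiff (fun z => starMat (volEl ε z) (cinv G z) (killMat G τ z)) y :=
    EntryDiff.starMat (hD.differentiableAt_volEl hy) (hD.entryDiff_cinv hy)
      (hD.entryDiff_killMat hy)
  have h1 : covMat G c (sdKill G ε τ) y = covMat G c (killMat G τ) y
      + covMat G c (fun z => Complex.I • starMat (volEl ε z) (cinv G z) (killMat G τ z)) y :=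
    covMat_add c (hD.entryDiff_killMat hy) fun a b => (differentiableAt_const _).mul (hs a b)
  rw [h1, covMat_smul c (differentiableAt_const _) hs, pderiv_const, zero_smul, zero_add,
    hD.covMat_starMat hy c (hD.entryDiff_killMat hy) (hD.killMat_antisymm hy),
    hD.covMat_killMat hy]
  simp only [starMat_sum, starMat_smul, Finset.smul_sum, sdRiem, smul_add, Finset.sum_add_distrib]
  congr 1
  exact Finset.sum_congr rfl fun _ _ => smul_comm _ _ _

/-- Maxwell's equation for the self-dual Killing form. -/
theorem div_sdKill (hy : y ∈ Ω) (b : Fin 4) :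
    ∑ a, ∑ c, cinv G y a c * covMat G c (sdKill G ε τ) y a b = 0 := by
  have S := hD.selfDualData hy
  have e : ∀ a c, cinv G y a c * covMat G c (sdKill G ε τ) y a b
      = ∑ l, -upT G τ l y * (cinv G y a c * sdRiem G ε y l c b a) := fun a c => by
    rw [hD.covMat_sdKill hy, Matrix.sum_apply, Finset.mul_sum]
    refine Finset.sum_congr rfl fun l _ => ?_
    have : sdRiem G ε y l c b a = -sdRiem G ε y l c a b :=
      congrFun (congrFun (S.W_antisymm l c) a) b
    rw [this, Matrix.smul_apply, smul_eq_mul]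
    ring
  simp only [e]
  have : ∀ a, ∑ c, ∑ l, -upT G τ l y * (cinv G y a c * sdRiem G ε y l c b a)
      = ∑ l, -upT G τ l y * ∑ c, cinv G y a c * sdRiem G ε y l c b a := fun a => by
    rw [Finset.sum_comm]
    simp only [Finset.mul_sum]
  simp only [this]
  rw [Finset.sum_comm]
  simp only [← Finset.mul_sum, S.W_trace, mul_zero, Finset.sum_const_zero]

omit hD in
/-- The contraction of the self-dual curvature with the self-dual Killing form. -/
noncomputable def _root_.MarsSimon.sdWF (G : E4 → Matrix (Fin 4) (Fin 4) ℝ)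
    (ε : Fin 4 → Fin 4 → Fin 4 → Fin 4 → E4 → ℝ) (τ : Fin 4 → E4 → ℝ) (y : E4) :
    Matrix (Fin 4) (Fin 4) ℂ :=
  SelfDualData.WF (cinv G y) (sdKill G ε τ y) (sdRiem G ε y)

theorem pair_sdRiem (hy : y ∈ Ω) {X : Matrix (Fin 4) (Fin 4) ℂ} (hX : Xᵀ = -X)
    (hsX : starMat (volEl ε y) (cinv G y) X = -Complex.I • X) (a b : Fin 4) :
    pair (cinv G y) (sdRiem G ε y a b) X
      = 2 * pair (cinv G y) (lastTwo (cRiem G y) a b) X :=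
  pair_selfDual_left (hD.cinv_symm hy) _ (lastTwo_antisymm a b) hX hsX

/-- This form is used for differentiation: only the real curvature occurs, so no covariant
derivative of a dualised four-index tensor is needed. -/
theorem sdWF_eq (hy : y ∈ Ω) (a b : Fin 4) : sdWF G ε τ y a b
    = 2 * pair (cinv G y) (lastTwo (cRiem G y) a b) (sdKill G ε τ y) :=
  hD.pair_sdRiem hy (hD.selfDualData hy).F_antisymm (hD.selfDualData hy).F_selfDual a b

theorem entryDiff_sdWF (hy : y ∈ Ω) : EntryDiff (sdWF G ε τ) y := fun a b => by
  have h : DifferentiableAt ℝ (fun z => 2 * pair (cinv G z) (lastTwo (cRiem G z) a b)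
      (sdKill G ε τ z)) y := (differentiableAt_const _).mul
    (differentiableAt_pair (hD.entryDiff_cinv hy) (hD.entryDiff_lastTwo hy a b)
      (hD.entryDiff_sdKill hy))
  exact h.congr_of_eventuallyEq
    (Filter.eventuallyEq_of_mem (hD.isOpen.mem_nhds hy) fun z hz => hD.sdWF_eq hz a b)

theorem covMat_sdWF (hy : y ∈ Ω) (c a b : Fin 4) : covMat G c (sdWF G ε τ) y a b =
    pair (cinv G y) (sdRiem G ε y a b) (∑ l, upT G τ l y • sdRiem G ε y l c)
      + 2 * pair (cinv G y) (Matrix.of fun m n => (covDerivRiemann G c a b m n y : ℂ))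
        (sdKill G ε τ y) := by
  have S := hD.selfDualData hy
  have hpd : pd c (sdWF G ε τ) y a b =
      2 * (pair (cinv G y) (covMat G c (fun z => lastTwo (cRiem G z) a b) y) (sdKill G ε τ y)
      + pair (cinv G y) (lastTwo (cRiem G y) a b) (covMat G c (sdKill G ε τ) y)) := by
    have hdp := differentiableAt_pair (hD.entryDiff_cinv hy) (hD.entryDiff_lastTwo hy a b)
      (hD.entryDiff_sdKill hy)
    have h1 := hD.pderiv_pair hy c (hD.entryDiff_lastTwo hy a b) (hD.entryDiff_sdKill hy)
    change pderiv c (fun z => sdWF G ε τ z a b) y = _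
    rw [pderiv_congr_on c hD.isOpen hy fun z hz => hD.sdWF_eq hz a b]
    refine (pderiv_mul c (differentiableAt_const _) hdp).trans ?_
    rw [h1, pderiv_const, zero_mul, zero_add]
    rfl
  -- The derivative of F is itself self-dual, being a combination of the `sdRiem` matrices, so the
  -- factor 2 is absorbed back into 𝓡.
  have hself : pair (cinv G y) (sdRiem G ε y a b) (covMat G c (sdKill G ε τ) y)
      = 2 * pair (cinv G y) (lastTwo (cRiem G y) a b) (covMat G c (sdKill G ε τ) y) := by
    refine hD.pair_sdRiem hy ?_ ?_ a b
    · rw [hD.covMat_sdKill hy]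
      simp only [Matrix.transpose_sum, Matrix.transpose_smul, S.W_antisymm, smul_neg,
        Finset.sum_neg_distrib]
    · rw [hD.covMat_sdKill hy]
      simp only [starMat_sum, starMat_smul, S.W_selfDual, Finset.smul_sum]
      exact Finset.sum_congr rfl fun _ _ => smul_comm _ _ _
  -- `covMat` corrects only the last two indices; the added sums correct a and b, and they match the
  -- connection terms of `sdWF` viewed as a 2-tensor.
  have hDR : (Matrix.of fun m n => (covDerivRiemann G c a b m n y : ℂ)) =
      covMat G c (fun z => lastTwo (cRiem G z) a b) y
      + (∑ k, (-(christoffel G k c a y : ℂ)) • lastTwo (cRiem G y) k b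
      + ∑ k, (-(christoffel G k c b y : ℂ)) • lastTwo (cRiem G y) a k) := by
    ext m n
    have hp : pd c (fun z => lastTwo (cRiem G z) a b) y m n
        = ((pderiv c (riemann G a b m n) y : ℝ) : ℂ) :=
      pderiv_ofReal c (hD.differentiableAt_riemann hy a b m n)
    rw [Matrix.add_apply, covMat, Matrix.sub_apply, Matrix.sub_apply, hp]
    simp only [Matrix.add_apply, Matrix.of_apply, covDerivRiemann,
      Matrix.sum_apply, Matrix.smul_apply, smul_eq_mul, lastTwo, cRiem, Matrix.mul_apply,
      Matrix.transpose_apply, cplx, Matrix.map_apply, connMat, neg_mul, Finset.sum_neg_distrib]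
    push_cast
    simp only [mul_comm]
    ring
  have hlin : ∀ (f : Fin 4 → ℂ) (M : Fin 4 → Matrix (Fin 4) (Fin 4) ℂ),
      pair (cinv G y) (∑ k, f k • M k) (sdKill G ε τ y)
        = ∑ k, f k * pair (cinv G y) (M k) (sdKill G ε τ y) := fun f M => by
    simp only [pair_eq_trace, Finset.sum_mul, Matrix.trace_sum, Matrix.smul_mul, Matrix.trace_smul,
      smul_eq_mul]
  rw [← hD.covMat_sdKill hy, hself, hDR, pair_add_left, pair_add_left, hlin, hlin]
  rw [covMat, Matrix.sub_apply, Matrix.sub_apply, hpd]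
  simp only [Matrix.mul_apply, Matrix.transpose_apply, hD.sdWF_eq hy, cplx, Matrix.map_apply,
    connMat, Matrix.of_apply, Finset.mul_sum, mul_add, neg_mul, mul_neg, Finset.sum_neg_distrib]
  have r1 : ∀ k, (christoffel G k c a y : ℂ) *
      (2 * pair (cinv G y) (lastTwo (cRiem G y) k b) (sdKill G ε τ y)) =
      2 * ((christoffel G k c a y : ℂ) *
        pair (cinv G y) (lastTwo (cRiem G y) k b) (sdKill G ε τ y)) := fun k => by ring
  have r2 : ∀ k, 2 * pair (cinv G y) (lastTwo (cRiem G y) a k) (sdKill G ε τ y) *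
      (christoffel G k c b y : ℂ) =
      2 * ((christoffel G k c b y : ℂ) *
        pair (cinv G y) (lastTwo (cRiem G y) a k) (sdKill G ε τ y)) := fun k => by ring
  simp only [r1, r2]
  ring

theorem sum_pair_covDerivRiemann (hy : y ∈ Ω) (b : Fin 4) :
    ∑ a, ∑ c, cinv G y a c * pair (cinv G y)
      (Matrix.of fun m n => (covDerivRiemann G c a b m n y : ℂ)) (sdKill G ε τ y) = 0 := by
  have h : ∀ m n, ∑ a, ∑ c, cinv G y a c * (covDerivRiemann G c a b m n y : ℂ) = 0 :=
      fun m n => by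
    have := congrArg (fun x : ℝ => (x : ℂ)) (hD.div_riemann hD.ricci hy b m n)
    push_cast at this
    exact this
  have e : ∀ a c, cinv G y a c * pair (cinv G y)
      (Matrix.of fun m n => (covDerivRiemann G c a b m n y : ℂ)) (sdKill G ε τ y)
      = pair (cinv G y) (cinv G y a c • Matrix.of fun m n => (covDerivRiemann G c a b m n y : ℂ))
        (sdKill G ε τ y) := fun a c => (pair_smul_left _ _ _ _).symm
  have hs : ∀ (M : Fin 4 → Matrix (Fin 4) (Fin 4) ℂ), ∑ k, pair (cinv G y) (M k) (sdKill G ε τ y)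
      = pair (cinv G y) (∑ k, M k) (sdKill G ε τ y) := fun M => by
    simp only [pair_eq_trace, Finset.sum_mul, Matrix.trace_sum]
  simp only [e, hs]
  have h0 : ∑ a, ∑ c, cinv G y a c • (Matrix.of fun m n => (covDerivRiemann G c a b m n y : ℂ))
      = 0 := by
    ext m n
    simpa [Matrix.sum_apply] using h m n
  rw [h0]
  simp [pair]

end IsKillingVacuumOn

/-! ### The root h, the form 𝓗 and its Maxwell equation. -/

namespace IsKillingVacuumOn

variable {G : E4 → Matrix (Fin 4) (Fin 4) ℝ} {ε : Fin 4 → Fin 4 → Fin 4 → Fin 4 → E4 → ℝ}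
  {τ : Fin 4 → E4 → ℝ} {Ω : Set E4} (hD : IsKillingVacuumOn G ε τ Ω) {y : E4} {h : E4 → ℂ} {C : ℂ}

/-- The scalar `𝓕²`. -/
noncomputable def sdNorm (G : E4 → Matrix (Fin 4) (Fin 4) ℝ)
    (ε : Fin 4 → Fin 4 → Fin 4 → Fin 4 → E4 → ℝ) (τ : Fin 4 → E4 → ℝ) (y : E4) : ℂ :=
  pair (cinv G y) (sdKill G ε τ y) (sdKill G ε τ y)

/-- The Mars–Simon tensor as a matrix in its last two indices. -/
noncomputable def sdS (G : E4 → Matrix (Fin 4) (Fin 4) ℝ)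
    (ε : Fin 4 → Fin 4 → Fin 4 → Fin 4 → E4 → ℝ) (τ : Fin 4 → E4 → ℝ) (h : E4 → ℂ) (y : E4)
    (a b : Fin 4) : Matrix (Fin 4) (Fin 4) ℂ :=
  SelfDualData.marsSimon (volEl ε y) (cplx (G y)) (cinv G y) (sdKill G ε τ y) (sdRiem G ε y)
    (h y) a b

include hD

theorem raise_calF (hy : y ∈ Ω) (m n : Fin 4) :
    raise₂ G (calF G ε τ) m n y = sharp (cinv G y) (sdKill G ε τ y) m n := by
  rw [raise₂_eq]
  congr 1
  ext a b
  exact hD.calF_eq hy a b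

theorem calFsq_eq (hy : y ∈ Ω) : calFsq G ε τ y = sdNorm G ε τ y := by
  simp only [calFsq, hD.calF_eq hy, hD.raise_calF hy]
  rfl

theorem calS_eq (hy : y ∈ Ω) (a b c d : Fin 4) :
    calS G ε τ h a b c d y = sdS G ε τ h y a b c d := by
  simp only [calS, calQ, hD.calF_eq hy, hD.calR_eq hy, hD.calI_eq hy, hD.calFsq_eq hy, sdS,
    SelfDualData.marsSimon, sdNorm, Matrix.add_apply, Matrix.smul_apply, smul_eq_mul]
  ring

theorem calSF_eq (hy : y ∈ Ω) (a b : Fin 4) :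
    calSF G ε τ h a b y = pair (cinv G y) (sdS G ε τ h y a b) (sdKill G ε τ y) := by
  simp only [calSF, hD.calS_eq hy, hD.raise_calF hy]
  rfl

theorem calSF_eq_add (hy : y ∈ Ω) (a b : Fin 4) : calSF G ε τ h a b y =
    sdWF G ε τ y a b + 4 * (h y)⁻¹ * sdNorm G ε τ y * sdKill G ε τ y a b := by
  rw [hD.calSF_eq hy]
  exact (hD.selfDualData hy).pair_marsSimon (h y) a b

theorem calSS_eq (hy : y ∈ Ω) (s b : Fin 4) : calSS G ε τ h s b y =
    ∑ r, ∑ r', cinv G y r r' * pair (cinv G y) (sdS G ε τ h y s r) (sdS G ε τ h y b r') := by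
  simp only [calSS, hD.calS_eq hy, pair, sharp_apply, Finset.mul_sum]
  refine Finset.sum_congr rfl fun r _ => ?_
  have e : ∀ m, ∑ n, ∑ r', ∑ m', ∑ n', invMetric G r r' y * invMetric G m m' y *
      invMetric G n n' y * sdS G ε τ h y b r' m' n' * sdS G ε τ h y s r m n
      = ∑ r', ∑ n, ∑ m', ∑ n', invMetric G r r' y * invMetric G m m' y *
      invMetric G n n' y * sdS G ε τ h y b r' m' n' * sdS G ε τ h y s r m n := fun m =>
    Finset.sum_comm
  simp only [e]
  rw [Finset.sum_comm]
  exact Finset.sum_congr rfl fun _ _ => Finset.sum_congr rfl fun _ _ => Finset.sum_congr rfl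
    fun _ _ => Finset.sum_congr rfl fun _ _ => Finset.sum_congr rfl fun _ _ => by
      simp only [cinv, invMetric, cplx, Matrix.map_apply]; ring

theorem differentiableAt_sdNorm (hy : y ∈ Ω) : DifferentiableAt ℝ (sdNorm G ε τ) y :=
  differentiableAt_pair (hD.entryDiff_cinv hy) (hD.entryDiff_sdKill hy) (hD.entryDiff_sdKill hy)

theorem pderiv_sdNorm (hy : y ∈ Ω) (c : Fin 4) :
    pderiv c (sdNorm G ε τ) y = 2 * ∑ l, upT G τ l y * sdWF G ε τ y l c := by
  have hs := hD.cinv_symm hy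
  have h1 : pderiv c (sdNorm G ε τ) y = _ :=
    hD.pderiv_pair hy c (hD.entryDiff_sdKill hy) (hD.entryDiff_sdKill hy)
  change _ = pair (cinv G y) _ _ + pair (cinv G y) _ _ at h1
  rw [h1, pair_comm hs (sdKill G ε τ y), hD.covMat_sdKill hy, ← two_mul]
  congr 1
  simp only [pair_eq_trace, Finset.sum_mul, Matrix.trace_sum, Matrix.smul_mul, Matrix.trace_smul,
    smul_eq_mul, sdWF, SelfDualData.WF, Matrix.of_apply]

section Root

variable (hc : ContinuousOn h Ω) (h0 : ∀ z ∈ Ω, h z ≠ 0)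
  (hh : ∀ z ∈ Ω, h z ^ 4 = -C ^ 4 * sdNorm G ε τ z)
include hc h0 hh

theorem differentiableAt_root (hy : y ∈ Ω) : DifferentiableAt ℝ h y := by
  refine differentiableAt_of_pow (n := 4) (by norm_num)
    (hc.continuousAt (hD.isOpen.mem_nhds hy)) (h0 y hy) ?_
  have hd : DifferentiableAt ℝ (fun z => -C ^ 4 * sdNorm G ε τ z) y :=
    (differentiableAt_const _).mul (hD.differentiableAt_sdNorm hy)
  exact hd.congr_of_eventuallyEq
    (Filter.eventuallyEq_of_mem (hD.isOpen.mem_nhds hy) fun z hz => hh z hz)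

/-- Differentiate h⁴ = -C⁴ 𝓕² and use D𝓕² = 2 T·WF; the factor is -½ = -2/4. -/
theorem pderiv_root (hy : y ∈ Ω) (c : Fin 4) : pderiv c h y =
    -(1 / 2) * C ^ 4 * (h y ^ 3)⁻¹ * ∑ l, upT G τ l y * sdWF G ε τ y l c := by
  have h1 := pderiv_pow (hD.differentiableAt_root hc h0 hh hy) c 4
  have h2 := pderiv_mul c (differentiableAt_const (-C ^ 4)) (hD.differentiableAt_sdNorm hy)
  rw [pderiv_congr_on c hD.isOpen hy fun z hz => hh z hz, h2, pderiv_const,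
    hD.pderiv_sdNorm hy] at h1
  have hne : h y ^ 3 ≠ 0 := pow_ne_zero 3 (h0 y hy)
  refine mul_left_cancel₀ hne ?_
  simp only [Nat.cast_ofNat, Nat.add_one_sub_one, zero_mul, zero_add] at h1
  have hi : h y ^ 3 * (h y ^ 3)⁻¹ = 1 := mul_inv_cancel₀ hne
  linear_combination -(1 / 4) * h1
    + (1 / 2) * C ^ 4 * (∑ l, upT G τ l y * sdWF G ε τ y l c) * hi

-- The choice of the fourth root makes h⁻⁴ 𝓕² the constant -C⁻⁴. Thus the 𝓠 part of 𝓗 is a constant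
-- multiple of 𝓕, which is divergence free.
omit hc in
theorem calH_eq (hC : C ≠ 0) (hy : y ∈ Ω) (a b : Fin 4) : calH G ε τ h a b y =
    ((h y ^ 3)⁻¹ • sdWF G ε τ y + (-4 * (C ^ 4)⁻¹) • sdKill G ε τ y) a b := by
  have hne := h0 y hy
  have hf : sdNorm G ε τ y = -(C ^ 4)⁻¹ * h y ^ 4 := by
    rw [hh y hy]
    field_simp
  rw [calH, hD.calSF_eq_add hy, hf]
  simp only [Matrix.add_apply, Matrix.smul_apply, smul_eq_mul]
  field_simp

theorem entryDiff_calH (hC : C ≠ 0) (hy : y ∈ Ω) (a b : Fin 4) :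
    DifferentiableAt ℝ (calH G ε τ h a b) y := by
  have hi : DifferentiableAt ℝ (fun z => (h z ^ 3)⁻¹) y :=
    ((hD.differentiableAt_root hc h0 hh hy).pow 3).inv (pow_ne_zero 3 (h0 y hy))
  have hd : DifferentiableAt ℝ (fun z => ((h z ^ 3)⁻¹ • sdWF G ε τ z
      + (-4 * (C ^ 4)⁻¹) • sdKill G ε τ z) a b) y :=
    (hi.mul (hD.entryDiff_sdWF hy a b)).add
      ((differentiableAt_const _).mul (hD.entryDiff_sdKill hy a b))
  exact hd.congr_of_eventuallyEq
    (Filter.eventuallyEq_of_mem (hD.isOpen.mem_nhds hy) fun z hz => hD.calH_eq h0 hh hC hz a b)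

theorem covMat_calH (hC : C ≠ 0) (hy : y ∈ Ω) (c : Fin 4) :
    covMat G c (fun z => Matrix.of fun a b => calH G ε τ h a b z) y =
      (-3 * (h y ^ 4)⁻¹ * pderiv c h y) • sdWF G ε τ y + (h y ^ 3)⁻¹ • covMat G c (sdWF G ε τ) y
        + (-4 * (C ^ 4)⁻¹) • covMat G c (sdKill G ε τ) y := by
  have hdh := hD.differentiableAt_root hc h0 hh hy
  have hi : DifferentiableAt ℝ (fun z => (h z ^ 3)⁻¹) y := (hdh.pow 3).inv (pow_ne_zero 3 (h0 y hy))
  have e : ∀ z ∈ Ω, (Matrix.of fun a b => calH G ε τ h a b z)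
      = (h z ^ 3)⁻¹ • sdWF G ε τ z + (-4 * (C ^ 4)⁻¹) • sdKill G ε τ z := fun z hz => by
    ext a b; exact hD.calH_eq h0 hh hC hz a b
  have h1 : covMat G c (fun z => Matrix.of fun a b => calH G ε τ h a b z) y = covMat G c
      (fun z => (h z ^ 3)⁻¹ • sdWF G ε τ z + (-4 * (C ^ 4)⁻¹) • sdKill G ε τ z) y := by
    rw [covMat, covMat, pd_congr_on c hD.isOpen hy e, e y hy]
  have hW := hD.entryDiff_sdWF hy
  have hK := hD.entryDiff_sdKill hy
  have hW' : EntryDiff (fun z => (h z ^ 3)⁻¹ • sdWF G ε τ z) y := fun a b => hi.mul (hW a b)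
  have hK' : EntryDiff (fun z => (-4 * (C ^ 4)⁻¹) • sdKill G ε τ z) y := fun a b =>
    (differentiableAt_const _).mul (hK a b)
  rw [h1, covMat_add c hW' hK',
    covMat_smul c hi hW, covMat_smul c (differentiableAt_const _) hK, pderiv_const,
    pderiv_inv_pow hdh (h0 y hy)]
  simp

/-- The Leibniz rule yields two further terms, both zero: the divergence of the curvature contracted
with 𝓕, and the divergence of 𝓕. -/
theorem divergence_calH (hC : C ≠ 0) (hy : y ∈ Ω) (b : Fin 4) :
    divergence G (calH G ε τ h) b y = ∑ a, ∑ c, cinv G y a c * (-3 * (h y ^ 4)⁻¹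
          * (-(1 / 2) * C ^ 4 * (h y ^ 3)⁻¹ * ∑ s, upT G τ s y * sdWF G ε τ y s c)
          * sdWF G ε τ y a b
        + (h y ^ 3)⁻¹ * pair (cinv G y) (sdRiem G ε y a b)
          (∑ s, upT G τ s y • sdRiem G ε y s c)) := by
  have e : ∀ a c, invMetric G a c y * covDeriv₂ G (calH G ε τ h) c a b y =
      cinv G y a c * (-3 * (h y ^ 4)⁻¹
          * (-(1 / 2) * C ^ 4 * (h y ^ 3)⁻¹ * ∑ s, upT G τ s y * sdWF G ε τ y s c)
          * sdWF G ε τ y a b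
        + (h y ^ 3)⁻¹ * pair (cinv G y) (sdRiem G ε y a b)
          (∑ s, upT G τ s y • sdRiem G ε y s c))
      + (h y ^ 3)⁻¹ * 2 * (cinv G y a c * pair (cinv G y)
        (Matrix.of fun m n => (covDerivRiemann G c a b m n y : ℂ)) (sdKill G ε τ y))
      + (-4 * (C ^ 4)⁻¹) * (cinv G y a c * covMat G c (sdKill G ε τ) y a b) := fun a c => by
    rw [covDeriv₂_eq, hD.covMat_calH hc h0 hh hC hy, hD.pderiv_root hc h0 hh hy]
    simp only [Matrix.add_apply, Matrix.smul_apply, smul_eq_mul, hD.covMat_sdWF hy]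
    rw [show invMetric G a c y = cinv G y a c from rfl]
    ring
  simp only [divergence, e, Finset.sum_add_distrib, ← Finset.mul_sum (a := (h y ^ 3)⁻¹ * 2),
    ← Finset.mul_sum (a := -4 * (C ^ 4)⁻¹), hD.sum_pair_covDerivRiemann hy, hD.div_sdKill hy]
  simp

/-- The constant term of 𝓗 reproduces σ, since (-½C⁴)(-4C⁻⁴) = 2, and its `sdWF` term reproduces the
derivative of h. -/
theorem formE_eq (hC : C ≠ 0) (hy : y ∈ Ω) (r : Fin 4) : formE G ε τ h r y =
    -(1 / 2) * C ^ 4 * ∑ s, upT G τ s y * calH G ε τ h s r y := by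
  simp only [formE, ernst, hD.pderiv_root hc h0 hh hy, hD.calF_eq hy, hD.calH_eq h0 hh hC hy,
    Matrix.add_apply, Matrix.smul_apply, smul_eq_mul, Finset.mul_sum, ← Finset.sum_add_distrib]
  refine Finset.sum_congr rfl fun s _ => ?_
  field_simp
  ring

theorem maxwell (hC : C ≠ 0) (hy : y ∈ Ω) (b : Fin 4) : divergence G (calH G ε τ h) b y =
    -(h y ^ 3)⁻¹ * ∑ s, upT G τ s y * calSS G ε τ h s b y
      - 3 * (h y)⁻¹ * ∑ r, ∑ r', invMetric G r r' y * formE G ε τ h r' y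
        * calH G ε τ h r b y := by
  rw [hD.divergence_calH hc h0 hh hC hy]
  refine ((hD.selfDualData hy).maxwell_identity (fun s => upT G τ s y) (h0 y hy) (hh y hy) b).trans ?_
  simp only [hD.formE_eq hc h0 hh hC hy, hD.calSS_eq hy, calH, hD.calSF_eq hy]
  rfl

omit hc in
theorem calH_antisymm (hC : C ≠ 0) (hy : y ∈ Ω) (a b : Fin 4) :
    calH G ε τ h b a y = -calH G ε τ h a b y := by
  have S := hD.selfDualData hy
  have h1 : sdWF G ε τ y b a = -sdWF G ε τ y a b := congrFun (congrFun S.WF_antisymm a) b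
  have h2 : sdKill G ε τ y b a = -sdKill G ε τ y a b := congrFun (congrFun S.F_antisymm a) b
  simp only [hD.calH_eq h0 hh hC hy, Matrix.add_apply, Matrix.smul_apply, h1, h2]
  simp [add_comm]

omit hc in
theorem hodge_calH (hC : C ≠ 0) (hy : y ∈ Ω) (a b : Fin 4) :
    hodge G ε (calH G ε τ h) a b y = -Complex.I * calH G ε τ h a b y := by
  have S := hD.selfDualData hy
  have hW : starMat (volEl ε y) (cinv G y) (sdWF G ε τ y) = -Complex.I • sdWF G ε τ y :=
    S.WF_selfDual
  rw [hD.hodge_eq (hD.calH_eq h0 hh hC hy)]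
  · rw [starMat_add, starMat_smul, starMat_smul, hW, S.F_selfDual, hD.calH_eq h0 hh hC hy]
    simp only [Matrix.add_apply, Matrix.smul_apply, smul_eq_mul]
    ring
  · ext i j
    have := hD.calH_antisymm h0 hh hC hy i j
    rw [hD.calH_eq h0 hh hC hy, hD.calH_eq h0 hh hC hy] at this
    exact this

theorem maxwell_quadratic (hC : C ≠ 0) (hy : y ∈ Ω) (b : Fin 4) :
    -(h y ^ 3)⁻¹ * ∑ s, upT G τ s y * calSS G ε τ h s b y
      - 3 * (h y)⁻¹ * ∑ r, ∑ r', invMetric G r r' y * formE G ε τ h r' y * calH G ε τ h r b y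
    = -(h y ^ 3)⁻¹ * ∑ s, upT G τ s y * calSS G ε τ h s b y
      + (3 / 2) * C ^ 4 * (h y ^ 7)⁻¹ * ∑ s, ∑ r, ∑ r', upT G τ s y * invMetric G r r' y
        * calSF G ε τ h s r' y * calSF G ε τ h r b y := by
  rw [sub_eq_add_neg]
  congr 1
  have e : ∀ r r', invMetric G r r' y * formE G ε τ h r' y * calH G ε τ h r b y
      = ∑ s, -(1 / 2) * C ^ 4 * (h y ^ 6)⁻¹ * (upT G τ s y * invMetric G r r' y
        * calSF G ε τ h s r' y * calSF G ε τ h r b y) := fun r r' => by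
    rw [hD.formE_eq hc h0 hh hC hy]
    simp only [calH, Finset.mul_sum, Finset.sum_mul]
    refine Finset.sum_congr rfl fun s _ => ?_
    rw [show h y ^ 6 = h y ^ 3 * h y ^ 3 by ring, mul_inv]
    ring
  simp only [e]
  have e2 : ∀ r, ∑ r', ∑ s, -(1 / 2) * C ^ 4 * (h y ^ 6)⁻¹ * (upT G τ s y * invMetric G r r' y
        * calSF G ε τ h s r' y * calSF G ε τ h r b y)
      = ∑ s, ∑ r', -(1 / 2) * C ^ 4 * (h y ^ 6)⁻¹ * (upT G τ s y * invMetric G r r' y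
        * calSF G ε τ h s r' y * calSF G ε τ h r b y) := fun r => Finset.sum_comm
  simp only [e2]
  rw [Finset.sum_comm]
  simp only [← Finset.mul_sum (a := -(1 / 2) * C ^ 4 * (h y ^ 6)⁻¹)]
  rw [show h y ^ 7 = h y * h y ^ 6 by ring, mul_inv]
  ring

end Root
end IsKillingVacuumOn

/-! ### From the manifold to chart components. -/

section Charts

variable {M : Type*} [TopologicalSpace M] [ChartedSpace E4 M] [IsManifold (𝓡 4) ∞ M]
  {e : OpenPartialHomeomorph M E4}

theorem contMDiffOn_chartFrame (he : e ∈ IsManifold.maximalAtlas (𝓡 4) ∞ M) (i : Fin 4) :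
    ContMDiffOn (𝓡 4) (𝓡 4).tangent ∞
      (fun y => (⟨e.symm y, chartFrame e y i⟩ : TangentBundle (𝓡 4) M)) e.target := by
  have h1 := (contMDiffOn_symm_of_mem_maximalAtlas he).contMDiffOn_tangentMapWithin
    (m := ∞) (by simp) e.open_target.uniqueMDiffOn
  have h2 : ContMDiff (𝓡 4) (𝓡 4).tangent ∞
      (fun y => (⟨y, EuclideanSpace.single i (1 : ℝ)⟩ : TangentBundle (𝓡 4) E4)) :=
    contMDiff_vectorSpace_iff_contDiff.2 contDiff_const
  refine (h1.comp h2.contMDiffOn fun y hy => hy).congr fun y hy => ?_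
  simp only [Function.comp, tangentMapWithin, chartFrame]
  rw [mfderivWithin_of_isOpen e.open_target hy]

theorem contDiffOn_inner (g : LorentzMetric M) (he : e ∈ IsManifold.maximalAtlas (𝓡 4) ∞ M)
    {v w : ∀ y : E4, TangentSpace (𝓡 4) (e.symm y)}
    (hv : ContMDiffOn (𝓡 4) (𝓡 4).tangent ∞
      (fun y => (⟨e.symm y, v y⟩ : TangentBundle (𝓡 4) M)) e.target)
    (hw : ContMDiffOn (𝓡 4) (𝓡 4).tangent ∞
      (fun y => (⟨e.symm y, w y⟩ : TangentBundle (𝓡 4) M)) e.target) :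
    ContDiffOn ℝ ∞ (fun y => g.inner (e.symm y) (v y) (w y)) e.target := by
  rw [← contMDiffOn_iff_contDiffOn]
  intro y hy
  have hs := contMDiffOn_symm_of_mem_maximalAtlas he y hy
  have hg := (g.contMDiff (e.symm y)).comp_contMDiffWithinAt y hs
  have := ContMDiffWithinAt.clm_bundle_apply₂ (F₁ := E4) (F₂ := E4) (F₃ := ℝ)
    (E₁ := fun x : M => TangentSpace (𝓡 4) x) (E₂ := fun x : M => TangentSpace (𝓡 4) x)
    (E₃ := Bundle.Trivial M ℝ) (b := e.symm) (ψ := fun y => g.inner (e.symm y)) hg (hv y hy)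
    (hw y hy)
  rw [Bundle.contMDiffWithinAt_totalSpace] at this
  exact this.2

theorem smooth_metricComp (g : LorentzMetric M) (he : e ∈ IsManifold.maximalAtlas (𝓡 4) ∞ M) :
    EntrySmooth (metricComp g e) e.target := fun i j =>
  contDiffOn_inner g he (contMDiffOn_chartFrame he i) (contMDiffOn_chartFrame he j)

theorem smooth_lowerComp (g : LorentzMetric M) {T : ∀ x : M, TangentSpace (𝓡 4) x}
    (hT : ContMDiff (𝓡 4) (𝓡 4).tangent ∞ (fun x => (⟨x, T x⟩ : TangentBundle (𝓡 4) M)))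
    (he : e ∈ IsManifold.maximalAtlas (𝓡 4) ∞ M) (i : Fin 4) :
    ContDiffOn ℝ ∞ (lowerComp g T e i) e.target :=
  contDiffOn_inner g he (hT.comp_contMDiffOn (contMDiffOn_symm_of_mem_maximalAtlas he))
    (contMDiffOn_chartFrame he i)

/-- A null vector of the Gram matrix gives a tangent vector orthogonal to the whole coordinate
frame. The frame spans, so an orthonormal basis forces this vector to vanish. -/
theorem det_metricComp_ne (g : LorentzMetric M) (he : e ∈ IsManifold.maximalAtlas (𝓡 4) ∞ M)
    {y : E4} (hy : y ∈ e.target) : (metricComp g e y).det ≠ 0 := by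
  obtain ⟨b, hb⟩ := g.signature (e.symm y)
  intro hdet
  obtain ⟨c, hc0, hc⟩ := Matrix.exists_vecMul_eq_zero_iff.2 hdet
  set L : E4 →L[ℝ] TangentSpace (𝓡 4) (e.symm y) := mfderiv (𝓡 4) (𝓡 4) e.symm y with hL
  have hdiff : e.MDifferentiable (𝓡 4) (𝓡 4) :=
    ⟨(contMDiffOn_of_mem_maximalAtlas he).mdifferentiableOn (by simp),
      (contMDiffOn_symm_of_mem_maximalAtlas he).mdifferentiableOn (by simp)⟩
  set L' : TangentSpace (𝓡 4) (e.symm y) →L[ℝ] E4 := mfderiv (𝓡 4) (𝓡 4) e (e.symm y) with hL'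
  have h1 : ∀ v : E4, L' (L v) = v := fun v =>
    congrArg (fun A : E4 →L[ℝ] E4 => A v) (hdiff.comp_symm_deriv hy)
  -- Read as an endomorphism of the model space, the differential is surjective because it has a
  -- left inverse.
  let L₀ : E4 →L[ℝ] E4 := L
  have h2 : ∀ w, ∃ u : E4, L u = w :=
    LinearMap.surjective_of_injective (f := L₀.toLinearMap)
      (Function.LeftInverse.injective (g := (L' : E4 → E4)) h1)
  set v : E4 := ∑ i, c i • EuclideanSpace.single i (1 : ℝ) with hv
  have h3 : ∀ j, g.inner (e.symm y) (L v) (L (EuclideanSpace.single j 1)) = 0 := fun j => by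
    have := congrFun hc j
    simp only [Matrix.vecMul, dotProduct, metricComp, Matrix.of_apply, chartFrame, Pi.zero_apply]
      at this
    rw [hv, map_sum, map_sum, _root_.sum_apply, ← this]
    refine Finset.sum_congr rfl fun i _ => ?_
    rw [map_smul, map_smul]
    rfl
  clear_value v
  have h4 : ∀ w, g.inner (e.symm y) (L v) w = 0 := fun w => by
    obtain ⟨u, rfl⟩ := h2 w
    have hu : u = ∑ i, u i • EuclideanSpace.single i (1 : ℝ) := by
      ext j
      simp [Pi.single_apply]
    rw [hu, map_sum L, map_sum (g.inner (e.symm y) (L v))]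
    refine Finset.sum_eq_zero fun i _ => ?_
    rw [map_smul L, map_smul (g.inner (e.symm y) (L v)), h3, smul_zero]
  have h5 : L v = 0 := by
    rw [← b.sum_repr (L v)]
    refine Finset.sum_eq_zero fun j _ => ?_
    have h := h4 (b j)
    rw [← b.sum_repr (L v), map_sum, _root_.sum_apply] at h
    simp only [map_smul, _root_.smul_apply, hb, smul_eq_mul] at h
    have hj : b.repr (L v) j = 0 := by
      by_cases h0 : j = 0
      · simpa [h0] using h
      · simpa [h0] using h
    rw [hj, zero_smul]
  have h6 : v = 0 := by rw [← h1 v, h5, map_zero]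
  apply hc0
  ext i
  have := congrArg (fun u : E4 => u i) h6
  simpa [hv, Pi.single_apply] using this

end Charts

theorem isAlternating₄_volComp {M : Type*} [TopologicalSpace M] [ChartedSpace E4 M]
    [IsManifold (𝓡 4) ∞ M] {g : LorentzMetric M} (vol : VolumeForm g)
    (e : OpenPartialHomeomorph M E4) (y : E4) :
    IsAlternating₄ fun a b c d => volComp vol e a b c d y := by
  have key : ∀ (a b c d : Fin 4) (i j : Fin 4), i ≠ j →
      vol.form (e.symm y) ((fun k => chartFrame e y (![a, b, c, d] k)) ∘ Equiv.swap i j)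
        = -volComp vol e a b c d y := fun a b c d i j hij =>
    (vol.form (e.symm y)).map_swap _ hij
  refine ⟨fun a b c d => ?_, fun a b c d => ?_, fun a b c d => ?_⟩
  · rw [← key a b c d 0 1 (by decide)]
    simp only [volComp]
    congr 1
    ext k
    fin_cases k <;> rfl
  · rw [← key a b c d 1 2 (by decide)]
    simp only [volComp]
    congr 1
    ext k
    fin_cases k <;> rfl
  · rw [← key a b c d 2 3 (by decide)]
    simp only [volComp]
    congr 1
    ext k
    fin_cases k <;> rfl

theorem volComp_eq {M : Type*} [TopologicalSpace M] [ChartedSpace E4 M]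
    [IsManifold (𝓡 4) ∞ M] {g : LorentzMetric M} (vol : VolumeForm g)
    (e : OpenPartialHomeomorph M E4) (y : E4) :
    volComp vol e 0 1 2 3 y = vol.form (e.symm y) (chartFrame e y) := by
  simp only [volComp]
  congr 1
  ext k
  fin_cases k <;> rfl

/-- The coordinate components of a vacuum metric, its volume form and a Killing field. -/
theorem isKillingVacuumOn_chart {M : Type*} [TopologicalSpace M] [ChartedSpace E4 M]
    [IsManifold (𝓡 4) ∞ M] {g : LorentzMetric M} (vol : VolumeForm g) (hvac : IsVacuum g)
    {T : ∀ x : M, TangentSpace (𝓡 4) x} (hT : IsKilling g T)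
    {e : OpenPartialHomeomorph M E4} (he : e ∈ IsManifold.maximalAtlas (𝓡 4) ∞ M)
    {Ω : Set E4} (hΩ : IsOpen Ω) (hΩe : Ω ⊆ e.target) :
    IsKillingVacuumOn (metricComp g e) (volComp vol e) (lowerComp g T e) Ω where
  isOpen := hΩ
  smooth i j := (smooth_metricComp g he i j).mono hΩe
  symm y _ := by
    ext i j
    exact g.symm _ _ _
  det_ne y hy := det_metricComp_ne g he (hΩe hy)
  alternating := isAlternating₄_volComp vol e
  vol_sq y _ := by
    rw [volComp_eq, vol.sq_eq]
    rfl
  vol_cont := ((vol.continuousOn e he).mono hΩe).congr fun y _ => volComp_eq vol e y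
  smooth_cov i := (smooth_lowerComp g hT.contMDiff he i).mono hΩe
  killing y hy := hT.killing e he y (hΩe hy)
  ricci y hy := hvac e he y (hΩe hy)

end MarsSimon
open MarsSimon
theorem mainTheorem1 {M : Type*} [TopologicalSpace M] [ChartedSpace E4 M]
    [IsManifold (𝓡 4) ∞ M]
    (g : LorentzMetric M) (vol : VolumeForm g) (hvac : IsVacuum g)
    (T : ∀ x : M, TangentSpace (𝓡 4) x) (hT : IsKilling g T)
    (e : OpenPartialHomeomorph M E4) (he : e ∈ IsManifold.maximalAtlas (𝓡 4) ∞ M)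
    (G : E4 → Matrix (Fin 4) (Fin 4) ℝ) (hG : G = metricComp g e)
    (ε : Fin 4 → Fin 4 → Fin 4 → Fin 4 → E4 → ℝ) (hε : ε = volComp vol e)
    (τ : Fin 4 → E4 → ℝ) (hτ : τ = lowerComp g T e)
    -- the function `q` is a continuous branch of `(-𝓕²)^{1/4}` on `U`, where `𝓕² ≠ 0`
    (U : Set M) (hU : IsOpen U) (q : M → ℂ) (hq : ContinuousOn q U)
    (hF : ∀ y ∈ e.target, e.symm y ∈ U → calFsq G ε τ y ≠ 0)
    (hroot : ∀ y ∈ e.target, e.symm y ∈ U → q (e.symm y) ^ 4 = -calFsq G ε τ y)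
    (C : ℂ) (hC : C ≠ 0)
    (h : E4 → ℂ) (hh : h = fun y => C * q (e.symm y)) :
    ∀ y ∈ e.target, e.symm y ∈ U →
      -- `h` and `𝓗` are differentiable
      DifferentiableAt ℝ h y ∧
      (∀ a b, DifferentiableAt ℝ (calH G ε τ h a b) y) ∧
      -- `𝓗` is a self-dual `2`-form
      (∀ a b, calH G ε τ h b a y = -calH G ε τ h a b y) ∧
      (∀ a b, hodge G ε (calH G ε τ h) a b y = -Complex.I * calH G ε τ h a b y) ∧
      -- `E_r = -½ C⁴ T^s 𝓗_{sr}`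
      (∀ r, formE G ε τ h r y
        = -(1 / 2) * C ^ 4 * ∑ s, upT G τ s y * calH G ε τ h s r y) ∧
      -- the Maxwell equation
      (∀ b, divergence G (calH G ε τ h) b y
        = -(h y ^ 3)⁻¹ * ∑ s, upT G τ s y * calSS G ε τ h s b y
          - 3 * (h y)⁻¹ * ∑ r, ∑ r', invMetric G r r' y * formE G ε τ h r' y
              * calH G ε τ h r b y) ∧
      -- its right-hand side is quadratic in `𝓢`
      (∀ b, -(h y ^ 3)⁻¹ * ∑ s, upT G τ s y * calSS G ε τ h s b y
          - 3 * (h y)⁻¹ * ∑ r, ∑ r', invMetric G r r' y * formE G ε τ h r' y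
              * calH G ε τ h r b y
        = -(h y ^ 3)⁻¹ * ∑ s, upT G τ s y * calSS G ε τ h s b y
          + (3 / 2) * C ^ 4 * (h y ^ 7)⁻¹ * ∑ s, ∑ r, ∑ r', upT G τ s y * invMetric G r r' y
              * calSF G ε τ h s r' y * calSF G ε τ h r b y) := by
  subst hG hε hτ
  -- The claims are local, so all the coordinate results are applied on the part of the chart that
  -- lies over `U`.
  set Ω : Set E4 := e.target ∩ e.symm ⁻¹' U with hΩ
  have hD := isKillingVacuumOn_chart vol hvac hT he (e.isOpen_inter_preimage_symm hU)
    Set.inter_subset_left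
  have hc : ContinuousOn h Ω := by
    rw [hh]
    exact continuousOn_const.mul (hq.comp (e.continuousOn_symm.mono Set.inter_subset_left)
      fun z hz => hz.2)
  have hpow : ∀ z ∈ Ω, h z ^ 4 =
      -C ^ 4 * IsKillingVacuumOn.sdNorm (metricComp g e) (volComp vol e) (lowerComp g T e) z :=
    fun z hz => by
      rw [hh, ← hD.calFsq_eq hz, mul_pow, hroot z hz.1 hz.2]
      ring
  have h0 : ∀ z ∈ Ω, h z ≠ 0 := fun z hz hz0 => by
    have h1 := hpow z hz
    rw [hz0, ← hD.calFsq_eq hz] at h1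
    have h2 : -C ^ 4 * calFsq (metricComp g e) (volComp vol e) (lowerComp g T e) z ≠ 0 :=
      mul_ne_zero (neg_ne_zero.2 (pow_ne_zero 4 hC)) (hF z hz.1 hz.2)
    exact h2 (by rw [← h1]; ring)
  intro y hy hyU
  have hyΩ : y ∈ Ω := ⟨hy, hyU⟩
  exact ⟨hD.differentiableAt_root hc h0 hpow hyΩ,
    hD.entryDiff_calH hc h0 hpow hC hyΩ,
    hD.calH_antisymm h0 hpow hC hyΩ,
    hD.hodge_calH h0 hpow hC hyΩ,
    hD.formE_eq hc h0 hpow hC hyΩ,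
    hD.maxwell hc h0 hpow hC hyΩ,
    hD.maxwell_quadratic hc h0 hpow hC hyΩ⟩
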